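/- Let $d \ge 2$ be an integer, let $\mathbb{k}$ be a field, and let $0 \le c < \epsilon_d := \frac{1}{2^{2d+1} d}$. For each $n$ let $X = X(n, c/n^{1/d})$ be the clique complex (the simplicial complex whose faces are the nonempty cliques) of the binomial random graph $G(n,p)$ on $n$ vertices in which each edge is present independently with probability $p = c/n^{1/d}$. Let $\beta_d(X;\mathbb{k}) = \dim_{\mathbb{k}} H_d(X;\mathbb{k})$, where $H_d$ is simplicial homology. Then, as $n \to \infty$: 1. $\beta_d(X;\mathbb{k})$ converges in distribution to a Poisson random variable with mean $$\frac{c^{2d(d+1)}}{2^{d+1}(d+1)!};$$ 2. with probability tending to $1$, $H_d(X;\mathbb{k})$ is generated by the copies in $X$ of the boundary of the $(d+1)$-dimensional cross-polytope. That is, every $d$-cycle of $X$ with coefficients in $\mathbb{k}$ is, modulo $d$-boundaries of $X$, a $\mathbb{k}$-linear combination of $d$-cycles each of which is supported on a subcomplex of $X$ isomorphic to the boundary of the $(d+1)$-dimensional cross-polytope, i.e. to the clique complex of the complete $(d+1)$-partite graph with two vertices in each part. (For $c = 0$ the Poisson distribution with mean $0$ is the point mass at $0$.) -/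

import Mathlib

open MeasureTheory ProbabilityTheory Filter
open scoped NNReal Topology

set_option maxSynthPendingDepth 3

noncomputable section

/-- The clique complex (flag complex) of a graph: its faces are the nonempty finite cliques. -/
def SimpleGraph.cliqueComplex {V : Type*} (G : SimpleGraph V) :
    PreAbstractSimplicialComplex V where
  faces := {s | s.Nonempty ∧ G.IsClique (s : Set V)}
  isRelLowerSet_faces := fun {_} hs =>
    ⟨hs.1, fun _ hts ht => ⟨ht, hs.2.subset (Finset.coe_subset.mpr hts)⟩⟩

namespace PreAbstractSimplicialComplex

section Homology

variable (k : Type*) [Field k] {V : Type*} [LinearOrder V]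

/-- The simplicial boundary operator over `k`, on formal combinations of finite vertex sets. A face
`{v₀ < v₁ < ⋯ < vⱼ}` is oriented by the order of its vertices and is sent to
`∑ i, (-1) ^ i • {v₀, …, vⱼ} \ {vᵢ}`. A single vertex has boundary zero (homology is unreduced). -/
def boundaryMap : (Finset V →₀ k) →ₗ[k] (Finset V →₀ k) :=
  Finsupp.linearCombination k fun σ : Finset V =>
    if 2 ≤ σ.card then
      ∑ v ∈ σ, Finsupp.single (σ.erase v) ((-1 : k) ^ (σ.filter (· < v)).card)
    else 0

/-- The `j`-chains of `K`: combinations of the faces of dimension `j`, that is with `j + 1`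
vertices. -/
def chains (j : ℕ) (K : PreAbstractSimplicialComplex V) : Submodule k (Finset V →₀ k) :=
  Finsupp.supported k k {σ | σ ∈ K.faces ∧ σ.card = j + 1}

/-- The `j`-cycles of `K`. -/
def cycles (j : ℕ) (K : PreAbstractSimplicialComplex V) : Submodule k (Finset V →₀ k) :=
  chains k j K ⊓ LinearMap.ker (boundaryMap k)

/-- The `j`-boundaries of `K`. -/
def boundaries (j : ℕ) (K : PreAbstractSimplicialComplex V) : Submodule k (Finset V →₀ k) :=
  (chains k (j + 1) K).map (boundaryMap k)

/-- The simplicial homology `H_j(K; k)`: cycles modulo boundaries. -/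
abbrev homology (j : ℕ) (K : PreAbstractSimplicialComplex V) : Type _ :=
  cycles k j K ⧸ (boundaries k j K).submoduleOf (cycles k j K)

/-- The Betti number `β_j(K; k) = dim_k H_j(K; k)`. -/
def betti (j : ℕ) (K : PreAbstractSimplicialComplex V) : ℕ :=
  Module.finrank k (homology k j K)

theorem boundaryMap_single (σ : Finset V) (hσ : 2 ≤ σ.card) (a : k) :
    boundaryMap k (Finsupp.single σ a) =
      a • ∑ v ∈ σ, Finsupp.single (σ.erase v) ((-1 : k) ^ (σ.filter (· < v)).card) := by
  simp [boundaryMap, Finsupp.linearCombination_single, hσ]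

theorem boundaryMap_boundaryMap (x : Finset V →₀ k) :
    boundaryMap k (boundaryMap k x) = 0 := by
  induction x using Finsupp.induction_linear with
  | zero => simp
  | add f g hf hg => simp [hf, hg]
  | single σ a =>
    by_cases h2 : 2 ≤ σ.card
    swap
    · simp [boundaryMap, Finsupp.linearCombination_single, h2]
    rw [boundaryMap_single k σ h2, map_smul, map_sum]
    by_cases h3 : 3 ≤ σ.card
    · have key : ∀ v ∈ σ, boundaryMap k
          (Finsupp.single (σ.erase v) ((-1 : k) ^ (σ.filter (· < v)).card)) =
          ∑ w ∈ σ.erase v, Finsupp.single ((σ.erase v).erase w)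
            ((-1 : k) ^ ((σ.filter (· < v)).card + ((σ.erase v).filter (· < w)).card)) := by
        intro v hv
        have hc : 2 ≤ (σ.erase v).card := by rw [Finset.card_erase_of_mem hv]; omega
        rw [boundaryMap_single k _ hc, Finset.smul_sum]
        refine Finset.sum_congr rfl fun w _ => ?_
        rw [Finsupp.smul_single, smul_eq_mul, pow_add]
      rw [Finset.sum_congr rfl key, Finset.sum_sigma']
      have sgn : ∀ v w : V, v ∈ σ → v < w →
          (-1 : k) ^ ((σ.filter (· < v)).card + ((σ.erase v).filter (· < w)).card) +
            (-1 : k) ^ ((σ.filter (· < w)).card + ((σ.erase w).filter (· < v)).card) = 0 := by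
        intro v w hv hvw
        have e1 : (σ.erase w).filter (· < v) = σ.filter (· < v) := by
          ext u
          simp only [Finset.mem_filter, Finset.mem_erase]
          constructor
          · rintro ⟨⟨_, h⟩, h'⟩
            exact ⟨h, h'⟩
          · rintro ⟨h, h'⟩
            exact ⟨⟨(h'.trans hvw).ne, h⟩, h'⟩
        have e2 : (σ.erase v).filter (· < w) = (σ.filter (· < w)).erase v := by
          ext u
          simp only [Finset.mem_filter, Finset.mem_erase]
          tauto
        have e3 : v ∈ σ.filter (· < w) := Finset.mem_filter.mpr ⟨hv, hvw⟩
        have e4 := Finset.card_erase_add_one e3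
        rw [e1, e2, ← e4]
        ring
      have hz := Finset.sum_involution (s := σ.sigma fun v => σ.erase v)
        (f := fun p => Finsupp.single ((σ.erase p.1).erase p.2)
            ((-1 : k) ^ ((σ.filter (· < p.1)).card + ((σ.erase p.1).filter (· < p.2)).card)))
        (fun p _ => ⟨p.2, p.1⟩)
        (by
          rintro ⟨v, w⟩ hp
          simp only [Finset.mem_sigma, Finset.mem_erase] at hp
          obtain ⟨hv, hwv, hw⟩ := hp
          simp only
          rw [Finset.erase_right_comm (a := w) (b := v), ← Finsupp.single_add]
          rcases lt_or_gt_of_ne hwv with h | h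
          · rw [add_comm, sgn w v hw h, Finsupp.single_zero]
          · rw [sgn v w hv h, Finsupp.single_zero])
        (by
          rintro ⟨v, w⟩ hp _ he
          simp only [Finset.mem_sigma, Finset.mem_erase] at hp
          simp only [Sigma.mk.injEq, heq_eq_eq] at he
          exact hp.2.1 he.1)
        (by
          rintro ⟨v, w⟩ hp
          simp only [Finset.mem_sigma, Finset.mem_erase] at hp ⊢
          exact ⟨hp.2.2, hp.2.1.symm, hp.1⟩)
        (by rintro ⟨v, w⟩ _; rfl)
      rw [hz, smul_zero]
    · have hz : ∀ v ∈ σ, boundaryMap k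
          (Finsupp.single (σ.erase v) ((-1 : k) ^ (σ.filter (· < v)).card)) = 0 := by
        intro v hv
        have hc : ¬ 2 ≤ (σ.erase v).card := by rw [Finset.card_erase_of_mem hv]; omega
        simp [boundaryMap, Finsupp.linearCombination_single, hc]
      rw [Finset.sum_eq_zero hz, smul_zero]

/-- Boundaries are cycles, so `homology` is the quotient it should be. -/
theorem boundaries_le_cycles (j : ℕ) (K : PreAbstractSimplicialComplex V) :
    boundaries k j K ≤ cycles k j K := by
  rw [boundaries, chains, Finsupp.supported_eq_span_single, Submodule.map_span,
    Submodule.span_le]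
  rintro _ ⟨_, ⟨σ, ⟨hσ, hc⟩, rfl⟩, rfl⟩
  refine ⟨?_, LinearMap.mem_ker.mpr (boundaryMap_boundaryMap k _)⟩
  rw [boundaryMap_single k σ (by omega), one_smul]
  refine Submodule.sum_mem _ fun v hv => Finsupp.single_mem_supported k _ ?_
  have h1 : (σ.erase v).card = j + 1 := by rw [Finset.card_erase_of_mem hv]; omega
  exact ⟨(K.isRelLowerSet_faces hσ).2 (Finset.erase_subset v σ)
    (Finset.card_pos.mp (by omega)), h1⟩

end Homology

/-- The boundary of the `(d + 1)`-dimensional cross-polytope: the clique complex of the complete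
`(d + 1)`-partite graph with two vertices in each part. -/
def crossPolytopeBoundary (d : ℕ) : PreAbstractSimplicialComplex (Fin (d + 1) × Fin 2) :=
  (SimpleGraph.completeEquipartiteGraph (d + 1) 2).cliqueComplex

/-- `L` is a copy, on vertices taken from `V`, of the boundary of the `(d + 1)`-dimensional
cross-polytope. -/
def IsCrossPolytopeBoundary {V : Type*} [DecidableEq V] (d : ℕ)
    (L : PreAbstractSimplicialComplex V) : Prop :=
  ∃ φ : Fin (d + 1) × Fin 2 ↪ V, L = (crossPolytopeBoundary d).map φ

/-- `H_d(K; k)` is generated by copies of the boundary of the `(d + 1)`-dimensional cross-polytope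
in `K`: modulo boundaries, every `d`-cycle of `K` is a `k`-linear combination of `d`-cycles of
subcomplexes of `K` that are such copies. -/
def HomologyGeneratedByCrossPolytopes (k : Type*) [Field k] {V : Type*} [LinearOrder V] (d : ℕ)
    (K : PreAbstractSimplicialComplex V) : Prop :=
  cycles k d K =
    boundaries k d K ⊔
      ⨆ L : {L : PreAbstractSimplicialComplex V // L ≤ K ∧ IsCrossPolytopeBoundary d L},
        cycles k d L.1

end PreAbstractSimplicialComplex

/-- The edge probability `c / n ^ (1 / d)` as a point of the unit interval. The truncation to
`[0, 1]` changes nothing when `c ≤ 1`, see `coe_edgeProb`. -/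
def edgeProb (c : ℝ≥0) (d n : ℕ) : unitInterval :=
  Set.projIcc 0 1 zero_le_one ((c : ℝ) / (n : ℝ) ^ (1 / (d : ℝ)))

theorem coe_edgeProb {c : ℝ≥0} (hc : c ≤ 1) (d n : ℕ) :
    (edgeProb c d n : ℝ) = (c : ℝ) / (n : ℝ) ^ (1 / (d : ℝ)) := by
  have h0 : 0 ≤ (c : ℝ) / (n : ℝ) ^ (1 / (d : ℝ)) := by positivity
  have h1 : (c : ℝ) / (n : ℝ) ^ (1 / (d : ℝ)) ≤ 1 := by
    rcases Nat.eq_zero_or_pos n with rfl | hn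
    · rcases Nat.eq_zero_or_pos d with rfl | hd
      · simpa using hc
      · have : (1 / (d : ℝ)) ≠ 0 := by positivity
        rw [Nat.cast_zero, Real.zero_rpow this]
        simp
    · have h : (1 : ℝ) ≤ (n : ℝ) ^ (1 / (d : ℝ)) :=
        Real.one_le_rpow (by exact_mod_cast hn) (by positivity)
      have hc' : (c : ℝ) ≤ 1 := by exact_mod_cast hc
      exact (div_le_one (by linarith)).mpr (hc'.trans h)
  rw [edgeProb, Set.projIcc_of_mem zero_le_one ⟨h0, h1⟩]

end

set_option linter.unusedSectionVars false

/-! The argument splits into a deterministic statement about sparse graphs and two probabilistic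
estimates.

Sparse graphs. A `d`-cycle is cut into pieces that are connected through common facets. The vertex
set `W` of a piece is tight: it grows from one facet by vertices joined to `d`-cliques already
reached. If the link of the piece at `v` bounds among the neighbours of `v` in `W`, the piece is
homologous to a cycle avoiding `v`. A `(d-1)`-cycle on fewer than `2d` vertices always bounds, and
on `2d` vertices it bounds unless these span an octahedral graph (`IsCliqueChain.exists_bd_eq_or`).
So if no vertex can be removed, all degrees in `W` are at least `2d`. Sparsity allows only `d|W|`
edges, hence all degrees equal `2d`, all links are octahedral, and tightness makes `W` itself
octahedral (`isOct_of_links`). This gives generation (`Sparse.octGenerated`). The same edge count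
shows that distinct octahedral sets share no facet and that their facets lie in no larger clique.
Evaluation at one facet per octahedral set therefore identifies homology with a coordinate space,
and the Betti number counts copies of the cross-polytope graph (`Sparse.betti_eq`,
`Sparse.card_isOct`).

Sparsity holds with high probability. A tight set with too many edges is explored breadth first and
stopped when the edges first exceed `d` per vertex; this yields `m` vertices with `d m + 1` recorded
edges. The clique to which a vertex is attached is located by the index of its last vertex, and
these indices are monotone, so the possible shapes number only an exponential in `m` times a power
of `m` (`exists_finset_shapes`). Each shape has expected number at most `n^m p^(dm+1) ≤ p c^(dm)`,
and for `c` below the threshold the sum over `m` is `O(p)`.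

Poisson limit. Let `N` be the number of copies and `λ` its mean. Copies with disjoint supports have
no common edge, and two distinct copies that meet span more than `d` edges per vertex. Hence `(m+1)
P(N=m+1) - λ P(N=m)` is `O(p)` (`abs_copies_octGraph_recursion_le`). Together with Markov's
inequality this recursion determines the limit (`tendsto_poisson_of_recursion`). -/

noncomputable section

namespace CliqueHomology

/-! ### Reduced chains: cones, links and signs. -/

section Chains

variable {V : Type*} [LinearOrder V] {k : Type*} [Field k]

/-- The sign with which `v` enters the oriented simplex `insert v τ`. -/
def sgn (k : Type*) [Field k] (v : V) (τ : Finset V) : k := (-1) ^ (τ.filter (· < v)).card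

theorem sgn_mul_self (v : V) (τ : Finset V) : sgn k v τ * sgn k v τ = 1 := by
  rw [sgn, ← pow_add, ← two_mul, pow_mul]; simp

theorem sgn_ne_zero (v : V) (τ : Finset V) : sgn k v τ ≠ 0 := fun h => by
  simpa [h] using sgn_mul_self (k := k) v τ

theorem sgn_mul_sgn_mul (v : V) (τ : Finset V) (a : k) : sgn k v τ * (sgn k v τ * a) = a := by
  rw [← mul_assoc, sgn_mul_self, one_mul]

theorem sgn_insert_of_lt {v w : V} {τ : Finset V} (h : w < v) (hw : w ∉ τ) :
    sgn k v (insert w τ) = -sgn k v τ := by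
  rw [sgn, sgn, Finset.filter_insert, if_pos h, Finset.card_insert_of_notMem (by simp [hw]),
    pow_succ]
  ring

theorem sgn_insert_of_gt {v w : V} {τ : Finset V} (h : v < w) :
    sgn k v (insert w τ) = sgn k v τ := by
  rw [sgn, sgn, Finset.filter_insert, if_neg h.not_gt]

/-- Exactly one of the two vertices precedes the other, so exchanging the order of insertion flips
one sign. This is the cancellation behind `∂∂ = 0`. -/
theorem sgn_mul_sgn_insert {v w : V} {τ : Finset V} (hv : v ∉ τ) (hw : w ∉ τ) (hvw : v ≠ w) :
    sgn k w τ * sgn k v (insert w τ) = -(sgn k v τ * sgn k w (insert v τ)) := by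
  rcases lt_or_gt_of_ne hvw with h | h
  · rw [sgn_insert_of_gt h, sgn_insert_of_lt h hv]; ring
  · rw [sgn_insert_of_lt h hw, sgn_insert_of_gt h]; ring

/-- The cone with apex `v` over a chain. -/
def cone (v : V) (x : Finset V → k) (τ : Finset V) : k :=
  if v ∈ τ then sgn k v (τ.erase v) * x (τ.erase v) else 0

/-- The link part of a chain at the vertex `v`. -/
def linkAt (v : V) (z : Finset V → k) (τ : Finset V) : k :=
  if v ∈ τ then 0 else sgn k v τ * z (insert v τ)

/-- The part of a chain away from the vertex `v`. -/
def away (v : V) (z : Finset V → k) (τ : Finset V) : k := if v ∈ τ then 0 else z τ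

theorem away_add_cone_linkAt (v : V) (z : Finset V → k) : away v z + cone v (linkAt v z) = z := by
  ext τ
  by_cases h : v ∈ τ
  · simp [away, cone, linkAt, h, sgn_mul_sgn_mul, Finset.insert_erase h]
  · simp [away, cone, h]

variable [Fintype V]

/-- The boundary in the reduced chain complex: chains are functions on finite vertex sets, and the
vertices are mapped to multiples of the empty simplex. -/
def bd : (Finset V → k) →ₗ[k] (Finset V → k) where
  toFun z τ := ∑ v ∈ τᶜ, sgn k v τ * z (insert v τ)
  map_add' x y := by ext τ; simp [mul_add, Finset.sum_add_distrib]
  map_smul' a x := by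
    ext τ; simp only [Pi.smul_apply, smul_eq_mul, RingHom.id_apply, Finset.mul_sum]
    exact Finset.sum_congr rfl fun _ _ => by ring

theorem bd_apply (z : Finset V → k) (τ : Finset V) :
    bd z τ = ∑ v ∈ τᶜ, sgn k v τ * z (insert v τ) := rfl

theorem bd_apply_of_notMem (z : Finset V → k) {v : V} {τ : Finset V} (hv : v ∉ τ) :
    bd z τ = bd (away v z) τ + linkAt v z τ := by
  have hv' : v ∈ τᶜ := by simpa
  rw [bd_apply, bd_apply, ← Finset.add_sum_erase _ _ hv', ← Finset.add_sum_erase _ _ hv', linkAt,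
    if_neg hv, away, if_pos (Finset.mem_insert_self _ _), mul_zero, zero_add, add_comm]
  congr 1
  refine Finset.sum_congr rfl fun w hw => ?_
  have : v ∉ insert w τ := by
    simp only [Finset.mem_erase] at hw
    simp [hv, hw.1.symm]
  rw [away, if_neg this]

theorem bd_linkAt_apply (z : Finset V → k) {v : V} {τ : Finset V} (hv : v ∉ τ) :
    bd (linkAt v z) τ = -(sgn k v τ * bd z (insert v τ)) := by
  have hv' : v ∈ τᶜ := by simpa
  rw [bd_apply, bd_apply, ← Finset.add_sum_erase _ _ hv', linkAt,
    if_pos (Finset.mem_insert_self _ _), mul_zero, zero_add, Finset.mul_sum,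
    ← Finset.sum_neg_distrib]
  have he : (insert v τ)ᶜ = τᶜ.erase v := by ext; simp
  rw [he]
  refine Finset.sum_congr rfl fun w hw => ?_
  simp only [Finset.mem_erase, Finset.mem_compl] at hw
  have hv2 : v ∉ insert w τ := by simp [hv, hw.1.symm]
  rw [linkAt, if_neg hv2, ← mul_assoc, sgn_mul_sgn_insert hv hw.2 hw.1.symm, Finset.insert_comm]
  ring

theorem bd_eq_zero_of_forall_mem {v : V} {x : Finset V → k} (hx : ∀ τ, v ∈ τ → x τ = 0)
    {τ : Finset V} (hτ : v ∈ τ) : bd x τ = 0 := by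
  rw [bd_apply]
  exact Finset.sum_eq_zero fun w _ => by rw [hx _ (Finset.mem_insert_of_mem hτ), mul_zero]

theorem bd_linkAt {z : Finset V → k} (hz : bd z = 0) (v : V) : bd (linkAt v z) = 0 := by
  ext τ
  by_cases hv : v ∈ τ
  · exact bd_eq_zero_of_forall_mem (v := v) (fun σ hσ => by rw [linkAt, if_pos hσ]) hv
  · rw [bd_linkAt_apply z hv, hz]; simp

/-- On faces without `v`, the boundary of a cycle splits into the boundary of its `v`-free part and
the link, and these must cancel. So the link always bounds away from `v`; what matters later is
whether it bounds inside the neighbourhood of `v`. -/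
theorem bd_away {z : Finset V → k} (hz : bd z = 0) (v : V) : bd (away v z) = -linkAt v z := by
  ext τ
  by_cases hv : v ∈ τ
  · rw [bd_eq_zero_of_forall_mem (v := v) (fun σ hσ => by rw [away, if_pos hσ]) hv]
    simp [linkAt, hv]
  · have := bd_apply_of_notMem z hv
    rw [hz, Pi.zero_apply] at this
    rw [Pi.neg_apply]
    exact eq_neg_of_add_eq_zero_left this.symm

theorem linkAt_cone {v : V} {x : Finset V → k} (hx : ∀ τ, v ∈ τ → x τ = 0) :
    linkAt v (cone v x) = x := by
  ext τ
  by_cases hv : v ∈ τ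
  · simp [linkAt, hv, hx]
  · simp [linkAt, cone, hv, sgn_mul_sgn_mul]

/-- Coning is a contracting homotopy. The formula needs no exception in low degree because the
complex is reduced. -/
theorem bd_cone {v : V} {x : Finset V → k} (hx : ∀ τ, v ∈ τ → x τ = 0) :
    bd (cone v x) = x - cone v (bd x) := by
  ext τ
  by_cases hv : v ∈ τ
  · have h := bd_linkAt_apply (cone v x) (Finset.notMem_erase v τ)
    rw [linkAt_cone hx, Finset.insert_erase hv] at h
    simp [hx τ hv, cone, hv, h, sgn_mul_sgn_mul]
  · have h0 : away v (cone v x) = 0 := by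
      ext σ
      by_cases h : v ∈ σ <;> simp [away, cone, h]
    rw [bd_apply_of_notMem _ hv, h0, linkAt_cone hx]
    simp [cone, hv]

theorem bd_congr {x y : Finset V → k} {τ : Finset V} (h : ∀ v ∉ τ, x (insert v τ) = y (insert v τ)) :
    bd x τ = bd y τ := by
  rw [bd_apply, bd_apply]
  exact Finset.sum_congr rfl fun v hv => by rw [h v (by simpa using hv)]

end Chains

/-! ### Pushing cycles off a vertex; cycles on few vertices. -/

section CliqueChains

variable {V : Type*} [LinearOrder V] {k : Type*} [Field k]

/-- `z` is a combination of cliques of `G` inside `U` with `q` vertices each. -/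
def IsCliqueChain (G : SimpleGraph V) (q : ℕ) (U : Finset V) (z : Finset V → k) : Prop :=
  ∀ σ, z σ ≠ 0 → σ ⊆ U ∧ σ.card = q ∧ G.IsClique (σ : Set V)

open Classical in
/-- The neighbours of `v` in `U`. -/
def nbrs (G : SimpleGraph V) (U : Finset V) (v : V) : Finset V := U.filter (G.Adj v)

variable {G : SimpleGraph V} {q : ℕ} {U W : Finset V} {x z : Finset V → k} {v : V}

@[simp] theorem mem_nbrs {u : V} : u ∈ nbrs G U v ↔ u ∈ U ∧ G.Adj v u := by simp [nbrs]

theorem nbrs_subset : nbrs G U v ⊆ U := fun _ h => (mem_nbrs.mp h).1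

theorem nbrs_subset_erase : nbrs G U v ⊆ U.erase v := fun u h => by
  rw [mem_nbrs] at h
  exact Finset.mem_erase.mpr ⟨h.2.ne', h.1⟩

theorem nbrs_mono (h : U ⊆ W) : nbrs G U v ⊆ nbrs G W v := fun u hu => by
  rw [mem_nbrs] at hu ⊢
  exact ⟨h hu.1, hu.2⟩

namespace IsCliqueChain

theorem zero : IsCliqueChain G q U (0 : Finset V → k) := fun _ h => absurd rfl h

theorem add (hx : IsCliqueChain G q U x) (hz : IsCliqueChain G q U z) :
    IsCliqueChain G q U (x + z) := fun σ h => by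
  by_cases h0 : x σ = 0
  · exact hz σ fun h1 => h (by simp [h0, h1])
  · exact hx σ h0

theorem smul (hx : IsCliqueChain G q U x) (a : k) : IsCliqueChain G q U (a • x) :=
  fun σ h => hx σ fun h1 => h (by simp [h1])

theorem neg (hx : IsCliqueChain G q U x) : IsCliqueChain G q U (-x) :=
  fun σ h => hx σ fun h1 => h (by simp [h1])

theorem sub (hx : IsCliqueChain G q U x) (hz : IsCliqueChain G q U z) :
    IsCliqueChain G q U (x - z) := by
  rw [sub_eq_add_neg]; exact hx.add hz.neg

theorem mono (hx : IsCliqueChain G q U x) (h : U ⊆ W) : IsCliqueChain G q W x :=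
  fun σ hσ => ⟨(hx σ hσ).1.trans h, (hx σ hσ).2⟩

theorem eq_zero_of_mem (hx : IsCliqueChain G q U x) (hv : v ∉ U) (τ : Finset V) (hτ : v ∈ τ) :
    x τ = 0 := by
  by_contra h
  exact hv ((hx τ h).1 hτ)

theorem link (hz : IsCliqueChain G (q + 1) U z) (v : V) :
    IsCliqueChain G q (nbrs G U v) (linkAt v z) := by
  intro σ hσ
  have hv : v ∉ σ := fun h => hσ (by simp [linkAt, h])
  rw [linkAt, if_neg hv] at hσ
  obtain ⟨h1, h2, h3⟩ := hz _ (right_ne_zero_of_mul hσ)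
  rw [Finset.card_insert_of_notMem hv] at h2
  rw [Finset.coe_insert] at h3
  refine ⟨fun u hu => mem_nbrs.mpr ⟨h1 (Finset.mem_insert_of_mem hu), ?_⟩, by omega,
    h3.subset (Set.subset_insert _ _)⟩
  exact h3 (Set.mem_insert _ _) (Set.mem_insert_of_mem _ hu) fun h => hv (h ▸ hu)

theorem awayFrom (hz : IsCliqueChain G q U z) (v : V) : IsCliqueChain G q (U.erase v) (away v z) := by
  intro σ hσ
  have hv : v ∉ σ := fun h => hσ (by simp [away, h])
  rw [away, if_neg hv] at hσ
  obtain ⟨h1, h2⟩ := hz _ hσ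
  exact ⟨Finset.subset_erase.mpr ⟨h1, hv⟩, h2⟩

theorem coneOver (hx : IsCliqueChain G q U x) (hU : ∀ u ∈ U, G.Adj v u) :
    IsCliqueChain G (q + 1) (insert v U) (cone v x) := by
  intro σ hσ
  have hv : v ∈ σ := by
    by_contra h
    exact hσ (by simp [cone, h])
  rw [cone, if_pos hv] at hσ
  obtain ⟨h1, h2, h3⟩ := hx _ (right_ne_zero_of_mul hσ)
  rw [← Finset.insert_erase hv]
  refine ⟨Finset.insert_subset_insert v h1, ?_, ?_⟩
  · rw [Finset.card_insert_of_notMem (Finset.notMem_erase _ _), h2]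
  · rw [Finset.coe_insert]
    exact h3.insert fun u hu _ => hU u (h1 hu)

end IsCliqueChain

variable [Fintype V]

/-- A cycle can be pushed off a vertex at which its link bounds. -/
theorem IsCliqueChain.exists_push_off (hz : IsCliqueChain G (q + 1) U z) (hb : bd z = 0)
    (hv : v ∈ U) (hx : IsCliqueChain G (q + 1) (nbrs G U v) x) (hxb : bd x = linkAt v z) :
    IsCliqueChain G (q + 1) (U.erase v) (away v z + x) ∧
      bd (away v z + x) = 0 ∧
      IsCliqueChain G (q + 2) U (cone v x) ∧
      z + bd (cone v x) = away v z + x := by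
  have hx0 : ∀ τ, v ∈ τ → x τ = 0 := hx.eq_zero_of_mem (by simp)
  refine ⟨(hz.awayFrom v).add (hx.mono nbrs_subset_erase), ?_, ?_, ?_⟩
  · rw [map_add, bd_away hb, hxb, neg_add_cancel]
  · refine (hx.coneOver fun u hu => (mem_nbrs.mp hu).2).mono ?_
    exact Finset.insert_subset hv nbrs_subset
  · rw [bd_cone hx0, hxb]
    nth_rewrite 1 [← away_add_cone_linkAt v z]
    abel

/-- A cycle on at most `2 q` vertices bounds, unless the vertices span an octahedral graph. -/
theorem IsCliqueChain.exists_bd_eq_or (G : SimpleGraph V) (n : ℕ) : ∀ (q : ℕ) (U : Finset V)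
    (z : Finset V → k), U.card = n → IsCliqueChain G q U z → bd z = 0 → n ≤ 2 * q →
    (∃ x, IsCliqueChain G (q + 1) U x ∧ bd x = z) ∨
      (n = 2 * q ∧ ∀ v ∈ U, (nbrs G U v).card + 2 = 2 * q) := by
  induction n using Nat.strong_induction_on with
  | _ n ih =>
  intro q U z hU hz hb hn
  by_contra! hcon
  obtain ⟨h1, h2⟩ := hcon
  -- For `q = 0` the empty simplex is a cycle that need not bound, and the empty vertex set counts
  -- as octahedral. For `q > 0` the only chain on no vertices is zero.
  rcases U.eq_empty_or_nonempty with rfl | hne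
  · rcases Nat.eq_zero_or_pos q with rfl | hq
    · have := h2 (by simpa using hU.symm)
      simp at this
    · refine h1 0 IsCliqueChain.zero ?_
      rw [map_zero]
      ext σ
      by_contra h
      obtain ⟨h3, h4, -⟩ := hz σ (Ne.symm h)
      rw [Finset.subset_empty.mp h3] at h4
      simp at h4
      omega
  obtain ⟨q, rfl⟩ : ∃ q', q = q' + 1 := ⟨q - 1, by have := hne.card_pos; omega⟩
  have key : ∀ v ∈ U, (nbrs G U v).card = 2 * q := by
    intro v hv
    -- If the link bounded, pushing `z` off `v` would leave a cycle on `n - 1 < 2 (q + 1)` vertices,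
    -- too few for the octahedral alternative, so `z` would bound.
    have nolink : ¬ ∃ x, IsCliqueChain G (q + 1) (nbrs G U v) x ∧ bd x = linkAt v z := by
      rintro ⟨x, hx, hxb⟩
      obtain ⟨p1, p2, p3, p4⟩ := hz.exists_push_off hb hv hx hxb
      have hc := Finset.card_erase_of_mem hv
      have hpos := hne.card_pos
      rcases ih (n - 1) (by omega) (q + 1) _ _ (by omega) p1 p2 (by omega) with ⟨y, hy, hyb⟩ | h
      · refine h1 (y - cone v x) ((hy.mono (Finset.erase_subset _ _)).sub p3) ?_
        rw [map_sub, hyb, ← p4]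
        abel
      · omega
    have hlt : (nbrs G U v).card < n := by
      have := Finset.card_le_card (nbrs_subset_erase (G := G) (U := U) (v := v))
      have hc := Finset.card_erase_of_mem hv
      have hpos := hne.card_pos
      omega
    by_cases hle : (nbrs G U v).card ≤ 2 * q
    · rcases ih _ hlt q _ _ rfl (hz.link v) (bd_linkAt hb v) hle with h | h
      · exact absurd h nolink
      · exact h.1
    -- Since `n ≤ 2 q + 2`, degree above `2 q` means that `v` is joined to all other vertices. Then
    -- the `v`-free part of `z` fills the link up to sign.
    · exfalso
      have he : nbrs G U v = U.erase v :=
        Finset.eq_of_subset_of_card_le nbrs_subset_erase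
          (by rw [Finset.card_erase_of_mem hv]; omega)
      refine nolink ⟨-away v z, ?_, ?_⟩
      · rw [he]; exact (hz.awayFrom v).neg
      · rw [map_neg, bd_away hb, neg_neg]
  obtain ⟨v, hv⟩ := hne
  have hc := Finset.card_le_card (nbrs_subset_erase (G := G) (U := U) (v := v))
  rw [key v hv, Finset.card_erase_of_mem hv] at hc
  -- Otherwise `n = 2 q + 1`, so `v` is joined to everything and `z` is the boundary of a cone with
  -- apex `v`.
  have hn2 : n = 2 * (q + 1) := by
    by_contra hlt
    have he : nbrs G U v = U.erase v :=
        Finset.eq_of_subset_of_card_le nbrs_subset_erase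
          (by rw [Finset.card_erase_of_mem hv, key v hv]; omega)
    obtain ⟨p1, p2, p3, p4⟩ := hz.exists_push_off (x := -away v z) hb hv
      (by rw [he]; exact (hz.awayFrom v).neg) (by rw [map_neg, bd_away hb, neg_neg])
    refine h1 (-cone v (-away v z)) p3.neg ?_
    rw [add_neg_cancel] at p4
    rw [map_neg]
    exact (eq_neg_of_add_eq_zero_left p4).symm
  obtain ⟨w, hw, hne⟩ := h2 hn2
  rw [key w hw] at hne
  omega

end CliqueChains

end CliqueHomology

end

noncomputable section

namespace CliqueHomology

/-! ### Tight vertex sets with octahedral links. -/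

section Tight

variable {V : Type*} [LinearOrder V]

/-- `W` can be exhausted from the `(d + 1)`-clique `R` by repeatedly adding a vertex which is
adjacent to all vertices of a `d`-clique reached before. -/
def TightFrom (G : SimpleGraph V) (d : ℕ) (R W : Finset V) : Prop :=
  R ⊆ W ∧ R.card = d + 1 ∧ G.IsClique (R : Set V) ∧ ∀ U, R ⊆ U → U ⊂ W →
    ∃ D ⊆ U, D.card = d ∧ G.IsClique (D : Set V) ∧ ∃ v ∈ W, v ∉ U ∧ ∀ u ∈ D, G.Adj v u

/-- Every tightly connected vertex set spans at most `d` edges per vertex. -/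
def Sparse (G : SimpleGraph V) (d : ℕ) : Prop :=
  ∀ R W, TightFrom G d R W → ∑ v ∈ W, (nbrs G W v).card ≤ 2 * d * W.card

/-- `W` spans the graph of the `(d + 1)`-dimensional cross-polytope. -/
def IsOct (G : SimpleGraph V) (d : ℕ) (W : Finset V) : Prop :=
  W.card = 2 * d + 2 ∧ ∀ v ∈ W, (nbrs G W v).card = 2 * d

variable {G : SimpleGraph V} {d : ℕ} {R W : Finset V}

/-- Pigeonhole. Used mostly with `T` an octahedral link and `S` the neighbourhood of a vertex in it,
which misses only that vertex and its antipode. -/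
theorem mem_of_card_add_two {S T : Finset V} {a b t : V} (hS : S ⊆ T) (ha : a ∈ T) (hb : b ∈ T)
    (hab : a ≠ b) (haS : a ∉ S) (hbS : b ∉ S) (hc : S.card + 2 = T.card) (ht : t ∈ T)
    (hta : t ≠ a) (htb : t ≠ b) : t ∈ S := by
  by_contra h
  have hsub : insert a (insert b (insert t S)) ⊆ T :=
    Finset.insert_subset ha (Finset.insert_subset hb (Finset.insert_subset ht hS))
  have := Finset.card_le_card hsub
  rw [Finset.card_insert_of_notMem (by simp [hab, hta.symm, haS]),
    Finset.card_insert_of_notMem (by simp [htb.symm, hbS]), Finset.card_insert_of_notMem h] at this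
  omega

/-- A tightly connected set in which all links are octahedral is octahedral. -/
theorem isOct_of_links (hd : 2 ≤ d) (hW : TightFrom G d R W)
    (h1 : ∀ v ∈ W, (nbrs G W v).card = 2 * d)
    (h2 : ∀ v ∈ W, ∀ u ∈ nbrs G W v, (nbrs G (nbrs G W v) u).card + 2 = 2 * d) :
    IsOct G d W := by
  obtain ⟨hRW, hRc, hR, hext⟩ := hW
  obtain ⟨v, hvR⟩ : R.Nonempty := Finset.card_pos.mp (by omega)
  have hv := hRW hvR
  -- In the octahedral link of `u` the non-adjacent vertices `v` and `x` are antipodal, so `x` is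
  -- joined to every other neighbour of `u`.
  have helper : ∀ u ∈ W, G.Adj v u → ∀ x ∈ W, G.Adj u x → x ≠ v → ¬ G.Adj v x →
      ∀ t ∈ W, G.Adj u t → t ≠ v → t ≠ x → G.Adj x t := by
    intro u hu hvu x hx hux hxv hvx t ht hut htv htx
    have hxN : x ∈ nbrs G W u := mem_nbrs.mpr ⟨hx, hux⟩
    have hvN : v ∈ nbrs G W u := mem_nbrs.mpr ⟨hv, hvu.symm⟩
    have := mem_of_card_add_two (S := nbrs G (nbrs G W u) x) (a := x) (b := v) nbrs_subset hxN hvN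
      hxv (by simp) (fun h => hvx (mem_nbrs.mp h).2.symm) ((h2 u hu x hxN).trans (h1 u hu).symm)
      (mem_nbrs.mpr ⟨ht, hut⟩) htx htv
    exact (mem_nbrs.mp this).2
  obtain ⟨u, huN⟩ : (nbrs G W v).Nonempty := Finset.card_pos.mp (by rw [h1 v hv]; omega)
  obtain ⟨hu, hvu⟩ := mem_nbrs.mp huN
  -- The antipode of `v` in the link of `u`: of the `2 d` neighbours of `u`, only `2 d - 2` are
  -- neighbours of `v`, and one more is `v` itself.
  obtain ⟨x, hx, hux, hxv, hvx⟩ : ∃ x ∈ W, G.Adj u x ∧ x ≠ v ∧ ¬ G.Adj v x := by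
    by_contra! hcon
    have hsub : nbrs G W u ⊆ insert v (nbrs G (nbrs G W v) u) := by
      intro x hx
      obtain ⟨hxW, hux⟩ := mem_nbrs.mp hx
      by_cases hxv : x = v
      · simp [hxv]
      · exact Finset.mem_insert_of_mem
          (mem_nbrs.mpr ⟨mem_nbrs.mpr ⟨hxW, hcon x hxW hux hxv⟩, hux⟩)
    have h3 := Finset.card_le_card hsub
    have h4 := Finset.card_insert_le v (nbrs G (nbrs G W v) u)
    have h5 := h2 v hv u huN
    rw [h1 u hu] at h3
    omega
  have hNx : nbrs G W v ⊆ nbrs G W x := by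
    intro t htN
    obtain ⟨ht, hvt⟩ := mem_nbrs.mp htN
    refine mem_nbrs.mpr ⟨ht, ?_⟩
    have htx : t ≠ x := fun h => hvx (h ▸ hvt)
    by_cases htu : t = u
    · exact htu ▸ hux.symm
    by_cases hut : G.Adj u t
    · exact helper u hu hvu x hx hux hxv hvx t ht hut hvt.ne' htx
    -- Here `t` is the antipode of `u` in the link of `v`. A common neighbour `s` of `v` and `u`,
    -- which exists because `2 d - 2 > 0`, is joined to `x` and to `t` and takes over the role of
    -- `u`.
    · obtain ⟨s, hs⟩ : (nbrs G (nbrs G W v) u).Nonempty :=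
        Finset.card_pos.mp (by have := h2 v hv u huN; omega)
      obtain ⟨hsN, hus⟩ := mem_nbrs.mp hs
      obtain ⟨hsW, hvs⟩ := mem_nbrs.mp hsN
      have hsx : s ≠ x := fun h => hvx (h ▸ hvs)
      have hst : s ≠ t := fun h => hut (h ▸ hus)
      have hts : s ∈ nbrs G (nbrs G W v) t :=
        mem_of_card_add_two (a := t) (b := u) nbrs_subset htN huN htu (by simp)
          (fun h => hut (mem_nbrs.mp h).2.symm) ((h2 v hv t htN).trans (h1 v hv).symm) hsN
          hst hus.ne'
      exact helper s hsW hvs x hx (helper u hu hvu x hx hux hxv hvx s hsW hus hvs.ne' hsx).symm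
        hxv hvx t ht (mem_nbrs.mp hts).2.symm hvt.ne' htx
  have hNx' : nbrs G W v = nbrs G W x :=
    Finset.eq_of_subset_of_card_le hNx (by rw [h1 v hv, h1 x hx])
  have hUW : insert v (insert x (nbrs G W v)) ⊆ W :=
    Finset.insert_subset hv (Finset.insert_subset hx nbrs_subset)
  have hxN : x ∉ nbrs G W v := fun h => hvx (mem_nbrs.mp h).2
  have hUc : (insert v (insert x (nbrs G W v))).card = 2 * d + 2 := by
    rw [Finset.card_insert_of_notMem (by simp [hxv.symm]), Finset.card_insert_of_notMem hxN,
      h1 v hv]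
  refine ⟨?_, h1⟩
  rcases hUW.eq_or_ssubset with he | hlt
  · rw [← he, hUc]
  exfalso
  -- The set formed by `v`, `x` and their common neighbours contains the root clique. If it were
  -- proper, tightness would join an outside vertex `w` to one of its members; but each member
  -- already has its `2 d` neighbours inside.
  obtain ⟨D, hDU, hDc, -, w, hw, hwU, hwD⟩ := hext _ (fun r hr => by
    by_cases hrv : r = v
    · simp [hrv]
    · exact Finset.mem_insert_of_mem (Finset.mem_insert_of_mem
        (mem_nbrs.mpr ⟨hRW hr, hR hvR hr (Ne.symm hrv)⟩))) hlt
  obtain ⟨t, ht⟩ : D.Nonempty := Finset.card_pos.mp (by omega)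
  have hwt := hwD t ht
  simp only [Finset.mem_insert, not_or] at hwU
  obtain ⟨hwv, hwx, hwN⟩ := hwU
  have htU := hDU ht
  rw [Finset.mem_insert, Finset.mem_insert] at htU
  rcases htU with rfl | rfl | htN
  · exact hwN (mem_nbrs.mpr ⟨hw, hwt.symm⟩)
  · exact hwN (hNx' ▸ mem_nbrs.mpr ⟨hw, hwt.symm⟩)
  · obtain ⟨htW, hvt⟩ := mem_nbrs.mp htN
    have htx := (mem_nbrs.mp (hNx htN)).2
    have hsub : nbrs G (nbrs G W v) t ⊆ nbrs G W t := fun s hs =>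
      mem_nbrs.mpr ⟨(mem_nbrs.mp (mem_nbrs.mp hs).1).1, (mem_nbrs.mp hs).2⟩
    have := mem_of_card_add_two (a := v) (b := x) hsub (mem_nbrs.mpr ⟨hv, hvt.symm⟩)
      (mem_nbrs.mpr ⟨hx, htx.symm⟩) hxv.symm (fun h => by simpa using (mem_nbrs.mp h).1)
      (fun h => hxN (mem_nbrs.mp h).1) ((h2 v hv t htN).trans (h1 t htW).symm)
      (mem_nbrs.mpr ⟨hw, hwt.symm⟩) hwv hwx
    exact hwN (mem_nbrs.mp this).1

/-- In a sparse graph, minimum degree `2 d` on a tightly connected set forces all degrees. -/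
theorem Sparse.card_nbrs_eq (hG : Sparse G d) (hW : TightFrom G d R W)
    (h : ∀ v ∈ W, 2 * d ≤ (nbrs G W v).card) : ∀ v ∈ W, (nbrs G W v).card = 2 * d := by
  have h1 := hG R W hW
  have h2 : ∑ _v ∈ W, 2 * d = 2 * d * W.card := by rw [Finset.sum_const, smul_eq_mul, mul_comm]
  have h3 := (Finset.sum_eq_sum_iff_of_le h).mp
    (le_antisymm (Finset.sum_le_sum h) (h1.trans h2.ge))
  exact fun v hv => (h3 v hv).symm

end Tight

/-! ### Sparse graphs: generation by octahedral cycles. -/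

section Generation

variable {V : Type*} [LinearOrder V] [Fintype V] {k : Type*} [Field k] {G : SimpleGraph V} {d : ℕ}

/-- `z` is a boundary plus a sum of cycles on octahedral vertex sets. -/
def OctGenerated (G : SimpleGraph V) (d : ℕ) (z : Finset V → k) : Prop :=
  ∃ (w : Finset V → k) (c : Finset V → Finset V → k), IsCliqueChain G (d + 2) Finset.univ w ∧
    (∀ W, c W ≠ 0 → IsOct G d W) ∧ (∀ W, IsCliqueChain G (d + 1) W (c W) ∧ bd (c W) = 0) ∧
    z = bd w + ∑ W, c W

namespace OctGenerated

variable {z z' w : Finset V → k}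

theorem add (h : OctGenerated G d z) (h' : OctGenerated G d z') : OctGenerated G d (z + z') := by
  obtain ⟨w, c, h1, h2, h3, rfl⟩ := h
  obtain ⟨w', c', h1', h2', h3', rfl⟩ := h'
  refine ⟨w + w', c + c', h1.add h1', fun W hW => ?_, fun W => ⟨(h3 W).1.add (h3' W).1, ?_⟩, ?_⟩
  · by_cases h0 : c W = 0
    · exact h2' W fun h0' => hW (by simp [h0, h0'])
    · exact h2 W h0
  · rw [Pi.add_apply, map_add, (h3 W).2, (h3' W).2, add_zero]
  · simp only [map_add, Pi.add_apply, Finset.sum_add_distrib]; abel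

theorem of_bd (hw : IsCliqueChain G (d + 2) Finset.univ w) : OctGenerated G d (bd w) :=
  ⟨w, 0, hw, fun W hW => absurd rfl hW, fun W => ⟨IsCliqueChain.zero, map_zero _⟩, by simp⟩

theorem zero : OctGenerated G d (0 : Finset V → k) := by
  simpa using of_bd (d := d) (G := G) (k := k) IsCliqueChain.zero

theorem of_isOct {W : Finset V} (hW : IsOct G d W) (hz : IsCliqueChain G (d + 1) W z)
    (hb : bd z = 0) : OctGenerated G d z := by
  refine ⟨0, Pi.single W z, IsCliqueChain.zero, fun U hU => ?_, fun U => ?_, ?_⟩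
  · by_cases h : U = W
    · exact h ▸ hW
    · exact absurd (Pi.single_eq_of_ne h _) hU
  · by_cases h : U = W
    · subst h; simpa using ⟨hz, hb⟩
    · rw [Pi.single_eq_of_ne h]; exact ⟨IsCliqueChain.zero, map_zero _⟩
  · rw [map_zero, zero_add]; simp [Finset.sum_pi_single']

end OctGenerated

/-- Two simplices in the support of `z` sharing a facet. -/
def FacetAdj (d : ℕ) (z : Finset V → k) (σ τ : Finset V) : Prop :=
  z σ ≠ 0 ∧ z τ ≠ 0 ∧ (σ ∩ τ).card = d

open Classical in
/-- The part of `z` in the strongly connected component of the simplex `F`. -/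
def component (d : ℕ) (z : Finset V → k) (F σ : Finset V) : k :=
  if Relation.ReflTransGen (FacetAdj d z) F σ then z σ else 0

variable {z : Finset V → k} {F : Finset V} {U : Finset V}

theorem isCliqueChain_component (hz : IsCliqueChain G (d + 1) U z) :
    IsCliqueChain G (d + 1) U (component d z F) := fun σ hσ => hz σ fun h0 => hσ (by
  rw [component, h0, ite_self])

/-- The boundary at `τ` sees only the support simplices that contain `τ` as a facet. Any two of
these share `τ`, so they lie all inside the component or all outside. -/
theorem bd_component (hz : IsCliqueChain G (d + 1) U z) (hb : bd z = 0) :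
    bd (component d z F) = 0 := by
  ext τ
  by_cases h : ∃ v ∉ τ, component d z F (insert v τ) ≠ 0
  · obtain ⟨v, hv, hvz⟩ := h
    have hz0 : z (insert v τ) ≠ 0 := fun h0 => hvz (by rw [component, h0, ite_self])
    have hr : Relation.ReflTransGen (FacetAdj d z) F (insert v τ) := by
      by_contra hr
      exact hvz (by rw [component, if_neg hr])
    rw [← hb]
    refine bd_congr fun w hw => ?_
    by_cases hw0 : z (insert w τ) = 0
    · rw [component, hw0, ite_self]
    by_cases hwv : w = v
    · rw [hwv, component, if_pos hr]
    · rw [component, if_pos]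
      refine hr.tail ⟨hz0, hw0, ?_⟩
      have h1 : insert v τ ∩ insert w τ = τ := by
        ext t
        simp only [Finset.mem_inter, Finset.mem_insert]
        constructor
        · rintro ⟨rfl | h, rfl | h'⟩
          · exact absurd rfl hwv
          all_goals assumption
        · exact fun h => ⟨Or.inr h, Or.inr h⟩
      have h2 := (hz _ hz0).2.1
      rw [Finset.card_insert_of_notMem hv] at h2
      rw [h1]
      omega
  · push Not at h
    rw [bd_apply]
    exact Finset.sum_eq_zero fun v hv => by rw [h v (by simpa using hv), mul_zero]

open Classical in
/-- The vertices of a chain. -/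
def vertices (z : Finset V → k) : Finset V := Finset.univ.filter fun v => ∃ σ, z σ ≠ 0 ∧ v ∈ σ

theorem mem_vertices {v : V} : v ∈ vertices z ↔ ∃ σ, z σ ≠ 0 ∧ v ∈ σ := by simp [vertices]

theorem subset_vertices {σ : Finset V} (h : z σ ≠ 0) : σ ⊆ vertices z :=
  fun _ hv => mem_vertices.mpr ⟨σ, h, hv⟩

/-- A path of facet-adjacent simplices from `F` to a simplex not inside `U'` has a step that leaves
`U'`. The common face of the two simplices at that step is the required clique. -/
theorem tightFrom_vertices_component (hz : IsCliqueChain G (d + 1) U z) (hF : z F ≠ 0) :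
    TightFrom G d F (vertices (component d z F)) := by
  have hsup : ∀ σ, Relation.ReflTransGen (FacetAdj d z) F σ → component d z F σ ≠ 0 := by
    intro σ hσ
    rw [component, if_pos hσ]
    rcases Relation.ReflTransGen.cases_tail hσ with rfl | ⟨τ, -, h⟩
    · exact hF
    · exact h.2.1
  refine ⟨subset_vertices (hsup F .refl), (hz F hF).2.1, (hz F hF).2.2, fun U' hFU hUW => ?_⟩
  obtain ⟨w, hw, hwU⟩ := Finset.exists_of_ssubset hUW
  obtain ⟨σ, hσ, hwσ⟩ := mem_vertices.mp hw
  have hr : Relation.ReflTransGen (FacetAdj d z) F σ := by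
    by_contra hr
    exact hσ (by rw [component, if_neg hr])
  have step : ∀ σ, Relation.ReflTransGen (FacetAdj d z) F σ → ¬ σ ⊆ U' →
      ∃ τ τ', Relation.ReflTransGen (FacetAdj d z) F τ' ∧ FacetAdj d z τ τ' ∧ τ ⊆ U' ∧
        ¬ τ' ⊆ U' := by
    intro σ hσ
    induction hσ with
    | refl => exact fun h => absurd hFU h
    | @tail b c hb hbc ih =>
      intro hc
      by_cases hbU : b ⊆ U'
      · exact ⟨b, c, hb.tail hbc, hbc, hbU, hc⟩
      · exact ih hbU
  obtain ⟨τ, τ', hτ', ⟨hz1, hz2, hcard⟩, hτU, hτU'⟩ := step σ hr fun h => hwU (h hwσ)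
  obtain ⟨v, hv, hvU⟩ := Finset.not_subset.mp hτU'
  refine ⟨τ ∩ τ', Finset.inter_subset_left.trans hτU, hcard,
    (hz τ hz1).2.2.subset (Finset.coe_subset.mpr Finset.inter_subset_left), v,
    subset_vertices (hsup _ hτ') hv, hvU, fun u hu => ?_⟩
  rw [Finset.mem_inter] at hu
  exact (hz τ' hz2).2.2 hv hu.2 fun h => hvU (h ▸ hτU hu.1)

open Classical in
/-- In a sparse graph, every cycle is a boundary plus a sum of cycles on octahedral sets. -/
theorem Sparse.octGenerated (hd : 2 ≤ d) (hG : Sparse G d) (m : ℕ) : ∀ (U : Finset V)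
    (z : Finset V → k), U.card ≤ m → IsCliqueChain G (d + 1) U z → bd z = 0 →
    OctGenerated G d z := by
  induction m using Nat.strong_induction_on with
  | _ m ihm =>
  -- Double induction: splitting off a component shrinks the support but not the bound on the
  -- vertices, while pushing off a vertex may enlarge the support but lowers the number of vertices.
  suffices H : ∀ (s : ℕ) (U : Finset V) (z : Finset V → k),
      (Finset.univ.filter fun σ => z σ ≠ 0).card = s → U.card ≤ m →
      IsCliqueChain G (d + 1) U z → bd z = 0 → OctGenerated G d z from
    fun U z => H _ U z rfl
  intro s
  induction s using Nat.strong_induction_on with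
  | _ s ihs =>
  intro U z hs hU hz hb
  by_cases hz0 : z = 0
  · rw [hz0]; exact .zero
  obtain ⟨F, hF⟩ : ∃ F, z F ≠ 0 := Function.ne_iff.mp hz0
  have hy := isCliqueChain_component (F := F) hz
  have hyb := bd_component (F := F) hz hb
  have hT := tightFrom_vertices_component hz hF
  have hyF : component d z F F = z F := by rw [component, if_pos .refl]
  set y := component d z F with hydef
  have hyW : IsCliqueChain G (d + 1) (vertices y) y :=
    fun σ hσ => ⟨subset_vertices hσ, (hy σ hσ).2⟩
  have hWU : vertices y ⊆ U := fun v hv => by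
    obtain ⟨σ, hσ, hv⟩ := mem_vertices.mp hv
    exact (hy σ hσ).1 hv
  have hrest : OctGenerated G d (z - y) := by
    refine ihs _ ?_ U _ rfl hU (hz.sub hy) (by rw [map_sub, hb, hyb, sub_zero])
    rw [← hs]
    refine Finset.card_lt_card (Finset.ssubset_iff_of_subset ?_ |>.mpr ⟨F, ?_, ?_⟩)
    · intro σ
      simp only [Finset.mem_filter_univ, Pi.sub_apply]
      intro h h0
      refine h ?_
      rw [hydef, component, h0, ite_self, sub_zero]
    · simpa using hF
    · simp [hyF]
  have : OctGenerated G d y := by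
    by_cases hlink : ∃ v ∈ vertices y, ∃ x, IsCliqueChain G (d + 1) (nbrs G (vertices y) v) x ∧
        bd x = linkAt v y
    · obtain ⟨v, hv, x, hx, hxb⟩ := hlink
      obtain ⟨p1, p2, p3, p4⟩ := hyW.exists_push_off hyb hv hx hxb
      have hlt : ((vertices y).erase v).card < m := by
        have h1 := Finset.card_erase_lt_of_mem hv
        have h2 := Finset.card_le_card hWU
        omega
      have h3 := (ihm _ hlt _ _ le_rfl p1 p2).add
        (OctGenerated.of_bd (p3.mono (Finset.subset_univ _)).neg)
      rw [map_neg, ← p4, add_neg_cancel_right] at h3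
      exact h3
    · push Not at hlink
      -- When no link bounds, a vertex of degree at most `2 d` has an octahedral link. So degrees
      -- below `2 d` do not occur, and sparsity then makes all of them equal to `2 d`.
      have key : ∀ v ∈ vertices y, (nbrs G (vertices y) v).card ≤ 2 * d →
          (nbrs G (vertices y) v).card = 2 * d ∧ ∀ u ∈ nbrs G (vertices y) v,
            (nbrs G (nbrs G (vertices y) v) u).card + 2 = 2 * d := by
        intro v hv hle
        rcases IsCliqueChain.exists_bd_eq_or G _ d _ _ rfl (hyW.link v) (bd_linkAt hyb v) hle with
          ⟨x, hx, hxb⟩ | h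
        · exact absurd hxb (hlink v hv x hx)
        · exact h
      have hdeg := hG.card_nbrs_eq hT fun v hv => by
        by_contra! hlt
        have := (key v hv hlt.le).1
        omega
      exact OctGenerated.of_isOct (isOct_of_links hd hT hdeg fun v hv => (key v hv (hdeg v hv).le).2)
        hyW hyb
  simpa using hrest.add this

end Generation

end CliqueHomology

end

noncomputable section

namespace CliqueHomology

/-! ### Antipodal maps and rigidity of octahedral sets. -/

section Pairing

variable {V : Type*} [LinearOrder V] [Fintype V] {G : SimpleGraph V} {d : ℕ} {R W : Finset V}
  {σ : Equiv.Perm V}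

/-- `σ` is an involution which moves exactly `2 d + 2` points: the antipodal map of a cross-polytope
of dimension `d + 1` on its support. -/
def IsPairing (d : ℕ) (σ : Equiv.Perm V) : Prop :=
  σ.support.card = 2 * d + 2 ∧ ∀ v, σ (σ v) = v

/-- The graph of the cross-polytope with antipodal map `σ`. -/
def octGraph (σ : Equiv.Perm V) : SimpleGraph V where
  Adj u v := u ∈ σ.support ∧ v ∈ σ.support ∧ u ≠ v ∧ v ≠ σ u ∧ u ≠ σ v
  symm := ⟨fun _ _ h => ⟨h.2.1, h.1, h.2.2.1.symm, h.2.2.2.2, h.2.2.2.1⟩⟩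
  loopless := ⟨fun _ h => h.2.2.1 rfl⟩

theorem IsPairing.octGraph_adj (hσ : IsPairing d σ) {u v : V} :
    (octGraph σ).Adj u v ↔ u ∈ σ.support ∧ v ∈ σ.support ∧ v ≠ u ∧ v ≠ σ u := by
  constructor
  · rintro ⟨h1, h2, h3, h4, -⟩
    exact ⟨h1, h2, h3.symm, h4⟩
  · rintro ⟨h1, h2, h3, h4⟩
    exact ⟨h1, h2, h3.symm, h4, fun h => h4 (by rw [h, hσ.2])⟩

theorem IsPairing.apply_ne {v : V} (hv : v ∈ σ.support) : σ v ≠ v :=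
  Equiv.Perm.mem_support.mp hv

/-- An octahedral vertex set has an antipodal map. -/
theorem IsOct.exists_pairing (hW : IsOct G d W) : ∃ σ : Equiv.Perm V, IsPairing d σ ∧
    σ.support = W ∧ ∀ v ∈ W, ∀ u ∈ W, (G.Adj v u ↔ u ≠ v ∧ u ≠ σ v) := by
  have h1 : ∀ v ∈ W, ∃ x ∈ W, x ≠ v ∧ ∀ u ∈ W, (G.Adj v u ↔ u ≠ v ∧ u ≠ x) := by
    intro v hv
    have hsub : nbrs G W v ⊆ W.erase v := nbrs_subset_erase
    have hc : ((W.erase v) \ nbrs G W v).card = 1 := by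
      rw [Finset.card_sdiff_of_subset hsub, Finset.card_erase_of_mem hv, hW.1, hW.2 v hv]
      omega
    obtain ⟨x, hx⟩ := Finset.card_eq_one.mp hc
    have key : ∀ u, (u ≠ v ∧ u ∈ W) ∧ ¬ (u ∈ W ∧ G.Adj v u) ↔ u = x := by
      intro u
      rw [← Finset.mem_singleton, ← hx, Finset.mem_sdiff, Finset.mem_erase, mem_nbrs]
    obtain ⟨⟨h2, h3⟩, h4⟩ := (key x).mpr rfl
    refine ⟨x, h3, h2, fun u hu => ⟨fun h => ⟨h.ne', ?_⟩, fun ⟨h5, h6⟩ => ?_⟩⟩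
    · rintro rfl
      exact h4 ⟨hu, h⟩
    · by_contra h7
      exact h6 ((key u).mp ⟨⟨h5, hu⟩, fun h => h7 h.2⟩)
  choose! f hfW hfne hf using h1
  have hff : ∀ v ∈ W, f (f v) = v := by
    intro v hv
    by_contra h
    have h2 := (hf (f v) (hfW v hv) v hv).mpr ⟨(hfne v hv).symm, Ne.symm h⟩
    exact ((hf v hv (f v) (hfW v hv)).mp h2.symm).2 rfl
  let g : V → V := fun v => if v ∈ W then f v else v
  have hg : Function.Involutive g := by
    intro v
    by_cases hv : v ∈ W
    · simp [g, hv, hfW v hv, hff v hv]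
    · simp [g, hv]
  have hsupp : (hg.toPerm g).support = W := by
    ext v
    rw [Equiv.Perm.mem_support, Function.Involutive.coe_toPerm]
    by_cases hv : v ∈ W
    · simp [g, hv, hfne v hv]
    · simp [g, hv]
  refine ⟨hg.toPerm g, ⟨by rw [hsupp, hW.1], fun v => hg v⟩, hsupp, fun v hv u hu => ?_⟩
  rw [hf v hv u hu]
  simp [g, hv]

theorem IsPairing.card_nbrs (hσ : IsPairing d σ) {v : V} (hv : v ∈ σ.support) :
    (nbrs (octGraph σ) σ.support v).card = 2 * d := by
  have : nbrs (octGraph σ) σ.support v = (σ.support.erase v).erase (σ v) := by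
    ext u
    rw [mem_nbrs, hσ.octGraph_adj, Finset.mem_erase, Finset.mem_erase]
    tauto
  rw [this, Finset.card_erase_of_mem, Finset.card_erase_of_mem hv, hσ.1]
  · omega
  · exact Finset.mem_erase.mpr ⟨apply_ne hv, Equiv.Perm.apply_mem_support.mpr hv⟩

theorem IsPairing.le_card_nbrs (hσ : IsPairing d σ) (hG : octGraph σ ≤ G) (hW : σ.support ⊆ W)
    {v : V} (hv : v ∈ σ.support) : 2 * d ≤ (nbrs G W v).card := by
  rw [← hσ.card_nbrs hv]
  refine Finset.card_le_card fun u hu => ?_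
  rw [mem_nbrs] at hu ⊢
  exact ⟨hW hu.1, hG hu.2⟩

/-- Half of the vertices of a cross-polytope, no two of them antipodal. -/
def transversal (σ : Equiv.Perm V) : Finset V := σ.support.filter fun v => v < σ v

theorem transversal_subset : transversal σ ⊆ σ.support := Finset.filter_subset _ _

theorem IsPairing.apply_notMem_transversal (hσ : IsPairing d σ) {v : V} (hv : v ∈ transversal σ) :
    σ v ∉ transversal σ := fun h => by
  simp only [transversal, Finset.mem_filter] at hv h
  rw [hσ.2] at h
  exact absurd (hv.2.trans h.2) (lt_irrefl _)

/-- A half of a cross-polytope without antipodal pairs and its antipodes cover everything. -/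
theorem IsPairing.mem_or_apply_mem (hσ : IsPairing d σ) (hR : R ⊆ σ.support)
    (hRσ : ∀ v ∈ R, σ v ∉ R) (hc : R.card = d + 1) {v : V} (hv : v ∈ σ.support) :
    v ∈ R ∨ σ v ∈ R := by
  have hdisj : Disjoint R (R.image σ) := by
    rw [Finset.disjoint_right]
    intro u hu hu'
    obtain ⟨w, hw, rfl⟩ := Finset.mem_image.mp hu
    exact hRσ w hw hu'
  have hsub : R ∪ R.image σ ⊆ σ.support := by
    refine Finset.union_subset hR fun u hu => ?_
    obtain ⟨w, hw, rfl⟩ := Finset.mem_image.mp hu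
    exact Equiv.Perm.apply_mem_support.mpr (hR hw)
  have he := Finset.eq_of_subset_of_card_le hsub (by
    rw [Finset.card_union_of_disjoint hdisj, Finset.card_image_of_injective _ σ.injective, hc, hσ.1]
    omega)
  rw [← he, Finset.mem_union] at hv
  refine hv.imp_right fun h => ?_
  obtain ⟨w, hw, rfl⟩ := Finset.mem_image.mp h
  rwa [hσ.2]

theorem IsPairing.card_transversal (hσ : IsPairing d σ) : (transversal σ).card = d + 1 := by
  have hdisj : Disjoint (transversal σ) ((transversal σ).image σ) := by
    rw [Finset.disjoint_right]
    intro u hu hu'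
    obtain ⟨w, hw, rfl⟩ := Finset.mem_image.mp hu
    exact hσ.apply_notMem_transversal hw hu'
  have he : transversal σ ∪ (transversal σ).image σ = σ.support := by
    ext v
    simp only [Finset.mem_union, Finset.mem_image, transversal, Finset.mem_filter]
    constructor
    · rintro (h | ⟨w, hw, rfl⟩)
      · exact h.1
      · exact Equiv.Perm.apply_mem_support.mpr hw.1
    · intro hv
      rcases lt_or_gt_of_ne (apply_ne hv) with h | h
      · refine Or.inr ⟨σ v, ⟨Equiv.Perm.apply_mem_support.mpr hv, ?_⟩, hσ.2 v⟩
        rwa [hσ.2]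
      · exact Or.inl ⟨hv, h⟩
  have := hσ.1
  rw [← he, Finset.card_union_of_disjoint hdisj, Finset.card_image_of_injective _ σ.injective]
    at this
  omega

/-- A cross-polytope is tightly connected from any of its facets. -/
theorem IsPairing.tightFrom (hσ : IsPairing d σ) (hG : octGraph σ ≤ G) (hR : R ⊆ σ.support)
    (hRσ : ∀ v ∈ R, σ v ∉ R) (hc : R.card = d + 1) : TightFrom G d R σ.support := by
  have hadj : ∀ u ∈ σ.support, ∀ v ∈ σ.support, v ≠ u → v ≠ σ u → G.Adj u v :=
    fun u hu v hv h1 h2 => hG (hσ.octGraph_adj.mpr ⟨hu, hv, h1, h2⟩)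
  have hclique : G.IsClique (R : Set V) := fun u hu v hv huv =>
    hadj u (hR hu) v (hR hv) huv.symm fun h => hRσ u hu (h ▸ hv)
  refine ⟨hR, hc, hclique, fun U hRU hUW => ?_⟩
  obtain ⟨v, hv, hvU⟩ := Finset.exists_of_ssubset hUW
  have hvR : v ∉ R := fun h => hvU (hRU h)
  have hσv := (hσ.mem_or_apply_mem hR hRσ hc hv).resolve_left hvR
  refine ⟨R.erase (σ v), (Finset.erase_subset _ _).trans hRU, ?_, ?_, v, hv, hvU, fun u hu => ?_⟩
  · rw [Finset.card_erase_of_mem hσv, hc]; omega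
  · exact hclique.subset (Finset.coe_subset.mpr (Finset.erase_subset _ _))
  · obtain ⟨h1, h2⟩ := Finset.mem_erase.mp hu
    exact hadj v hv u (hR h2) (fun h => hvR (h ▸ h2)) h1

theorem IsPairing.tightFrom_transversal (hσ : IsPairing d σ) (hG : octGraph σ ≤ G) :
    TightFrom G d (transversal σ) σ.support :=
  hσ.tightFrom hG transversal_subset (fun _ => hσ.apply_notMem_transversal) hσ.card_transversal

/-- In a sparse graph, copies of the cross-polytope graph are induced. -/
theorem IsPairing.isOct (hσ : IsPairing d σ) (hG : octGraph σ ≤ G) (hS : Sparse G d) :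
    IsOct G d σ.support :=
  ⟨hσ.1, hS.card_nbrs_eq (hσ.tightFrom_transversal hG) fun _ hv =>
    hσ.le_card_nbrs hG subset_rfl hv⟩

theorem IsOct.octGraph_le (hsupp : σ.support = W) (hσ : IsPairing d σ)
    (h : ∀ v ∈ W, ∀ u ∈ W, (G.Adj v u ↔ u ≠ v ∧ u ≠ σ v)) : octGraph σ ≤ G := by
  intro u v huv
  rw [hσ.octGraph_adj, hsupp] at huv
  exact (h u huv.1 v huv.2.1).mpr huv.2.2

theorem IsOct.tightFrom (hW : IsOct G d W) (hR : R ⊆ W) (hc : R.card = d + 1)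
    (hclique : G.IsClique (R : Set V)) : TightFrom G d R W := by
  obtain ⟨σ, hσ, rfl, h⟩ := hW.exists_pairing
  refine hσ.tightFrom (IsOct.octGraph_le rfl hσ h) hR (fun v hv hv' => ?_) hc
  have hadj := hclique hv hv' (IsPairing.apply_ne (hR hv)).symm
  exact ((h v (hR hv) _ (hR hv')).mp hadj).2 rfl

/-- A proper subset `U` of the union fails to contain one of the two sets, and tightness of that one
applies to its intersection with `U`. -/
theorem TightFrom.union {W' : Finset V} (h : TightFrom G d R W) (h' : TightFrom G d R W') :
    TightFrom G d R (W ∪ W') := by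
  have aux : ∀ {A : Finset V}, A ⊆ W ∪ W' → TightFrom G d R A → ∀ U, R ⊆ U → ¬ A ⊆ U →
      ∃ D ⊆ U, D.card = d ∧ G.IsClique (D : Set V) ∧ ∃ v ∈ W ∪ W', v ∉ U ∧
        ∀ u ∈ D, G.Adj v u := by
    intro A hA hT U hRU hAU
    obtain ⟨D, h1, h2, h3, v, h4, h5, h6⟩ := hT.2.2.2 (U ∩ A) (Finset.subset_inter hRU hT.1)
      ⟨Finset.inter_subset_right, fun h => hAU (h.trans Finset.inter_subset_left)⟩
    refine ⟨D, h1.trans Finset.inter_subset_left, h2, h3, v, hA h4, fun h => h5 ?_, h6⟩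
    exact Finset.mem_inter.mpr ⟨h, h4⟩
  refine ⟨h.1.trans Finset.subset_union_left, h.2.1, h.2.2.1, fun U hRU hU => ?_⟩
  by_cases hWU : W ⊆ U
  · refine aux Finset.subset_union_right h' U hRU fun hWU' => ?_
    exact hU.2 (Finset.union_subset hWU hWU')
  · exact aux Finset.subset_union_left h U hRU hWU

theorem TightFrom.insert {v : V} (h : TightFrom G d R W) (hv : ∀ u ∈ R, G.Adj v u) :
    TightFrom G d R (insert v W) := by
  by_cases hvW : v ∈ W
  · rwa [Finset.insert_eq_of_mem hvW]
  refine ⟨h.1.trans (Finset.subset_insert _ _), h.2.1, h.2.2.1, fun U hRU hU => ?_⟩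
  by_cases hWU : W ⊆ U
  · obtain ⟨r, hr⟩ : R.Nonempty := Finset.card_pos.mp (by rw [h.2.1]; omega)
    refine ⟨R.erase r, (Finset.erase_subset _ _).trans hRU, ?_, ?_, v, by simp, fun hvU => ?_,
      fun u hu => hv u (Finset.mem_of_mem_erase hu)⟩
    · rw [Finset.card_erase_of_mem hr, h.2.1]; omega
    · exact h.2.2.1.subset (Finset.coe_subset.mpr (Finset.erase_subset _ _))
    · exact hU.2 (Finset.insert_subset hvU hWU)
  · obtain ⟨D, h1, h2, h3, w, h4, h5, h6⟩ := h.2.2.2 (U ∩ W) (Finset.subset_inter hRU h.1)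
      ⟨Finset.inter_subset_right, fun h => hWU (h.trans Finset.inter_subset_left)⟩
    refine ⟨D, h1.trans Finset.inter_subset_left, h2, h3, w, by simp [h4], fun h => h5 ?_, h6⟩
    exact Finset.mem_inter.mpr ⟨h, h4⟩

/-- In a sparse graph, two octahedral sets with a common facet agree. -/
theorem Sparse.isOct_eq (hd : 1 ≤ d) (hG : Sparse G d) {W' : Finset V} (hW : IsOct G d W)
    (hW' : IsOct G d W') (hR : R ⊆ W) (hR' : R ⊆ W') (hc : R.card = d + 1)
    (hclique : G.IsClique (R : Set V)) : W = W' := by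
  have hT := hW.tightFrom hR hc hclique
  have hT' := hW'.tightFrom hR' hc hclique
  -- The union is tight with minimum degree `2 d`, hence has all degrees `2 d`, so no edge of it
  -- leaves `W`. If `W'` had a vertex outside `W`, tightness of `W'` would produce such an edge.
  have hdeg := hG.card_nbrs_eq (hT.union hT') fun v hv => by
    rcases Finset.mem_union.mp hv with h | h
    · rw [← hW.2 v h]; exact Finset.card_le_card (nbrs_mono Finset.subset_union_left)
    · rw [← hW'.2 v h]; exact Finset.card_le_card (nbrs_mono Finset.subset_union_right)
  have hsub : W' ⊆ W := by
    by_contra hsub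
    obtain ⟨D, h1, h2, h3, w, h4, h5, h6⟩ := hT'.2.2.2 (W ∩ W') (Finset.subset_inter hR hR')
      ⟨Finset.inter_subset_right, fun h => hsub (h.trans Finset.inter_subset_left)⟩
    obtain ⟨u, hu⟩ : D.Nonempty := Finset.card_pos.mp (by omega)
    have huW := (Finset.mem_inter.mp (h1 hu)).1
    have he : nbrs G W u = nbrs G (W ∪ W') u :=
      Finset.eq_of_subset_of_card_le (nbrs_mono Finset.subset_union_left)
        (by rw [hW.2 u huW, hdeg u (Finset.mem_union_left _ huW)])
    have hw : w ∈ nbrs G W u := by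
      rw [he]
      exact mem_nbrs.mpr ⟨Finset.mem_union_right _ h4, (h6 u hu).symm⟩
    exact h5 (Finset.mem_inter.mpr ⟨(mem_nbrs.mp hw).1, h4⟩)
  exact (Finset.eq_of_subset_of_card_le hsub (by rw [hW.1, hW'.1])).symm

/-- In a sparse graph, a facet of an octahedral set lies in no larger clique. -/
theorem Sparse.not_forall_adj (hG : Sparse G d) (hW : IsOct G d W) (hR : R ⊆ W)
    (hc : R.card = d + 1) (hclique : G.IsClique (R : Set V)) {v : V} (hv : ∀ u ∈ R, G.Adj v u) :
    False := by
  have hT := hW.tightFrom hR hc hclique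
  have hvR : v ∉ R := fun h => (hv v h).ne rfl
  by_cases hvW : v ∈ W
  · obtain ⟨σ, hσ, rfl, h⟩ := hW.exists_pairing
    have hRσ : ∀ v ∈ R, σ v ∉ R := fun v hv hv' =>
      ((h v (hR hv) _ (hR hv')).mp (hclique hv hv' (IsPairing.apply_ne (hR hv)).symm)).2 rfl
    have h1 := (hσ.mem_or_apply_mem hR hRσ hc hvW).resolve_left hvR
    exact ((h v hvW _ (hR h1)).mp (hv _ h1)).2 rfl
  -- With `v` added the degree sum is at least `2 d (2 d + 2) + 2 (d + 1)`, which exceeds the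
  -- permitted `2 d (2 d + 3)`.
  have h1 := hG _ _ (hT.insert hv)
  rw [Finset.sum_insert hvW, Finset.card_insert_of_notMem hvW, hW.1] at h1
  have h2 : d + 1 ≤ (nbrs G (insert v W) v).card := by
    rw [← hc]
    exact Finset.card_le_card fun u hu => mem_nbrs.mpr ⟨by simp [hR hu], hv u hu⟩
  have h3 : ∀ u ∈ W, 2 * d + (if u ∈ R then 1 else 0) ≤ (nbrs G (insert v W) u).card := by
    intro u hu
    rw [← hW.2 u hu]
    split_ifs with huR
    · rw [← Finset.card_insert_of_notMem (s := nbrs G W u) (a := v) fun h => hvW (mem_nbrs.mp h).1]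
      refine Finset.card_le_card (Finset.insert_subset ?_ (nbrs_mono (Finset.subset_insert _ _)))
      exact mem_nbrs.mpr ⟨by simp, (hv u huR).symm⟩
    · exact Finset.card_le_card (nbrs_mono (Finset.subset_insert _ _))
  have h4 := Finset.sum_le_sum h3
  rw [Finset.sum_add_distrib, Finset.sum_const, Finset.sum_boole, Finset.filter_mem_eq_inter,
    Finset.inter_eq_right.mpr hR, hc, hW.1, smul_eq_mul] at h4
  push_cast at h4
  nlinarith

end Pairing

/-! ### The one-dimensional space of cycles on an octahedral set. -/

section FundamentalCycle

variable {V : Type*} [LinearOrder V] [Fintype V] {k : Type*} [Field k] {G : SimpleGraph V} {d : ℕ}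
  {R W : Finset V} {σ : Equiv.Perm V}

/-- The fundamental cycle of a cross-polytope. -/
theorem exists_fundamental_cycle (hσ : ∀ v, σ (σ v) = v) (R : Finset V) (hRσ : ∀ v ∈ R, σ v ∉ R)
    (hadj : ∀ u ∈ R ∪ R.image σ, ∀ v ∈ R ∪ R.image σ, v ≠ u → v ≠ σ u → G.Adj u v) :
    ∃ z : Finset V → k, IsCliqueChain G R.card (R ∪ R.image σ) z ∧ bd z = 0 ∧ z R = 1 := by
  induction R using Finset.induction_on with
  | empty =>
    refine ⟨Pi.single ∅ 1, fun τ hτ => ?_, ?_, by simp⟩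
    · have : τ = ∅ := by
        by_contra h
        exact hτ (Pi.single_eq_of_ne h _)
      simp [this]
    · ext τ
      rw [bd_apply]
      refine Finset.sum_eq_zero fun v _ => ?_
      rw [Pi.single_eq_of_ne (Finset.insert_ne_empty v τ), mul_zero]
  | insert a R ha ih =>
    have hsub : R ∪ R.image σ ⊆ insert a R ∪ (insert a R).image σ :=
      Finset.union_subset_union (Finset.subset_insert _ _)
        (Finset.image_subset_image (Finset.subset_insert _ _))
    obtain ⟨y, hy, hyb, hyR⟩ := ih
      (fun v hv h => hRσ v (Finset.mem_insert_of_mem hv) (Finset.mem_insert_of_mem h))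
      (fun u hu v hv => hadj u (hsub hu) v (hsub hv))
    have hσa : σ a ∉ insert a R := hRσ a (Finset.mem_insert_self _ _)
    simp only [Finset.mem_insert, not_or] at hσa
    have haσ : a ∉ R.image σ := fun h => by
      obtain ⟨w, hw, rfl⟩ := Finset.mem_image.mp h
      exact hRσ w (Finset.mem_insert_of_mem hw) (Finset.mem_insert_self _ _)
    have hσaσ : σ a ∉ R.image σ := fun h => by
      obtain ⟨w, hw, hwa⟩ := Finset.mem_image.mp h
      exact ha (σ.injective hwa ▸ hw)
    have ha' : a ∉ R ∪ R.image σ := by simp only [Finset.mem_union, not_or]; exact ⟨ha, haσ⟩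
    have hσa' : σ a ∉ R ∪ R.image σ := by
      simp only [Finset.mem_union, not_or]; exact ⟨hσa.2, hσaσ⟩
    have haU : a ∈ insert a R ∪ (insert a R).image σ := by simp
    have hσaU : σ a ∈ insert a R ∪ (insert a R).image σ := by simp
    have hadj1 : ∀ u ∈ R ∪ R.image σ, G.Adj a u := fun u hu =>
      hadj a haU u (hsub hu) (fun h => ha' (h ▸ hu)) (fun h => hσa' (h ▸ hu))
    have hadj2 : ∀ u ∈ R ∪ R.image σ, G.Adj (σ a) u := fun u hu =>
      hadj _ hσaU u (hsub hu) (fun h => hσa' (h ▸ hu)) (fun h => ha' (by rw [hσ] at h; exact h ▸ hu))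
    -- Suspension: the difference of the cones from two antipodal points over the previous cycle.
    -- The scalar normalises the value at the facet to `1`.
    refine ⟨sgn k a R • (cone a y - cone (σ a) y), ?_, ?_, ?_⟩
    · rw [Finset.card_insert_of_notMem ha]
      exact (((hy.coneOver hadj1).mono (Finset.insert_subset haU hsub)).sub
        ((hy.coneOver hadj2).mono (Finset.insert_subset hσaU hsub))).smul _
    · have h0 : ∀ v : V, cone v (0 : Finset V → k) = 0 := fun v => by ext; simp [cone]
      rw [map_smul, map_sub, bd_cone (hy.eq_zero_of_mem ha'), bd_cone (hy.eq_zero_of_mem hσa'), hyb,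
        h0, h0]
      simp
    · have h1 : σ a ∉ insert a R := by simp [hσa]
      simp [cone, h1, Finset.erase_insert ha, hyR, sgn_mul_self]

theorem IsOct.exists_cycle (hW : IsOct G d W) (hR : R ⊆ W) (hc : R.card = d + 1)
    (hclique : G.IsClique (R : Set V)) :
    ∃ z : Finset V → k, IsCliqueChain G (d + 1) W z ∧ bd z = 0 ∧ z R = 1 := by
  obtain ⟨σ, hσ, rfl, h⟩ := hW.exists_pairing
  have hsub : R ∪ R.image σ ⊆ σ.support := by
    refine Finset.union_subset hR fun u hu => ?_
    obtain ⟨w, hw, rfl⟩ := Finset.mem_image.mp hu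
    exact Equiv.Perm.apply_mem_support.mpr (hR hw)
  obtain ⟨z, h1, h2, h3⟩ := exists_fundamental_cycle (G := G) (k := k) hσ.2 R
    (fun v hv hv' => ((h v (hR hv) _ (hR hv')).mp
      (hclique hv hv' (IsPairing.apply_ne (hR hv)).symm)).2 rfl)
    (fun u hu v hv h1 h2 => (h u (hsub hu) v (hsub hv)).mpr ⟨h1, h2⟩)
  exact ⟨z, hc ▸ h1.mono hsub, h2, h3⟩

/-- A cycle on an octahedral set is determined by its value at one facet. -/
theorem IsOct.cycle_eq_zero (hW : IsOct G d W) {z : Finset V → k} (hz : IsCliqueChain G (d + 1) W z)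
    (hb : bd z = 0) (hR : R ⊆ W) (hc : R.card = d + 1) (hclique : G.IsClique (R : Set V))
    (hzR : z R = 0) : z = 0 := by
  obtain ⟨σ, hσ, rfl, h⟩ := hW.exists_pairing
  have anti : ∀ F ⊆ σ.support, G.IsClique (F : Set V) → ∀ v ∈ F, σ v ∉ F :=
    fun F hF hFc v hv hv' => ((h v (hF hv) _ (hF hv')).mp
      (hFc hv hv' (IsPairing.apply_ne (hF hv)).symm)).2 rfl
  -- The face `F.erase u` lies in only two facets, `F` and the one with `u` replaced by its
  -- antipode, so a cycle cannot vanish on exactly one of them.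
  have flip : ∀ F, z F ≠ 0 → ∀ u ∈ F, z (insert (σ u) (F.erase u)) ≠ 0 := by
    intro F hF u hu h0
    obtain ⟨h1, h2, h3⟩ := hz F hF
    have hFσ := anti F h1 h3
    have hb' := congrFun hb (F.erase u)
    rw [bd_apply, Finset.sum_eq_single u, Finset.insert_erase hu, Pi.zero_apply] at hb'
    · exact (mul_ne_zero (sgn_ne_zero _ _) hF) hb'
    · intro w hw hwu
      rw [Finset.mem_compl] at hw
      by_contra hne
      obtain ⟨h4, h5, h6⟩ := hz _ (right_ne_zero_of_mul hne)
      have hwW : w ∈ σ.support := h4 (Finset.mem_insert_self _ _)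
      rcases hσ.mem_or_apply_mem h1 hFσ h2 hwW with hwF | hwF
      · exact hw (Finset.mem_erase.mpr ⟨hwu, hwF⟩)
      · by_cases hu' : σ w = u
        · rw [← hu', hσ.2, hu'] at h0
          exact hne (by rw [h0, mul_zero])
        · exact anti _ h4 h6 w (Finset.mem_insert_self _ _)
            (Finset.mem_insert_of_mem (Finset.mem_erase.mpr ⟨hu', hwF⟩))
    · intro hu'
      simp at hu'
  -- Replacing the vertices outside `R` by their antipodes, which lie in `R`, leads from any support
  -- simplex to `R`, where `z` vanishes.
  have main : ∀ n F, z F ≠ 0 → (F \ R).card = n → False := by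
    intro n
    induction n with
    | zero =>
      intro F hF hn
      rw [Finset.card_eq_zero, Finset.sdiff_eq_empty_iff_subset] at hn
      rw [Finset.eq_of_subset_of_card_le hn (by rw [hc, (hz F hF).2.1])] at hF
      exact hF hzR
    | succ n ih =>
      intro F hF hn
      obtain ⟨u, hu⟩ : (F \ R).Nonempty := Finset.card_pos.mp (by omega)
      obtain ⟨huF, huR⟩ := Finset.mem_sdiff.mp hu
      have huW := (hz F hF).1 huF
      have hσu := (hσ.mem_or_apply_mem hR (anti R hR hclique) hc huW).resolve_left huR
      refine ih _ (flip F hF u huF) ?_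
      have he : insert (σ u) (F.erase u) \ R = (F \ R).erase u := by
        ext t
        simp only [Finset.mem_sdiff, Finset.mem_insert, Finset.mem_erase]
        constructor
        · rintro ⟨rfl | h1, h2⟩
          · exact absurd hσu h2
          · exact ⟨h1.1, h1.2, h2⟩
        · exact fun h => ⟨Or.inr ⟨h.1, h.2.1⟩, h.2.2⟩
      rw [he, Finset.card_erase_of_mem hu, hn]
      rfl
  ext F
  by_contra hF
  exact main _ F hF rfl

end FundamentalCycle

end CliqueHomology

end

noncomputable section

namespace CliqueHomology

open PreAbstractSimplicialComplex

/-! ### Comparison with the simplicial chain complex. -/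

section Bridge

variable {V : Type*} [LinearOrder V] [Fintype V] {k : Type*} [Field k] {G : SimpleGraph V} {d : ℕ}

/-- The reduced and unreduced operators differ only on single vertices, which the hypothesis
excludes. This is harmless for cycles of dimension `d ≥ 1`. -/
theorem boundaryMap_eq_bd (z : Finset V →₀ k) (hz : ∀ σ, z σ ≠ 0 → 2 ≤ σ.card) :
    ⇑(boundaryMap k z) = bd ⇑z := by
  have key : ∀ (σ : Finset V) (a : k), 2 ≤ σ.card →
      ⇑(boundaryMap k (Finsupp.single σ a)) = bd ⇑(Finsupp.single σ a) := by
    intro σ a hσ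
    ext τ
    rw [boundaryMap_single k σ hσ, bd_apply, Finsupp.smul_apply, Finsupp.finsetSum_apply,
      smul_eq_mul, Finset.mul_sum]
    have h1 : ∑ v ∈ σ, a * (Finsupp.single (σ.erase v) ((-1 : k) ^ (σ.filter (· < v)).card)) τ =
        ∑ v, if v ∈ σ ∧ σ.erase v = τ then sgn k v τ * a else 0 := by
      rw [← Finset.sum_filter_add_sum_filter_not Finset.univ (· ∈ σ), Finset.filter_mem_eq_inter,
        Finset.univ_inter]
      rw [Finset.sum_eq_zero (s := Finset.univ.filter (· ∉ σ)), add_zero]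
      · refine Finset.sum_congr rfl fun v hv => ?_
        rw [Finsupp.single_apply]
        by_cases h : σ.erase v = τ
        · rw [if_pos h, if_pos ⟨hv, h⟩, sgn, ← h, mul_comm]
          congr 3
          ext u
          simp only [Finset.mem_filter, Finset.mem_erase]
          exact ⟨fun h => ⟨⟨h.2.ne, h.1⟩, h.2⟩, fun h => ⟨h.1.2, h.2⟩⟩
        · rw [if_neg h, if_neg fun h' => h h'.2, mul_zero]
      · intro v hv
        rw [if_neg fun h => (Finset.mem_filter.mp hv).2 h.1]
    have h2 : ∑ v ∈ τᶜ, sgn k v τ * (Finsupp.single σ a) (insert v τ) =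
        ∑ v, if v ∈ σ ∧ σ.erase v = τ then sgn k v τ * a else 0 := by
      rw [← Finset.sum_filter_add_sum_filter_not Finset.univ (· ∈ τᶜ), Finset.filter_mem_eq_inter,
        Finset.univ_inter]
      rw [Finset.sum_eq_zero (s := Finset.univ.filter (· ∉ τᶜ)), add_zero]
      · refine Finset.sum_congr rfl fun v hv => ?_
        rw [Finset.mem_compl] at hv
        rw [Finsupp.single_apply]
        by_cases h : σ = insert v τ
        · rw [if_pos h, if_pos]
          rw [h, Finset.erase_insert hv]
          exact ⟨Finset.mem_insert_self _ _, rfl⟩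
        · rw [if_neg h, if_neg, mul_zero]
          rintro ⟨h3, rfl⟩
          exact h (Finset.insert_erase h3).symm
      · intro v hv
        rw [if_neg]
        rintro ⟨-, rfl⟩
        simp at hv
    rw [h1, h2]
  have h1 : z = ∑ σ, Finsupp.single σ (z σ) := (Finsupp.univ_sum_single z).symm
  have h2 : ⇑z = ∑ σ, ⇑(Finsupp.single σ (z σ)) := by
    rw [← Finsupp.coe_finsetSum, ← h1]
  rw [h2, map_sum]
  nth_rewrite 1 [h1]
  rw [map_sum, Finsupp.coe_finsetSum]
  refine Finset.sum_congr rfl fun σ _ => ?_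
  by_cases h0 : z σ = 0
  · simp [h0]
  · exact key σ _ (hz σ h0)

theorem mem_chains_iff {j : ℕ} {z : Finset V →₀ k} :
    z ∈ chains k j G.cliqueComplex ↔ IsCliqueChain G (j + 1) Finset.univ ⇑z := by
  rw [chains, Finsupp.mem_supported]
  constructor
  · intro h σ hσ
    obtain ⟨h1, h2⟩ := h (Finsupp.mem_support_iff.mpr hσ)
    exact ⟨Finset.subset_univ _, h2, h1.2⟩
  · intro h σ hσ
    obtain ⟨-, h2, h3⟩ := h σ (Finsupp.mem_support_iff.mp hσ)
    exact ⟨⟨Finset.card_pos.mp (by omega), h3⟩, h2⟩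

theorem mem_cycles_iff (hd : 1 ≤ d) {z : Finset V →₀ k} :
    z ∈ cycles k d G.cliqueComplex ↔ IsCliqueChain G (d + 1) Finset.univ ⇑z ∧ bd ⇑z = 0 := by
  rw [cycles, Submodule.mem_inf, mem_chains_iff, LinearMap.mem_ker]
  refine and_congr_right fun h => ?_
  rw [← boundaryMap_eq_bd z fun σ hσ => by have := (h σ hσ).2.1; omega, ← Finsupp.coe_zero,
    DFunLike.coe_fn_eq]

theorem mem_boundaries_iff {z : Finset V →₀ k} :
    z ∈ boundaries k d G.cliqueComplex ↔
      ∃ w : Finset V → k, IsCliqueChain G (d + 2) Finset.univ w ∧ bd w = ⇑z := by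
  rw [boundaries, Submodule.mem_map]
  constructor
  · rintro ⟨w, hw, rfl⟩
    rw [mem_chains_iff] at hw
    exact ⟨w, hw, (boundaryMap_eq_bd w fun σ hσ => by have := (hw σ hσ).2.1; omega).symm⟩
  · rintro ⟨w, hw, hwz⟩
    refine ⟨Finsupp.equivFunOnFinite.symm w, mem_chains_iff.mpr (by simpa using hw), ?_⟩
    apply DFunLike.coe_injective
    rw [boundaryMap_eq_bd, ← hwz]
    · simp
    · intro σ hσ
      have := (hw σ (by simpa using hσ)).2.1
      omega

end Bridge

/-! ### Octahedral sets as copies of the cross-polytope boundary. -/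

section CrossPolytope

variable {V : Type*} [LinearOrder V] [Fintype V] {k : Type*} [Field k] {G : SimpleGraph V} {d : ℕ}
  {W : Finset V}

/-- A transversal of the antipodal pairs gives coordinates: the first records the pair, the second
whether the point is the chosen one or its antipode. -/
theorem IsOct.exists_embedding (hW : IsOct G d W) : ∃ φ : Fin (d + 1) × Fin 2 ↪ V,
    (∀ v, v ∈ W ↔ ∃ a, φ a = v) ∧ ∀ a b, G.Adj (φ a) (φ b) ↔ a.1 ≠ b.1 := by
  obtain ⟨σ, hσ, rfl, h⟩ := hW.exists_pairing
  let e : Fin (d + 1) ↪o V := (transversal σ).orderEmbOfFin hσ.card_transversal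
  have he : ∀ i, e i ∈ transversal σ := Finset.orderEmbOfFin_mem _ _
  let f : Fin (d + 1) × Fin 2 → V := fun a => if a.2 = 0 then e a.1 else σ (e a.1)
  have heW : ∀ i, e i ∈ σ.support := fun i => transversal_subset (he i)
  have hfW : ∀ a, f a ∈ σ.support := by
    rintro ⟨i, j⟩
    by_cases hj : j = 0
    · simpa [f, hj] using heW i
    · simp only [f, hj, if_false]
      exact Equiv.Perm.apply_mem_support.mpr (heW i)
  have hne : ∀ i j, e i ≠ σ (e j) := fun i j hij =>
    hσ.apply_notMem_transversal (he j) (hij ▸ he i)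
  have hf : Function.Injective f := by
    rintro ⟨i, j⟩ ⟨i', j'⟩ hij
    simp only [f] at hij
    split_ifs at hij with h1 h2 h2
    · rw [e.injective hij, h1, h2]
    · exact absurd hij (hne _ _)
    · exact absurd hij.symm (hne _ _)
    · rw [e.injective (σ.injective hij)]
      congr 1
      omega
  have hanti : ∀ a b, f b = σ (f a) → a.1 = b.1 := by
    rintro ⟨i, j⟩ ⟨i', j'⟩ hij
    simp only [f] at hij
    split_ifs at hij with h1 h2 h2
    · exact absurd hij (hne _ _)
    · rw [hσ.2] at hij
      exact (e.injective hij).symm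
    · exact (e.injective (σ.injective hij)).symm
    · rw [hσ.2] at hij
      exact absurd hij.symm (hne _ _)
  refine ⟨⟨f, hf⟩, fun v => ⟨fun hv => ?_, ?_⟩, fun a b => ?_⟩
  · have hr : ∀ u ∈ transversal σ, ∃ i, e i = u := fun u hu => by
      have : u ∈ Set.range e := by
        rw [Finset.range_orderEmbOfFin]
        exact hu
      exact this
    rcases hσ.mem_or_apply_mem transversal_subset (fun _ => hσ.apply_notMem_transversal)
      hσ.card_transversal hv with h1 | h1
    · obtain ⟨i, hi⟩ := hr v h1
      exact ⟨(i, 0), by simp [f, hi]⟩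
    · obtain ⟨i, hi⟩ := hr _ h1
      exact ⟨(i, 1), by simp [f, hi, hσ.2]⟩
  · rintro ⟨a, rfl⟩
    exact hfW a
  · rw [Function.Embedding.coeFn_mk, h _ (hfW a) _ (hfW b)]
    constructor
    · rintro ⟨h1, h2⟩ hab
      rcases a with ⟨i, j⟩
      rcases b with ⟨i', j'⟩
      simp only at hab
      subst hab
      simp only [f] at h1 h2
      split_ifs at h1 h2
      all_goals simp_all [hσ.2 (e i)]
    · intro hab
      exact ⟨fun h => hab (by rw [hf h]), fun h => hab (hanti a b h)⟩

/-- The clique complex of the graph spanned by an octahedral set is a copy of the boundary of the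
cross-polytope. -/
theorem IsOct.exists_crossPolytopeBoundary (hW : IsOct G d W) :
    ∃ L : PreAbstractSimplicialComplex V, L ≤ G.cliqueComplex ∧ IsCrossPolytopeBoundary d L ∧
      ∀ s : Finset V, s.Nonempty → s ⊆ W → G.IsClique (s : Set V) → s ∈ L.faces := by
  obtain ⟨φ, hφW, hφ⟩ := hW.exists_embedding
  refine ⟨(crossPolytopeBoundary d).map φ, ?_, ⟨φ, rfl⟩, fun s hs hsW hsc => ?_⟩
  · rintro _ ⟨s, ⟨hs, hsc⟩, rfl⟩
    refine ⟨hs.image φ, ?_⟩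
    rw [Finset.coe_image]
    rintro _ ⟨a, ha, rfl⟩ _ ⟨b, hb, rfl⟩ hab
    exact (hφ a b).mpr (hsc ha hb fun h => hab (by rw [h]))
  · have himg : (Finset.univ.filter fun a => φ a ∈ s).image φ = s := by
      ext v
      simp only [Finset.mem_image, Finset.mem_filter_univ]
      constructor
      · rintro ⟨a, ha, rfl⟩
        exact ha
      · intro hv
        obtain ⟨a, rfl⟩ := (hφW v).mp (hsW hv)
        exact ⟨a, hv, rfl⟩
    refine ⟨Finset.univ.filter fun a => φ a ∈ s, ⟨?_, ?_⟩, himg⟩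
    · rw [← himg] at hs
      exact Finset.image_nonempty.mp hs
    · intro a ha b hb hab
      rw [Finset.coe_filter_univ, Set.mem_ofPred_eq] at ha hb
      exact (hφ a b).mp (hsc ha hb fun h => hab (φ.injective h))

theorem chains_mono {j : ℕ} {K L : PreAbstractSimplicialComplex V} (h : L ≤ K) :
    chains k j L ≤ chains k j K :=
  Finsupp.supported_mono fun _ hs => ⟨h hs.1, hs.2⟩

theorem Sparse.homologyGeneratedByCrossPolytopes (hd : 2 ≤ d) (hG : Sparse G d) :
    HomologyGeneratedByCrossPolytopes k d G.cliqueComplex := by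
  apply le_antisymm
  · intro z hz
    obtain ⟨h1, h2⟩ := (mem_cycles_iff (by omega)).mp hz
    obtain ⟨w, c, hw, hcW, hc, hzwc⟩ := hG.octGenerated hd _ Finset.univ ⇑z le_rfl h1 h2
    have hz' : z = Finsupp.equivFunOnFinite.symm (bd w) +
        ∑ W, Finsupp.equivFunOnFinite.symm (c W) := by
      apply DFunLike.coe_injective
      rw [hzwc, Finsupp.coe_add, Finsupp.coe_finsetSum]
      simp
    rw [hz']
    refine Submodule.add_mem_sup (mem_boundaries_iff.mpr ⟨w, hw, by simp⟩)
      (Submodule.sum_mem _ fun W _ => ?_)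
    by_cases h0 : c W = 0
    · have : Finsupp.equivFunOnFinite.symm (c W) = 0 := by
        apply DFunLike.coe_injective
        simp [h0]
      rw [this]
      exact Submodule.zero_mem _
    obtain ⟨L, hL, hLd, hLf⟩ := (hcW W h0).exists_crossPolytopeBoundary
    refine Submodule.mem_iSup_of_mem ⟨L, hL, hLd⟩ ?_
    obtain ⟨hc1, hc2⟩ := hc W
    have hmem : Finsupp.equivFunOnFinite.symm (c W) ∈ cycles k d G.cliqueComplex :=
      (mem_cycles_iff (by omega)).mpr
        ⟨by simpa using hc1.mono (Finset.subset_univ _), by simpa using hc2⟩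
    refine ⟨?_, hmem.2⟩
    rw [chains]
    refine (Finsupp.mem_supported k _).mpr fun s hs => ?_
    obtain ⟨h3, h4, h5⟩ := hc1 s (by simpa using hs)
    exact ⟨hLf s (Finset.card_pos.mp (by omega)) h3 h5, h4⟩
  · refine sup_le (boundaries_le_cycles k d _) (iSup_le fun L => ?_)
    exact inf_le_inf_right _ (chains_mono L.2.1)

end CrossPolytope

/-! ### The Betti number of a sparse graph. -/

section Betti

variable {V : Type*} [LinearOrder V] [Fintype V] (k : Type*) [Field k] {G : SimpleGraph V} {d : ℕ}

theorem IsOct.exists_facet {W : Finset V} (hW : IsOct G d W) :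
    ∃ R ⊆ W, R.card = d + 1 ∧ G.IsClique (R : Set V) := by
  obtain ⟨σ, hσ, rfl, h⟩ := hW.exists_pairing
  have := hσ.tightFrom_transversal (IsOct.octGraph_le rfl hσ h)
  exact ⟨_, this.1, this.2.1, this.2.2.1⟩

open Classical in
/-- In a sparse graph, the Betti number counts the octahedral vertex sets. -/
theorem Sparse.betti_eq (hd : 2 ≤ d) (hG : Sparse G d) :
    betti k d G.cliqueComplex = (Finset.univ.filter (IsOct G d)).card := by
  choose! R hRW hRc hR using fun (W : Finset V) (hW : IsOct G d W) => hW.exists_facet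
  -- One chosen facet per octahedral set serves as a coordinate. Boundaries vanish at such a facet
  -- because it lies in no larger clique, and a cycle on another octahedral set vanishes there
  -- because the facet determines its set. So the kernel is the space of boundaries, and fundamental
  -- cycles give surjectivity.
  let ev : cycles k d G.cliqueComplex →ₗ[k] ({W : Finset V // IsOct G d W} → k) :=
    LinearMap.pi fun W => (Finsupp.lapply (R W.1)).comp (Submodule.subtype _)
  have hev : ∀ z W, ev z W = (z : Finset V →₀ k) (R W.1) := fun _ _ => rfl
  have hbd : ∀ W, IsOct G d W → ∀ w : Finset V → k, IsCliqueChain G (d + 2) Finset.univ w →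
      bd w (R W) = 0 := by
    intro W hW w hw
    rw [bd_apply]
    refine Finset.sum_eq_zero fun v hv => ?_
    by_contra hne
    obtain ⟨-, -, h3⟩ := hw _ (right_ne_zero_of_mul hne)
    refine hG.not_forall_adj hW (hRW W hW) (hRc W hW) (hR W hW) (v := v) fun u hu => ?_
    refine h3 (by simp) (by simp [hu]) fun h => ?_
    rw [Finset.mem_compl] at hv
    exact hv (h ▸ hu)
  have hoff : ∀ W W', IsOct G d W → IsOct G d W' → W ≠ W' → ∀ z : Finset V → k,
      IsCliqueChain G (d + 1) W z → z (R W') = 0 := by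
    intro W W' hW hW' hne z hz
    by_contra h0
    exact hne (hG.isOct_eq (by omega) hW hW' (hz _ h0).1 (hRW W' hW') (hRc W' hW') (hR W' hW'))
  have hker : LinearMap.ker ev =
      (boundaries k d G.cliqueComplex).submoduleOf (cycles k d G.cliqueComplex) := by
    ext z
    rw [LinearMap.mem_ker, Submodule.submoduleOf, Submodule.mem_comap, Submodule.coe_subtype,
      mem_boundaries_iff]
    constructor
    · intro h
      obtain ⟨h1, h2⟩ := (mem_cycles_iff (by omega)).mp z.2
      obtain ⟨w, c, hw, hcW, hc, hzwc⟩ := hG.octGenerated hd _ Finset.univ _ le_rfl h1 h2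
      refine ⟨w, hw, ?_⟩
      have hc0 : ∀ W, c W = 0 := by
        intro W
        by_contra h0
        have hW := hcW W h0
        refine h0 (hW.cycle_eq_zero (hc W).1 (hc W).2 (hRW W hW) (hRc W hW) (hR W hW) ?_)
        have h3 := congrFun h ⟨W, hW⟩
        rw [hev, hzwc, Pi.add_apply, hbd W hW w hw, zero_add, Finset.sum_apply,
          Finset.sum_eq_single W] at h3
        · exact h3
        · intro W' _ hne
          by_cases h0' : c W' = 0
          · rw [h0']; rfl
          · exact hoff W' W (hcW W' h0') hW hne _ (hc W').1
        · simp
      rw [hzwc, Finset.sum_eq_zero fun W _ => hc0 W, add_zero]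
    · rintro ⟨w, hw, hwz⟩
      ext W
      rw [hev, ← hwz]
      exact hbd W.1 W.2 w hw
  have hsurj : LinearMap.range ev = ⊤ := by
    rw [eq_top_iff]
    intro f _
    have hcyc : ∀ W : {W : Finset V // IsOct G d W}, ∃ z : Finset V → k,
        IsCliqueChain G (d + 1) W.1 z ∧ bd z = 0 ∧ z (R W.1) = 1 :=
      fun W => W.2.exists_cycle (hRW _ W.2) (hRc _ W.2) (hR _ W.2)
    choose y hy hyb hyR using hcyc
    have hmem : ∀ W, Finsupp.equivFunOnFinite.symm (y W) ∈ cycles k d G.cliqueComplex := fun W =>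
      (mem_cycles_iff (by omega)).mpr
        ⟨by simpa using (hy W).mono (Finset.subset_univ _), by simpa using hyb W⟩
    refine ⟨∑ W, f W • ⟨_, hmem W⟩, ?_⟩
    ext W
    rw [map_sum, Finset.sum_apply, Finset.sum_eq_single W]
    · rw [map_smul, Pi.smul_apply, hev, smul_eq_mul]
      simp [hyR]
    · intro W' _ hne
      rw [map_smul, Pi.smul_apply, hev, smul_eq_mul]
      have := hoff W'.1 W.1 W'.2 W.2 (fun h => hne (Subtype.ext h)) _ (hy W')
      simp [this]
    · simp
  change Module.finrank k (_ ⧸ _) = _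
  rw [← hker, (ev.quotKerEquivOfSurjective (LinearMap.range_eq_top.mp hsurj)).finrank_eq,
    Module.finrank_fintype_fun_eq_card, Fintype.card_subtype]

open Classical in
/-- In a sparse graph, the octahedral vertex sets correspond to the copies of the graph of the
cross-polytope. -/
theorem Sparse.card_isOct (hG : Sparse G d) : (Finset.univ.filter (IsOct G d)).card =
    (Finset.univ.filter fun σ : Equiv.Perm V => IsPairing d σ ∧ octGraph σ ≤ G).card := by
  symm
  refine Finset.card_bij (fun σ _ => σ.support) ?_ ?_ ?_
  · intro σ hσ
    rw [Finset.mem_filter_univ] at hσ ⊢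
    exact hσ.1.isOct hσ.2 hG
  · intro σ hσ τ hτ hστ
    rw [Finset.mem_filter_univ] at hσ hτ
    have hO := hσ.1.isOct hσ.2 hG
    ext v
    by_cases hv : v ∈ σ.support
    · have hsubset : nbrs (octGraph σ) σ.support v ⊆ nbrs G σ.support v := fun u hu => by
        rw [mem_nbrs] at hu ⊢
        exact ⟨hu.1, hσ.2 hu.2⟩
      have he := Finset.eq_of_subset_of_card_le hsubset
        (by rw [hO.2 v hv, hσ.1.card_nbrs hv])
      by_contra hne
      have hτv : τ v ∈ σ.support := by
        rw [hστ]; exact Equiv.Perm.apply_mem_support.mpr (hστ ▸ hv)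
      have h1 : σ v ∈ nbrs G σ.support v := by
        refine mem_nbrs.mpr ⟨Equiv.Perm.apply_mem_support.mpr hv, hτ.2 ?_⟩
        rw [hτ.1.octGraph_adj, ← hστ]
        exact ⟨hv, Equiv.Perm.apply_mem_support.mpr hv, IsPairing.apply_ne hv, hne⟩
      rw [← he, mem_nbrs, hσ.1.octGraph_adj] at h1
      exact h1.2.2.2.2 rfl
    · have hv' : v ∉ τ.support := hστ ▸ hv
      rw [Equiv.Perm.notMem_support] at hv hv'
      rw [hv, hv']
  · intro W hW
    rw [Finset.mem_filter_univ] at hW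
    obtain ⟨σ, hσ, hsupp, h⟩ := hW.exists_pairing
    exact ⟨σ, by rw [Finset.mem_filter_univ]; exact ⟨hσ, IsOct.octGraph_le hsupp hσ h⟩, hsupp⟩

end Betti

end CliqueHomology

end

noncomputable section

/-! ### Expectations over the binomial random graph. -/

namespace RandomGraph

open SimpleGraph

variable {V : Type*} [Fintype V] {p : unitInterval}

instance instMeasurableSingletonClass : MeasurableSingletonClass (SimpleGraph V) where
  measurableSet_singleton G := by
    have h := measurable_edgeSet (measurableSet_singleton G.edgeSet)
    convert h
    ext H
    simp

open Classical in
/-- The expectation of a function of the binomial random graph, as a finite sum. -/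
def expect (p : unitInterval) (f : SimpleGraph V → ℝ) : ℝ :=
  ∑ G, (binomialRandom V p).real {G} * f G

theorem expect_mono {f g : SimpleGraph V → ℝ} (h : ∀ G, f G ≤ g G) : expect p f ≤ expect p g :=
  Finset.sum_le_sum fun G _ => mul_le_mul_of_nonneg_left (h G) measureReal_nonneg

theorem expect_sub (f g : SimpleGraph V → ℝ) :
    expect p (fun G => f G - g G) = expect p f - expect p g := by
  simp [expect, mul_sub, Finset.sum_sub_distrib]

theorem expect_const_mul (a : ℝ) (f : SimpleGraph V → ℝ) :
    expect p (fun G => a * f G) = a * expect p f := by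
  rw [expect, expect, Finset.mul_sum]
  exact Finset.sum_congr rfl fun _ _ => by ring

theorem expect_sum {ι : Type*} (s : Finset ι) (f : ι → SimpleGraph V → ℝ) :
    expect p (fun G => ∑ i ∈ s, f i G) = ∑ i ∈ s, expect p (f i) := by
  simp only [expect, Finset.mul_sum]
  exact Finset.sum_comm

open Classical in
theorem measureReal_eq_expect (A : Set (SimpleGraph V)) :
    (binomialRandom V p).real A = expect p fun G => if G ∈ A then 1 else 0 := by
  rw [expect]
  simp only [mul_ite, mul_one, mul_zero]
  rw [← Finset.sum_filter, sum_measureReal_singleton]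
  simp

theorem expect_one : expect p (fun _ : SimpleGraph V => 1) = 1 := by
  have := measureReal_eq_expect (V := V) (p := p) Set.univ
  simpa using this.symm

/-- Adding an absent edge changes the weight by the factor `p / (1 - p)`. -/
theorem weight_sup_edge {e : Sym2 V} (he : ¬ e.IsDiag) {G : SimpleGraph V} (h : e ∉ G.edgeSet) :
    (binomialRandom V p).real {G ⊔ fromEdgeSet {e}} * (1 - (p : ℝ)) =
      (binomialRandom V p).real {G} * p := by
  classical
  have h1 : (G ⊔ fromEdgeSet {e}).edgeSet = insert e G.edgeSet := by
    rw [edgeSet_sup, edgeSet_fromEdgeSet, Set.union_comm]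
    ext x
    simp only [Set.mem_union, Set.mem_sdiff, Set.mem_singleton_iff, Set.mem_insert_iff]
    constructor
    · rintro (h | h)
      · exact Or.inl h.1
      · exact Or.inr h
    · rintro (rfl | h)
      · exact Or.inl ⟨rfl, he⟩
      · exact Or.inr h
  have h2 : (insert e G.edgeSet).ncard = G.edgeSet.ncard + 1 :=
    Set.ncard_insert_of_notMem h (Set.toFinite _)
  have h3 : G.edgeSet.ncard + 1 ≤ (Nat.card V).choose 2 := by
    rw [← h2, ← h1, Set.ncard_eq_toFinset_card', Nat.card_eq_fintype_card]
    exact card_edgeFinset_le_card_choose_two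
  obtain ⟨m, hm⟩ := Nat.exists_eq_add_of_le h3
  have h4 : (Nat.card V).choose 2 - G.edgeSet.ncard = m + 1 := by omega
  have h5 : (Nat.card V).choose 2 - (G.edgeSet.ncard + 1) = m := by omega
  simp only [measureReal_def, binomialRandom_singleton, h1, h2, h4, h5, ENNReal.toReal_mul,
    ENNReal.toReal_pow, ENNReal.coe_toReal, unitInterval.coe_toNNReal, unitInterval.coe_symm_eq]
  ring

open Classical in
/-- A present edge contributes the factor `p` if the rest does not depend on it. -/
theorem expect_edge {e : Sym2 V} (he : ¬ e.IsDiag) {f : SimpleGraph V → ℝ}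
    (hf : ∀ G, f (G ⊔ fromEdgeSet {e}) = f G) :
    expect p (fun G => if e ∈ G.edgeSet then f G else 0) = p * expect p f := by
  -- Adding and deleting `e` matches the graphs without `e` to those with it. The identity is kept
  -- free of division, since `1 - p` may vanish.
  have h1 : (1 - (p : ℝ)) * ∑ G : SimpleGraph V with e ∈ G.edgeSet,
      (binomialRandom V p).real {G} * f G =
      p * ∑ G : SimpleGraph V with e ∉ G.edgeSet, (binomialRandom V p).real {G} * f G := by
    rw [Finset.mul_sum, Finset.mul_sum]
    symm
    refine Finset.sum_bij' (fun G _ => G ⊔ fromEdgeSet {e}) (fun G _ => G.deleteEdges {e})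
      ?_ ?_ ?_ ?_ ?_
    · intro G _
      simp [edgeSet_sup, he]
    · intro G _
      simp
    · intro G hG
      rw [Finset.mem_filter_univ] at hG
      apply edgeSet_injective
      ext x
      simp only [edgeSet_deleteEdges, edgeSet_sup, edgeSet_fromEdgeSet, Set.mem_sdiff,
        Set.mem_union, Set.mem_singleton_iff]
      constructor
      · rintro ⟨h | h, h'⟩
        · exact h
        · exact absurd h.1 h'
      · exact fun h => ⟨Or.inl h, fun h' => hG (h' ▸ h)⟩
    · intro G hG
      rw [Finset.mem_filter_univ] at hG
      apply edgeSet_injective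
      ext x
      simp only [edgeSet_deleteEdges, edgeSet_sup, edgeSet_fromEdgeSet, Set.mem_sdiff,
        Set.mem_union, Set.mem_singleton_iff]
      constructor
      · rintro (h | h)
        · exact h.1
        · exact h.1 ▸ hG
      · intro h
        by_cases hx : x = e
        · exact Or.inr ⟨hx, hx ▸ he⟩
        · exact Or.inl ⟨h, hx⟩
    · intro G hG
      rw [Finset.mem_filter_univ] at hG
      rw [hf]
      linear_combination (-f G) * weight_sup_edge (p := p) he hG
  have h2 : expect p f = ∑ G : SimpleGraph V with e ∈ G.edgeSet,
      (binomialRandom V p).real {G} * f G + ∑ G : SimpleGraph V with e ∉ G.edgeSet,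
      (binomialRandom V p).real {G} * f G := by
    rw [expect, Finset.sum_filter_add_sum_filter_not]
  have h3 : expect p (fun G => if e ∈ G.edgeSet then f G else 0) =
      ∑ G : SimpleGraph V with e ∈ G.edgeSet, (binomialRandom V p).real {G} * f G := by
    rw [expect, Finset.sum_filter]
    exact Finset.sum_congr rfl fun G _ => by split_ifs <;> simp
  rw [h2, h3]
  linear_combination h1

open Classical in
/-- Present edges contribute a factor `p` each if the rest does not depend on them. -/
theorem expect_edges (S : Finset (Sym2 V)) (hS : ∀ e ∈ S, ¬ e.IsDiag) {f : SimpleGraph V → ℝ}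
    (hf : ∀ e ∈ S, ∀ G, f (G ⊔ fromEdgeSet {e}) = f G) :
    expect p (fun G => if ↑S ⊆ G.edgeSet then f G else 0) = p ^ S.card * expect p f := by
  induction S using Finset.induction_on with
  | empty => simp
  | insert e S he ih =>
    have h1 : (fun G : SimpleGraph V => if ↑(insert e S) ⊆ G.edgeSet then f G else 0) =
        fun G => if e ∈ G.edgeSet then (if ↑S ⊆ G.edgeSet then f G else 0) else 0 := by
      ext G
      rw [← ite_and]
      exact if_congr (by rw [Finset.coe_insert, Set.insert_subset_iff]) rfl rfl
    rw [h1, expect_edge (hS e (Finset.mem_insert_self _ _)), ih, Finset.card_insert_of_notMem he]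
    · ring
    · exact fun x hx => hS x (Finset.mem_insert_of_mem hx)
    · exact fun x hx => hf x (Finset.mem_insert_of_mem hx)
    · intro G
      rw [hf e (Finset.mem_insert_self _ _)]
      refine if_congr ?_ rfl rfl
      rw [edgeSet_sup, edgeSet_fromEdgeSet]
      refine ⟨fun h x hx => ?_, fun h => h.trans Set.subset_union_left⟩
      rcases h hx with h2 | h2
      · exact h2
      · exact absurd (h2.1 ▸ hx) he

open Classical in
theorem expect_subgraph (H : SimpleGraph V) {f : SimpleGraph V → ℝ}
    (hf : ∀ e ∈ H.edgeSet, ∀ G, f (G ⊔ fromEdgeSet {e}) = f G) :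
    expect p (fun G => if H ≤ G then f G else 0) = p ^ H.edgeSet.ncard * expect p f := by
  rw [Set.ncard_eq_toFinset_card', ← edgeFinset, ← expect_edges H.edgeFinset
    (fun e he => H.not_isDiag_of_mem_edgeSet (mem_edgeFinset.mp he))
    (fun e he => hf e (mem_edgeFinset.mp he))]
  simp only [coe_edgeFinset, edgeSet_subset_edgeSet]

open Classical in
theorem measureReal_subgraph (H : SimpleGraph V) :
    (binomialRandom V p).real {G | H ≤ G} = p ^ H.edgeSet.ncard := by
  rw [measureReal_eq_expect]
  have := expect_subgraph (p := p) H (f := fun _ => 1) (fun _ _ _ => rfl)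
  rw [expect_one, mul_one] at this
  exact this

open Classical in
theorem measureReal_edges (S : Finset (Sym2 V)) (hS : ∀ e ∈ S, ¬ e.IsDiag) :
    (binomialRandom V p).real {G | ↑S ⊆ G.edgeSet} = p ^ S.card := by
  rw [measureReal_eq_expect]
  have := expect_edges (p := p) S hS (f := fun _ => 1) (fun _ _ _ => rfl)
  rw [expect_one, mul_one] at this
  exact this

end RandomGraph

end

noncomputable section

namespace CliqueHomology

/-! ### Breadth first exploration of tight sets. -/

section Exploration

variable {V : Type*} [LinearOrder V] {G : SimpleGraph V} {d : ℕ} {R W : Finset V}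

open Classical in
/-- The indices of the neighbours of the `i`-th vertex among the vertices before it. -/
def back (G : SimpleGraph V) (w : ℕ → V) (i : ℕ) : Finset ℕ :=
  (Finset.range i).filter fun j => G.Adj (w i) (w j)

theorem mem_back {w : ℕ → V} {i j : ℕ} : j ∈ back G w i ↔ j < i ∧ G.Adj (w i) (w j) := by
  simp [back]

theorem back_congr {w w' : ℕ → V} {i : ℕ} (h : ∀ j ≤ i, w j = w' j) :
    back G w i = back G w' i := by
  ext j
  rw [mem_back, mem_back]
  refine and_congr_right fun hj => ?_
  rw [h i le_rfl, h j hj.le]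

/-- The indices `D` of visited vertices span a `d`-clique with a common neighbour in `W` that has
not been visited among the first `i` vertices. -/
def Expandable (G : SimpleGraph V) (d : ℕ) (W : Finset V) (w : ℕ → V) (i : ℕ) (D : Finset ℕ)
    (v : V) : Prop :=
  D ⊆ Finset.range i ∧ D.card = d ∧ (∀ a ∈ D, ∀ b ∈ D, a ≠ b → G.Adj (w a) (w b)) ∧ v ∈ W ∧
    (∀ j < i, w j ≠ v) ∧ ∀ a ∈ D, G.Adj v (w a)

theorem Expandable.congr {w w' : ℕ → V} {i : ℕ} {D : Finset ℕ} {v : V}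
    (h : ∀ j < i, w j = w' j) (hD : Expandable G d W w i D v) : Expandable G d W w' i D v := by
  obtain ⟨h1, h2, h3, h4, h5, h6⟩ := hD
  have h7 : ∀ a ∈ D, w a = w' a := fun a ha => h a (Finset.mem_range.mp (h1 ha))
  refine ⟨h1, h2, fun a ha b hb hab => ?_, h4, fun j hj => h j hj ▸ h5 j hj, fun a ha => ?_⟩
  · rw [← h7 a ha, ← h7 b hb]; exact h3 a ha b hb hab
  · rw [← h7 a ha]; exact h6 a ha

/-- Apart from its last vertex, a clique consists of earlier neighbours of that vertex. Knowing the
last index thus leaves few candidates for the clique. -/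
theorem Expandable.exists_sup (hd : 1 ≤ d) {w : ℕ → V} {i : ℕ} {D : Finset ℕ} {v : V}
    (hD : Expandable G d W w i D v) :
    D.sup id < i ∧ D ⊆ insert (D.sup id) (back G w (D.sup id)) := by
  have hne : D.Nonempty := Finset.card_pos.mp (by rw [hD.2.1]; omega)
  obtain ⟨s, hs, hsup⟩ := Finset.exists_mem_eq_sup D hne id
  rw [hsup, id]
  refine ⟨Finset.mem_range.mp (hD.1 hs), fun a ha => ?_⟩
  have hle : a ≤ s := by
    have := Finset.le_sup (f := id) ha
    rwa [hsup] at this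
  rcases hle.eq_or_lt with rfl | hlt
  · exact Finset.mem_insert_self _ _
  · exact Finset.mem_insert_of_mem (mem_back.mpr ⟨hlt, hD.2.2.1 s hs a ha hlt.ne'⟩)

/-- The state of the breadth first exploration of `W` from `R` after `i` vertices: `w` lists the
vertices, and `π j` is the index of the last vertex of the clique to which vertex `j` was
attached. -/
structure Explored (G : SimpleGraph V) (d : ℕ) (R W : Finset V) (i : ℕ) (w : ℕ → V)
    (π : ℕ → ℕ) : Prop where
  injOn : Set.InjOn w (Set.Iio i)
  mem : ∀ j < i, w j ∈ W
  root : ∀ r ∈ R, ∃ j < i, w j = r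
  clique : ∀ a ≤ d, ∀ b ≤ d, a ≠ b → G.Adj (w a) (w b)
  mono : ∀ j j', j ≤ j' → j' < i → π j ≤ π j'
  attach : ∀ j, d + 1 ≤ j → j < i → π j < j ∧
    ∃ D ⊆ back G w j, D.card = d ∧ D ⊆ insert (π j) (back G w (π j))
  closed : ∀ D v, Expandable G d W w i D v → ∀ j < i, π j ≤ D.sup id

/-- Tightness supplies an expandable clique until `W` is exhausted. Always expanding one whose last
index is smallest keeps the attachment indices monotone, by the invariant `closed`. -/
theorem TightFrom.exists_explored (hd : 1 ≤ d) (hW : TightFrom G d R W) (i : ℕ) (hi : d + 1 ≤ i)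
    (hiW : i ≤ W.card) : ∃ w π, Explored G d R W i w π := by
  obtain ⟨hRW, hRc, hR, hext⟩ := hW
  induction i, hi using Nat.le_induction with
  | base =>
    let e := R.orderEmbOfFin hRc
    -- The root clique comes first. Values of `w` beyond it are placeholders, and `π = 0` makes the
    -- conditions on `π` trivial.
    refine ⟨fun j => if h : j < d + 1 then e ⟨j, h⟩ else e 0, fun _ => 0, ?_, ?_, ?_, ?_, ?_, ?_, ?_⟩
    · intro a ha b hb hab
      simp only [Set.mem_Iio] at ha hb
      simp only [ha, hb, dif_pos] at hab
      simpa using e.injective hab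
    · intro j hj
      simp only [hj, dif_pos]
      exact hRW (Finset.orderEmbOfFin_mem _ _ _)
    · intro r hr
      have : r ∈ Set.range e := by rw [Finset.range_orderEmbOfFin]; exact hr
      obtain ⟨j, rfl⟩ := this
      exact ⟨j, j.2, by simp only [j.2, dif_pos]⟩
    · intro a ha b hb hab
      have ha' : a < d + 1 := by omega
      have hb' : b < d + 1 := by omega
      simp only [ha', hb', dif_pos]
      refine hR (Finset.orderEmbOfFin_mem _ _ _) (Finset.orderEmbOfFin_mem _ _ _) fun h => hab ?_
      simpa using e.injective h
    · intros; exact le_rfl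
    · intros; omega
    · intros; exact Nat.zero_le _
  | succ i hi ih =>
    obtain ⟨w, π, hE⟩ := ih (by omega)
    have hinj : Set.InjOn w (Finset.range i) := by rw [Finset.coe_range]; exact hE.injOn
    have hex : ∃ s D v, Expandable G d W w i D v ∧ D.sup id = s := by
      obtain ⟨D, hDU, hDc, hDcl, v, hv, hvU, hvD⟩ := hext ((Finset.range i).image w)
        (fun r hr => by
          obtain ⟨j, hj, rfl⟩ := hE.root r hr
          exact Finset.mem_image_of_mem _ (Finset.mem_range.mpr hj))
        (by
          refine Finset.ssubset_iff_subset_ne.mpr ⟨fun u hu => ?_, fun h => ?_⟩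
          · obtain ⟨j, hj, rfl⟩ := Finset.mem_image.mp hu
            exact hE.mem j (Finset.mem_range.mp hj)
          · have := Finset.card_image_of_injOn hinj
            rw [h, Finset.card_range] at this
            omega)
      refine ⟨_, (Finset.range i).filter (fun j => w j ∈ D), v, ⟨Finset.filter_subset _ _, ?_,
        fun a ha b hb hab => ?_, hv, fun j hj h => ?_, fun a ha => ?_⟩, rfl⟩
      · have himg : ((Finset.range i).filter (fun j => w j ∈ D)).image w = D := by
          ext u
          simp only [Finset.mem_image, Finset.mem_filter]
          constructor
          · rintro ⟨j, hj, rfl⟩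
            exact hj.2
          · intro hu
            obtain ⟨j, hj, rfl⟩ := Finset.mem_image.mp (hDU hu)
            exact ⟨j, ⟨hj, hu⟩, rfl⟩
        rw [← hDc, ← himg, Finset.card_image_of_injOn, himg]
        exact hinj.mono (Finset.coe_subset.mpr (Finset.filter_subset _ _))
      · rw [Finset.mem_filter] at ha hb
        exact hDcl ha.2 hb.2 fun h => hab (hinj ha.1 hb.1 h)
      · exact hvU (Finset.mem_image.mpr ⟨j, Finset.mem_range.mpr hj, h⟩)
      · exact hvD _ (Finset.mem_filter.mp ha).2
    classical
    -- The breadth first rule: the next vertex is attached to an expandable clique whose last index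
    -- is least.
    obtain ⟨D, v, hD, hsup⟩ := Nat.find_spec hex
    have hmin : ∀ D' v', Expandable G d W w i D' v' → D.sup id ≤ D'.sup id := by
      intro D' v' h
      rw [hsup]
      exact Nat.find_min' hex ⟨D', v', h, rfl⟩
    clear hsup
    obtain ⟨hsi, hDsub⟩ := hD.exists_sup hd
    have hwj : ∀ j < i, Function.update w i v j = w j := fun j hj =>
      Function.update_of_ne hj.ne _ _
    have hπj : ∀ j < i, Function.update π i (D.sup id) j = π j := fun j hj =>
      Function.update_of_ne hj.ne _ _
    have hback : ∀ j < i, back G (Function.update w i v) j = back G w j := fun j hj =>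
      back_congr fun a ha => hwj a (by omega)
    refine ⟨Function.update w i v, Function.update π i (D.sup id), ?_, ?_, ?_, ?_, ?_, ?_, ?_⟩
    · intro a ha b hb hab
      simp only [Set.mem_Iio] at ha hb
      rcases Nat.lt_succ_iff_lt_or_eq.mp ha with ha | rfl <;>
        rcases Nat.lt_succ_iff_lt_or_eq.mp hb with hb | rfl
      · rw [hwj a ha, hwj b hb] at hab
        exact hE.injOn ha hb hab
      · rw [hwj a ha, Function.update_self] at hab
        exact absurd hab (hD.2.2.2.2.1 a ha)
      · rw [hwj b hb, Function.update_self] at hab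
        exact absurd hab.symm (hD.2.2.2.2.1 b hb)
      · rfl
    · intro j hj
      rcases Nat.lt_succ_iff_lt_or_eq.mp hj with hj | rfl
      · rw [hwj j hj]; exact hE.mem j hj
      · rw [Function.update_self]; exact hD.2.2.2.1
    · intro r hr
      obtain ⟨j, hj, rfl⟩ := hE.root r hr
      exact ⟨j, by omega, hwj j hj⟩
    · intro a ha b hb hab
      rw [hwj a (by omega), hwj b (by omega)]
      exact hE.clique a ha b hb hab
    · intro j j' hjj' hj'
      rcases Nat.lt_succ_iff_lt_or_eq.mp hj' with hj' | rfl
      · rw [hπj j' hj', hπj j (by omega)]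
        exact hE.mono j j' hjj' hj'
      · rcases hjj'.eq_or_lt with rfl | hlt
        · exact le_rfl
        · rw [Function.update_self, hπj j hlt]
          exact hE.closed D v hD j hlt
    · intro j hj hji
      rcases Nat.lt_succ_iff_lt_or_eq.mp hji with hji | rfl
      · rw [hback j hji, hπj j hji, hback _ ((hE.attach j hj hji).1.trans hji)]
        exact hE.attach j hj hji
      · rw [Function.update_self, hback _ hsi]
        refine ⟨hsi, D, fun a ha => ?_, hD.2.1, hDsub⟩
        have haj := Finset.mem_range.mp (hD.1 ha)
        rw [mem_back, Function.update_self, hwj a haj]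
        exact ⟨haj, hD.2.2.2.2.2 a ha⟩
    -- A clique expandable after this step either uses the new index `i`, which exceeds every
    -- attachment index, or was expandable before, so that the old invariant and the minimality of
    -- `D` apply.
    · intro D' v' hD' j hj
      by_cases hiD : i ∈ D'
      · refine le_trans ?_ (Finset.le_sup (f := id) hiD)
        rcases Nat.lt_succ_iff_lt_or_eq.mp hj with hj | rfl
        · rw [hπj j hj]
          exact (hE.closed D v hD j hj).trans hsi.le
        · rw [Function.update_self]; exact hsi.le
      · have hsub : D' ⊆ Finset.range i := fun a ha => by
          have h1 := Finset.mem_range.mp (hD'.1 ha)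
          have h2 : a ≠ i := fun h => hiD (h ▸ ha)
          exact Finset.mem_range.mpr (by omega)
        have hD'' : Expandable G d W w i D' v' := by
          refine Expandable.congr hwj ⟨hsub, hD'.2.1, hD'.2.2.1, hD'.2.2.2.1, fun j hj => ?_,
            hD'.2.2.2.2.2⟩
          exact hD'.2.2.2.2.1 j (by omega)
        rcases Nat.lt_succ_iff_lt_or_eq.mp hj with hj | rfl
        · rw [hπj j hj]; exact hE.closed D' v' hD'' j hj
        · rw [Function.update_self]; exact hmin D' v' hD''

theorem Explored.two_mul_sum_card_back {w : ℕ → V} {π : ℕ → ℕ}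
    (hE : Explored G d R W W.card w π) :
    2 * ∑ i ∈ Finset.range W.card, (back G w i).card = ∑ v ∈ W, (nbrs G W v).card := by
  classical
  have hinj : Set.InjOn w (Finset.range W.card) := by rw [Finset.coe_range]; exact hE.injOn
  have himg : (Finset.range W.card).image w = W := by
    refine Finset.eq_of_subset_of_card_le (fun u hu => ?_) ?_
    · obtain ⟨j, hj, rfl⟩ := Finset.mem_image.mp hu
      exact hE.mem j (Finset.mem_range.mp hj)
    · rw [Finset.card_image_of_injOn hinj, Finset.card_range]
  have key : ∀ m, 2 * ∑ i ∈ Finset.range m, (back G w i).card = ∑ i ∈ Finset.range m,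
      ∑ j ∈ Finset.range m, if G.Adj (w i) (w j) then 1 else 0 := by
    intro m
    induction m with
    | zero => simp
    | succ m ih =>
      have h1 : ∀ i, ∑ j ∈ Finset.range (m + 1), (if G.Adj (w i) (w j) then 1 else 0) =
          ∑ j ∈ Finset.range m, (if G.Adj (w i) (w j) then 1 else 0) +
            if G.Adj (w i) (w m) then 1 else 0 := fun i => Finset.sum_range_succ _ _
      have h2 : (back G w m).card = ∑ j ∈ Finset.range m, if G.Adj (w m) (w j) then 1 else 0 := by
        rw [back, Finset.card_filter]
      have h3 : ∑ j ∈ Finset.range m, (if G.Adj (w j) (w m) then 1 else 0) = (back G w m).card := by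
        rw [h2]
        exact Finset.sum_congr rfl fun j _ => if_congr (G.adj_comm _ _) rfl rfl
      rw [Finset.sum_range_succ, mul_add, ih, Finset.sum_range_succ]
      simp only [h1]
      rw [Finset.sum_add_distrib, h3, ← h2, if_neg (G.loopless.irrefl _)]
      ring
  rw [key]
  rw [← Finset.sum_congr himg fun _ _ => rfl, Finset.sum_image hinj]
  refine Finset.sum_congr rfl fun i _ => ?_
  nth_rewrite 2 [← himg]
  rw [← Finset.card_filter, nbrs, Finset.filter_image, Finset.card_image_of_injOn]
  exact hinj.mono (Finset.coe_subset.mpr (Finset.filter_subset _ _))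

end Exploration

end CliqueHomology

end

noncomputable section

namespace CliqueHomology

/-! ### Counting the shapes of dense explorations. -/

section Shapes

variable {d m : ℕ} {B : ℕ → Finset ℕ}

/-- The number of edges by which a graph on `m` vertices with `d m + 1` edges exceeds the number
`∑ i < m, min i d`. -/
def excess (d : ℕ) : ℕ := d * (d + 1) / 2 + 1

theorem sum_min_add_excess (hm : d + 1 ≤ m) :
    ∑ i ∈ Finset.range m, min i d + excess d = d * m + 1 := by
  have h0 : d * (d + 1) / 2 * 2 = d * (d + 1) :=
    Nat.div_mul_cancel (Nat.even_mul_succ_self d).two_dvd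
  have h1 : ∀ m, d + 1 ≤ m → 2 * ∑ i ∈ Finset.range m, min i d + d * (d + 1) = 2 * (d * m) := by
    intro m hm
    induction m, hm using Nat.le_induction with
    | base =>
      have h2 : ∑ i ∈ Finset.range (d + 1), min i d = ∑ i ∈ Finset.range (d + 1), i :=
        Finset.sum_congr rfl fun i hi => min_eq_left (by rw [Finset.mem_range] at hi; omega)
      have h3 := Finset.sum_range_id_mul_two (d + 1)
      rw [h2]
      simp only [Nat.add_sub_cancel] at h3
      linarith
    | succ m hm ih =>
      rw [Finset.sum_range_succ, min_eq_right (by omega)]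
      linarith
  have h2 := h1 m hm
  rw [excess]
  omega

/-- The shape of an exploration of a set of `m` vertices with `d m + 1` recorded edges: `B i` is the
set of indices of earlier vertices to which vertex `i` is joined by a recorded edge. -/
structure IsShape (d m : ℕ) (B : ℕ → Finset ℕ) : Prop where
  le : d + 1 ≤ m
  subset : ∀ i, B i ⊆ Finset.range i
  out : ∀ i, m ≤ i → B i = ∅
  total : ∑ i ∈ Finset.range m, (B i).card = d * m + 1
  root : ∀ i ≤ d, B i = Finset.range i
  attach : ∃ π : ℕ → ℕ, (∀ j j', j ≤ j' → j' < m → π j ≤ π j') ∧ (∀ i < m, π i < m) ∧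
    ∀ i, d + 1 ≤ i → i < m → π i < i ∧ (insert (π i) (B (π i))).card ≤ d + excess d ∧
      ∃ D ⊆ B i, D.card = d ∧ D ⊆ insert (π i) (B (π i))

/-- One fixed numbering of subsets serves all shapes, so an attaching clique costs a single number
below `2 ^ K`. Unused numbers decode to the empty set. -/
theorem exists_subset_decoder (K : ℕ) : ∃ dec : Finset ℕ → Fin (2 ^ K) → Finset ℕ,
    ∀ A D : Finset ℕ, A.card ≤ K → D ⊆ A → ∃ t, dec A t = D := by
  refine ⟨fun A t => if h : t < A.powerset.card then (A.powerset.equivFin.symm ⟨t, h⟩).1 else ∅,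
    fun A D hA hD => ?_⟩
  have hc : A.powerset.card ≤ 2 ^ K := by
    rw [Finset.card_powerset]
    exact Nat.pow_le_pow_right two_pos hA
  let t := A.powerset.equivFin ⟨D, Finset.mem_powerset.mpr hD⟩
  refine ⟨⟨t, t.2.trans_le hc⟩, ?_⟩
  refine (dif_pos t.2).trans ?_
  rw [Fin.eta, Equiv.symm_apply_apply]

/-- The shape with attachment map `π`, extra edges `X`, and choices `t` of the remaining edges. -/
def decode (d m : ℕ) {K : ℕ} (dec : Finset ℕ → Fin K → Finset ℕ) (π : Fin m → Fin m)
    (X : Finset (ℕ × ℕ)) (t : Fin m → Fin K) (i : ℕ) : Finset ℕ :=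
  if hi : i < m then
    if i ≤ d then Finset.range i
    else (X.filter fun q => q.1 = i).image Prod.snd ∪
      -- The test makes the recursion terminate; for actual shapes it always succeeds at indices
      -- above `d`.
      if _hπ : π ⟨i, hi⟩ < i then
        dec (insert (π ⟨i, hi⟩).1 (decode d m dec π X t (π ⟨i, hi⟩))) (t ⟨i, hi⟩) else ∅
  else ∅
termination_by i

/-- Adding the index makes a monotone map strictly monotone, hence determined by its range, a subset
of `2 m` points. All maps together would number `m ^ m`, which is too many; this is the gain from
the breadth first order. -/
theorem card_monotone_le (m : ℕ) [DecidablePred fun π : Fin m → Fin m => Monotone π] :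
    (Finset.univ.filter fun π : Fin m → Fin m => Monotone π).card ≤ 4 ^ m := by
  have hmono : ∀ π : Fin m → Fin m, Monotone π → StrictMono fun i : Fin m => (i : ℕ) + π i := by
    intro π hπ i j hij
    have h1 : (π i : ℕ) ≤ π j := hπ hij.le
    have h2 : (i : ℕ) < j := hij
    simp only
    omega
  have h1 : (Finset.range (2 * m)).powerset.card = 4 ^ m := by
    rw [Finset.card_powerset, Finset.card_range, pow_mul]
    norm_num
  rw [← h1]
  refine Finset.card_le_card_of_injOn
    (fun π => Finset.univ.image fun i : Fin m => (i : ℕ) + π i) (fun π _ => ?_) ?_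
  · simp only [Finset.coe_powerset, Set.mem_preimage, Set.mem_powerset_iff, Finset.coe_subset]
    intro a ha
    obtain ⟨i, -, rfl⟩ := Finset.mem_image.mp ha
    have h1 := i.2
    have h2 := (π i).2
    exact Finset.mem_range.mpr (by omega)
  · intro π hπ π' hπ' he
    rw [Finset.mem_coe, Finset.mem_filter_univ] at hπ hπ'
    have he' := congrArg (fun s : Finset ℕ => (s : Set ℕ)) he
    simp only [Finset.coe_image, Finset.coe_univ, Set.image_univ] at he'
    have := (StrictMono.range_inj (hmono π hπ) (hmono π' hπ')).mp he'
    ext i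
    have h : (i : ℕ) + π i = i + π' i := congrFun this i
    omega

-- A shape is encoded by its monotone attachment map, by the edges outside the attaching cliques,
-- always `excess d` in number, and by the choice of each attaching clique within at most `d +
-- excess d` candidate indices. The three factors count these data.
open Classical in
theorem exists_finset_shapes (d m : ℕ) : ∃ S : Finset (ℕ → Finset ℕ), (∀ B, IsShape d m B → B ∈ S) ∧
    S.card ≤ 4 ^ m * (m * m) ^ excess d * (2 ^ (d + excess d)) ^ m := by
  obtain ⟨dec, hdec⟩ := exists_subset_decoder (d + excess d)
  let C : Finset ((Fin m → Fin m) × Finset (ℕ × ℕ) × (Fin m → Fin (2 ^ (d + excess d)))) :=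
    (Finset.univ.filter fun π : Fin m → Fin m => Monotone π) ×ˢ
      (Finset.powersetCard (excess d) (Finset.range m ×ˢ Finset.range m) ×ˢ Finset.univ)
  refine ⟨C.image fun c => decode d m dec c.1 c.2.1 c.2.2, fun B hB => ?_, ?_⟩
  swap
  · refine Finset.card_image_le.trans ?_
    rw [Finset.card_product, Finset.card_product, mul_assoc]
    refine Nat.mul_le_mul (card_monotone_le m) (Nat.mul_le_mul ?_ ?_)
    · rw [Finset.card_powersetCard, Finset.card_product, Finset.card_range]
      exact Nat.choose_le_pow _ _
    · simp
  obtain ⟨π, hmono, hπm, hatt⟩ := hB.attach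
  choose! hπ hcard D hDB hDc hDπ using hatt
  have htex : ∀ i, d + 1 ≤ i → i < m → ∃ t, dec (insert (π i) (B (π i))) t = D i :=
    fun i h1 h2 => hdec _ _ (hcard i h1 h2) (hDπ i h1 h2)
  have hpos : 0 < 2 ^ (d + excess d) := by positivity
  have : Inhabited (Fin (2 ^ (d + excess d))) := ⟨⟨0, hpos⟩⟩
  choose! t ht using htex
  let X : Finset (ℕ × ℕ) := (Finset.range m ×ˢ Finset.range m).filter
    fun q => d + 1 ≤ q.1 ∧ q.2 ∈ B q.1 ∧ q.2 ∉ D q.1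
  have hX : X.card = excess d := by
    have h1 : X.card = ∑ i ∈ Finset.range m, if d + 1 ≤ i then (B i \ D i).card else 0 := by
      rw [Finset.card_filter, Finset.sum_product]
      refine Finset.sum_congr rfl fun i hi => ?_
      split_ifs with h
      · simp only [h, true_and]
        rw [← Finset.card_filter]
        congr 1
        ext j
        simp only [Finset.mem_filter, Finset.mem_sdiff, Finset.mem_range]
        refine ⟨fun h => h.2, fun h => ⟨?_, h⟩⟩
        have h1 := Finset.mem_range.mp (hB.subset i h.1)
        have h2 := Finset.mem_range.mp hi
        omega
      · simp [h]
    have h2 : ∑ i ∈ Finset.range m, (B i).card =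
        ∑ i ∈ Finset.range m, min i d + ∑ i ∈ Finset.range m,
          if d + 1 ≤ i then (B i \ D i).card else 0 := by
      rw [← Finset.sum_add_distrib]
      refine Finset.sum_congr rfl fun i hi => ?_
      rw [Finset.mem_range] at hi
      split_ifs with h
      · have := Finset.card_sdiff_add_card_eq_card (hDB i h hi)
        rw [hDc i h hi] at this
        rw [min_eq_right (by omega)]
        omega
      · rw [hB.root i (by omega), Finset.card_range, min_eq_left (by omega), add_zero]
    have h3 := sum_min_add_excess hB.le
    have h4 := hB.total
    omega
  rw [Finset.mem_image]
  refine ⟨(fun i => ⟨π i, hπm i i.2⟩, X, fun i => t i), ?_, ?_⟩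
  · simp only [C, Finset.mem_product, Finset.mem_filter_univ, Finset.mem_powersetCard,
      Finset.mem_univ, and_true]
    exact ⟨fun i j hij => hmono i j hij j.2, Finset.filter_subset _ _, hX⟩
  · ext1 i
    induction i using Nat.strong_induction_on with
    | _ i ih =>
    rw [decode]
    split_ifs with h1 h2 h3
    · exact (hB.root i h2).symm
    · simp only at h3 ⊢
      have h4 : d + 1 ≤ i := by omega
      rw [ih _ h3, ht i h4 h1]
      ext j
      simp only [X, Finset.mem_union, Finset.mem_image, Finset.mem_filter, Finset.mem_product,
        Finset.mem_range]
      constructor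
      · rintro (⟨⟨a, b⟩, ⟨⟨-, -, h5, -⟩, h6⟩, h7⟩ | h)
        · simp only at h5 h6 h7
          rw [← h6, ← h7]; exact h5
        · exact hDB i h4 h1 h
      · intro hj
        by_cases hjD : j ∈ D i
        · exact Or.inr hjD
        · have := Finset.mem_range.mp (hB.subset i hj)
          exact Or.inl ⟨(i, j), ⟨⟨⟨h1, by simp only; omega⟩, h4, hj, hjD⟩, rfl⟩, rfl⟩
    · exact absurd (hπ i (by omega) h1) h3
    · exact (hB.out i (by omega)).symm

variable {V : Type*} [LinearOrder V] [Fintype V] {G : SimpleGraph V}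

/-- A graph which is not sparse contains an exploration with too many edges. -/
theorem exists_shape_of_not_sparse (hd : 1 ≤ d) (hG : ¬ Sparse G d) :
    ∃ m ≤ Fintype.card V, ∃ B, IsShape d m B ∧ ∃ w : ℕ → V, Set.InjOn w (Set.Iio m) ∧
      ∀ i < m, ∀ j ∈ B i, G.Adj (w i) (w j) := by
  rw [Sparse] at hG
  push Not at hG
  obtain ⟨R, W, hT, hlt⟩ := hG
  have hdW : d + 1 ≤ W.card := hT.2.1 ▸ Finset.card_le_card hT.1
  obtain ⟨w, π, hE⟩ := hT.exists_explored hd W.card hdW le_rfl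
  have hsum := hE.two_mul_sum_card_back
  -- The exploration is cut at the first `m` with more than `d m` edges. Minimality controls all
  -- vertices before the last one.
  have hex : ∃ m, d * m + 1 ≤ ∑ i ∈ Finset.range m, (back G w i).card :=
    ⟨W.card, by rw [mul_assoc] at hlt; omega⟩
  classical
  obtain ⟨M, hM⟩ : ∃ M, Nat.find hex = M + 1 := by
    refine ⟨Nat.find hex - 1, ?_⟩
    have : Nat.find hex ≠ 0 := fun h => by
      have := Nat.find_spec hex
      rw [h] at this
      simp at this
    omega
  have hspec := Nat.find_spec hex
  have hMW : M + 1 ≤ W.card := hM ▸ Nat.find_min' hex (by rw [mul_assoc] at hlt; omega)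
  have hmin : ∑ i ∈ Finset.range M, (back G w i).card ≤ d * M := by
    have := Nat.find_min hex (m := M) (by omega)
    omega
  rw [hM, Finset.sum_range_succ, mul_add, mul_one] at hspec
  have hback_sub : ∀ i, back G w i ⊆ Finset.range i := fun i => by
    rw [back]; exact Finset.filter_subset _ _
  have hback_root : ∀ i ≤ d, back G w i = Finset.range i := by
    intro i hi
    ext j
    rw [mem_back, Finset.mem_range]
    exact ⟨fun h => h.1, fun h => ⟨h, hE.clique i hi j (by omega) h.ne'⟩⟩
  have hdM : d + 1 ≤ M := by
    by_contra! hMd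
    have h1 : ∀ i ∈ Finset.range (M + 1), (back G w i).card = i := fun i hi => by
      rw [Finset.mem_range] at hi
      rw [hback_root i (by omega), Finset.card_range]
    have h2 := Finset.sum_congr rfl h1
    rw [Finset.sum_range_succ] at h2
    have h3 := Finset.sum_range_id_mul_two (M + 1)
    simp only [Nat.add_sub_cancel] at h3
    nlinarith
  have hmin_le : ∀ i < W.card, min i d ≤ (back G w i).card := by
    intro i hi
    by_cases hid : i ≤ d
    · rw [hback_root i hid, Finset.card_range]; exact min_le_left _ _
    · obtain ⟨-, D, hD, hDc, -⟩ := hE.attach i (by omega) hi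
      exact (min_le_right _ _).trans (hDc ▸ Finset.card_le_card hD)
  -- Each vertex `i` has at least `min i d` earlier neighbours, and the first `M` vertices have at
  -- most `d M` edges in total. So no single vertex exceeds its minimum by more than `excess d - 1`.
  have hcard : ∀ j < M, (back G w j).card + 1 ≤ d + excess d := by
    intro j hj
    have h1 := Finset.add_sum_erase (Finset.range M) (fun i => (back G w i).card)
      (Finset.mem_range.mpr hj)
    have h2 := Finset.add_sum_erase (Finset.range M) (fun i => min i d) (Finset.mem_range.mpr hj)
    have h3 : ∑ i ∈ (Finset.range M).erase j, min i d ≤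
        ∑ i ∈ (Finset.range M).erase j, (back G w i).card :=
      Finset.sum_le_sum fun i hi => hmin_le i (by
        have := Finset.mem_range.mp (Finset.mem_of_mem_erase hi)
        omega)
    have h4 := sum_min_add_excess hdM
    have h5 : min j d ≤ d := min_le_right _ _
    omega
  obtain ⟨hπM, D, hDB, hDc, hDπ⟩ := hE.attach M (by omega) (by omega)
  -- The last vertex may overshoot. Its recorded edges are thinned until the total is exactly `d (M
  -- + 1) + 1`, keeping the attaching clique.
  obtain ⟨B', hDB', hB', hB'c⟩ := Finset.exists_subsuperset_card_eq
    (n := d * M + d + 1 - ∑ i ∈ Finset.range M, (back G w i).card) hDB (by omega) (by omega)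
  let B : ℕ → Finset ℕ := fun i => if i < M then back G w i else if i = M then B' else ∅
  have hBlt : ∀ i < M, B i = back G w i := fun i hi => if_pos hi
  have hBM : B M = B' := by simp [B]
  have hBback : ∀ i, B i ⊆ back G w i := by
    intro i
    simp only [B]
    split_ifs with h1 h2
    · exact subset_rfl
    · exact h2 ▸ hB'
    · exact Finset.empty_subset _
  refine ⟨M + 1, hMW.trans (Finset.card_le_univ W), B, ⟨by omega, fun i =>
    (hBback i).trans (hback_sub i), fun i hi => ?_, ?_, fun i hi => ?_, π, fun j j' hj hj' =>
    hE.mono j j' hj (by omega), fun i hi => ?_, fun i hi hiM => ?_⟩, w,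
    hE.injOn.mono fun i hi => ?_, fun i _ j hj => (mem_back.mp (hBback i hj)).2⟩
  · simp only [B]
    rw [if_neg (by omega), if_neg (by omega)]
  · rw [Finset.sum_range_succ, hBM, hB'c, Finset.sum_congr rfl fun i hi => by
      rw [hBlt i (Finset.mem_range.mp hi)], mul_add]
    omega
  · rw [hBlt i (by omega), hback_root i hi]
  · by_cases hid : d + 1 ≤ i
    · have := (hE.attach i hid (by omega)).1
      omega
    · have h1 := (hE.attach (d + 1) le_rfl (by omega)).1
      have h2 := hE.mono i (d + 1) (by omega) (by omega)
      omega
  · obtain ⟨h1, D₁, h2, h3, h4⟩ := hE.attach i hi (by omega)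
    have h5 : B (π i) = back G w (π i) := hBlt _ (by omega)
    rw [h5]
    refine ⟨h1, (Finset.card_insert_le _ _).trans (hcard _ (by omega)), ?_⟩
    rcases Nat.lt_succ_iff_lt_or_eq.mp hiM with hlt | rfl
    · exact ⟨D₁, by rw [hBlt i hlt]; exact h2, h3, h4⟩
    · exact ⟨D, by rw [hBM]; exact hDB', hDc, hDπ⟩
  · simp only [Set.mem_Iio] at hi ⊢
    omega

end Shapes

end CliqueHomology

end

noncomputable section

namespace RandomGraph

open SimpleGraph CliqueHomology

/-! ### First moment bound for the failure of sparsity. -/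

section UnionBound

variable {V : Type*} [LinearOrder V] [Fintype V] {p : unitInterval} {d m : ℕ} {B : ℕ → Finset ℕ}

open Classical in
/-- The edges of a shape placed on the vertices `w`. -/
def placedEdges (B : ℕ → Finset ℕ) (w : Fin m ↪ V) : Finset (Sym2 V) :=
  (Finset.univ.filter fun q : Fin m × Fin m => (q.2 : ℕ) ∈ B q.1).image fun q => s(w q.1, w q.2)

theorem lt_of_isShape (hB : IsShape d m B) {i j : ℕ} (h : j ∈ B i) : j < i :=
  Finset.mem_range.mp (hB.subset i h)

theorem card_placedEdges (hB : IsShape d m B) (w : Fin m ↪ V) :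
    (placedEdges B w).card = d * m + 1 := by
  classical
  rw [placedEdges, Finset.card_image_of_injOn, ← hB.total, Finset.card_filter,
    ← Finset.univ_product_univ, Finset.sum_product,
    Finset.sum_range fun i => (B i).card]
  · refine Finset.sum_congr rfl fun i _ => ?_
    rw [← Finset.card_filter]
    have hmem : ∀ j ∈ B i, j < m := fun j hj => (lt_of_isShape hB hj).trans i.2
    symm
    refine Finset.card_bij (fun j hj => ⟨j, hmem j hj⟩) ?_ ?_ ?_
    · intro j hj
      simpa using hj
    · intro a _ b _ hab
      simpa using hab
    · intro b hb
      exact ⟨b, (Finset.mem_filter_univ b).mp hb, rfl⟩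
  · rintro ⟨i, j⟩ hij ⟨i', j'⟩ hij' he
    rw [Finset.mem_coe, Finset.mem_filter_univ] at hij hij'
    have h1 := lt_of_isShape hB hij
    have h2 := lt_of_isShape hB hij'
    simp only [Sym2.eq_iff, w.injective.eq_iff] at he
    rcases he with ⟨rfl, rfl⟩ | ⟨rfl, rfl⟩
    · rfl
    · simp only at h1 h2
      omega

theorem not_isDiag_of_mem_placedEdges (hB : IsShape d m B) (w : Fin m ↪ V) :
    ∀ e ∈ placedEdges B w, ¬ e.IsDiag := by
  classical
  intro e he
  obtain ⟨⟨i, j⟩, hij, rfl⟩ := Finset.mem_image.mp he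
  rw [Finset.mem_filter_univ] at hij
  rw [Sym2.mk_isDiag_iff, w.injective.eq_iff]
  rintro (h : i = j)
  subst h
  exact lt_irrefl _ (lt_of_isShape hB hij)

/-- The first moment bound for the failure of sparsity. -/
theorem measureReal_not_sparse_le (hd : 1 ≤ d) :
    (binomialRandom V p).real {G | ¬ Sparse G d} ≤
      ∑ m ∈ Finset.range (Fintype.card V + 1),
        (4 ^ m * (m * m) ^ excess d * (2 ^ (d + excess d)) ^ m : ℕ) *
          ((Fintype.card V : ℝ) ^ m * (p : ℝ) ^ (d * m + 1)) := by
  classical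
  choose S hS hSc using fun m => exists_finset_shapes d m
  have hsub : {G : SimpleGraph V | ¬ Sparse G d} ⊆
      ⋃ m ∈ Finset.range (Fintype.card V + 1), ⋃ B ∈ (S m).filter (IsShape d m),
        ⋃ w ∈ (Finset.univ : Finset (Fin m ↪ V)), {G | ↑(placedEdges B w) ⊆ G.edgeSet} := by
    intro G hG
    obtain ⟨m, hm, B, hB, w, hw, hadj⟩ := exists_shape_of_not_sparse hd hG
    simp only [Set.mem_iUnion]
    refine ⟨m, Finset.mem_range.mpr (by omega), B, Finset.mem_filter.mpr ⟨hS m B hB, hB⟩,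
      ⟨fun i => w i, fun i j hij => Fin.ext (hw i.2 j.2 hij)⟩, Finset.mem_univ _, ?_⟩
    intro e he
    obtain ⟨⟨i, j⟩, hij, rfl⟩ := Finset.mem_image.mp he
    rw [Finset.mem_filter_univ] at hij
    exact hadj i i.2 j hij
  refine (measureReal_mono hsub (measure_ne_top _ _)).trans ((measureReal_biUnion_finset_le _ _).trans
    (Finset.sum_le_sum fun m _ => ?_))
  have h1 : ∀ B ∈ (S m).filter (IsShape d m), (binomialRandom V p).real
      (⋃ w ∈ (Finset.univ : Finset (Fin m ↪ V)), {G | ↑(placedEdges B w) ⊆ G.edgeSet}) ≤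
      (Fintype.card V : ℝ) ^ m * (p : ℝ) ^ (d * m + 1) := by
    intro B hB
    have hB' := (Finset.mem_filter.mp hB).2
    refine (measureReal_biUnion_finset_le _ _).trans ?_
    have h2 : ∀ w ∈ (Finset.univ : Finset (Fin m ↪ V)), (binomialRandom V p).real
        {G | ↑(placedEdges B w) ⊆ G.edgeSet} = (p : ℝ) ^ (d * m + 1) := fun w _ => by
      rw [measureReal_edges _ (not_isDiag_of_mem_placedEdges hB' w), card_placedEdges hB']
    rw [Finset.sum_congr rfl h2, Finset.sum_const, nsmul_eq_mul]
    refine mul_le_mul_of_nonneg_right ?_ (pow_nonneg p.2.1 _)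
    rw [Finset.card_univ, Fintype.card_embedding_eq, Fintype.card_fin]
    exact_mod_cast Nat.descFactorial_le_pow _ _
  refine (measureReal_biUnion_finset_le _ _).trans ((Finset.sum_le_sum h1).trans ?_)
  rw [Finset.sum_const, nsmul_eq_mul]
  refine mul_le_mul_of_nonneg_right ?_
    (mul_nonneg (pow_nonneg (Nat.cast_nonneg _) _) (pow_nonneg p.2.1 _))
  exact_mod_cast (Finset.card_filter_le _ _).trans (hSc m)

end UnionBound

/-! ### The threshold for `c`. -/

section Threshold

variable {d : ℕ} {c : ℝ≥0}

theorem edgeProb_pow (hd : 1 ≤ d) (hc : c ≤ 1) (n : ℕ) :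
    (edgeProb c d n : ℝ) ^ d = (c : ℝ) ^ d / n := by
  have hd' : (d : ℝ) ≠ 0 := by positivity
  rw [coe_edgeProb hc, div_pow, ← Real.rpow_natCast ((n : ℝ) ^ (1 / (d : ℝ))),
    ← Real.rpow_mul (Nat.cast_nonneg n), one_div_mul_cancel hd', Real.rpow_one]

theorem edgeProb_pow_mul_le (hd : 1 ≤ d) (hc : c ≤ 1) (n : ℕ) :
    (n : ℝ) * (edgeProb c d n : ℝ) ^ d ≤ (c : ℝ) ^ d := by
  rw [edgeProb_pow hd hc]
  rcases Nat.eq_zero_or_pos n with rfl | hn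
  · simp
  · rw [mul_div_cancel₀ _ (by positivity)]

theorem tendsto_edgeProb (hd : 1 ≤ d) (hc : c ≤ 1) :
    Tendsto (fun n : ℕ => (edgeProb c d n : ℝ)) atTop (𝓝 0) := by
  simp_rw [coe_edgeProb hc]
  have hd' : (0 : ℝ) < 1 / (d : ℝ) := by positivity
  exact ((tendsto_rpow_atTop hd').comp tendsto_natCast_atTop_atTop).const_div_atTop _

theorem le_one_of_lt (hd : 2 ≤ d) (hc : c < 1 / (2 ^ (2 * d + 1) * (d : ℝ≥0))) : c ≤ 1 := by
  refine hc.le.trans ?_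
  rw [div_le_one (by positivity)]
  have h1 : (1 : ℝ≥0) ≤ 2 ^ (2 * d + 1) := one_le_pow₀ (by norm_num)
  have h2 : (1 : ℝ≥0) ≤ d := by exact_mod_cast (by omega : 1 ≤ d)
  exact one_le_mul_of_one_le_of_one_le h1 h2

/-- For `d ≥ 2` the hypothesis gives `c ≤ 2^(-(2d+2))`, and `(2d+2) d ≥ d + excess d + 4`. The ratio
`1 / 4` leaves room for the polynomial factor in the number of shapes. -/
theorem growth_lt (hd : 2 ≤ d) (hc : c < 1 / (2 ^ (2 * d + 1) * (d : ℝ≥0))) :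
    4 * 2 ^ (d + excess d) * (c : ℝ) ^ d ≤ 1 / 4 := by
  have hc' : (c : ℝ) * (2 ^ (2 * d + 1) * d) ≤ 1 := by
    have := (lt_div_iff₀ (by positivity)).mp hc
    exact_mod_cast this.le
  have h2 : (2 : ℝ) ≤ d := by exact_mod_cast hd
  have hc0 : (0 : ℝ) ≤ c := c.2
  have h1 : (c : ℝ) * 2 ^ (2 * d + 2) ≤ 1 := by
    refine le_trans ?_ hc'
    rw [pow_succ 2 (2 * d + 1)]
    exact mul_le_mul_of_nonneg_left (mul_le_mul_of_nonneg_left h2 (by positivity)) hc0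
  have h3 : ((c : ℝ) * 2 ^ (2 * d + 2)) ^ d ≤ 1 := pow_le_one₀ (by positivity) h1
  rw [mul_pow, ← pow_mul] at h3
  have h4 : d + excess d + 4 ≤ (2 * d + 2) * d := by
    have h5 : d * (d + 1) / 2 ≤ d * (d + 1) / 2 := le_rfl
    have h6 := Nat.div_mul_le_self (d * (d + 1)) 2
    rw [excess]
    nlinarith
  have h7 : (2 : ℝ) ^ (d + excess d + 4) ≤ 2 ^ ((2 * d + 2) * d) :=
    pow_le_pow_right₀ (by norm_num) h4
  have h8 : (c : ℝ) ^ d * 2 ^ (d + excess d + 4) ≤ 1 :=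
    (mul_le_mul_of_nonneg_left h7 (pow_nonneg hc0 _)).trans h3
  rw [pow_add _ _ 4] at h8
  norm_num at h8
  linarith

/-- Since `n p^d ≤ c^d`, the `m`-th term of the union bound is at most `p` times the `m`-th term of
a convergent series independent of `n`. The factor `p` comes from the one edge beyond `d m`. -/
theorem tendsto_not_sparse (hd : 2 ≤ d) (hc : c < 1 / (2 ^ (2 * d + 1) * (d : ℝ≥0))) :
    Tendsto (fun n : ℕ => (binomialRandom (Fin n) (edgeProb c d n)).real {G | ¬ Sparse G d})
      atTop (𝓝 0) := by
  have hc1 := le_one_of_lt hd hc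
  have hsum : Summable fun m : ℕ => (m : ℝ) ^ (2 * excess d) * (1 / 4) ^ m :=
    summable_pow_mul_geometric_of_norm_lt_one _ (by norm_num)
  have hlim : Tendsto (fun n : ℕ => (edgeProb c d n : ℝ) *
      ∑' m : ℕ, (m : ℝ) ^ (2 * excess d) * (1 / 4) ^ m) atTop (𝓝 0) := by
    simpa using (tendsto_edgeProb (by omega) hc1).mul_const _
  refine squeeze_zero (fun _ => measureReal_nonneg) (fun n => ?_) hlim
  refine (measureReal_not_sparse_le (by omega)).trans ?_
  set p := edgeProb c d n
  have hp : (0 : ℝ) ≤ p := p.2.1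
  rw [Fintype.card_fin]
  have hterm : ∀ m, ((4 ^ m * (m * m) ^ excess d * (2 ^ (d + excess d)) ^ m : ℕ) : ℝ) *
      ((n : ℝ) ^ m * (p : ℝ) ^ (d * m + 1)) ≤
      (p : ℝ) * ((m : ℝ) ^ (2 * excess d) * (1 / 4) ^ m) := by
    intro m
    have h1 : ((4 ^ m * (m * m) ^ excess d * (2 ^ (d + excess d)) ^ m : ℕ) : ℝ) *
      ((n : ℝ) ^ m * (p : ℝ) ^ (d * m + 1)) = (p : ℝ) * ((m : ℝ) ^ (2 * excess d) *
        (4 * 2 ^ (d + excess d) * (n * (p : ℝ) ^ d)) ^ m) := by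
      push_cast
      rw [pow_succ, pow_mul, mul_pow, mul_pow, mul_pow, pow_mul (m : ℝ), sq]
      ring
    rw [h1]
    have h2 : 4 * 2 ^ (d + excess d) * (n * (p : ℝ) ^ d) ≤ 1 / 4 :=
      (mul_le_mul_of_nonneg_left (edgeProb_pow_mul_le (by omega) hc1 n) (by positivity)).trans
        (growth_lt hd hc)
    gcongr
  refine (Finset.sum_le_sum fun m _ => hterm m).trans ?_
  rw [← Finset.mul_sum]
  exact mul_le_mul_of_nonneg_left (hsum.sum_le_tsum _ fun m _ => by positivity) hp

end Threshold

end RandomGraph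

end

noncomputable section

namespace RandomGraph

open SimpleGraph

/-! ### Approximate Poisson recursion for subgraph counts. -/

section PoissonRecursion

variable {V : Type*} [Fintype V] {p : unitInterval} {ι : Type*}

open Classical in
/-- The number of subgraphs of `G` in the family `H`. -/
def copies (I : Finset ι) (H : ι → SimpleGraph V) (G : SimpleGraph V) : ℕ :=
  (I.filter fun i => H i ≤ G).card

open Classical in
theorem measureReal_le_expect (I : Finset ι) (H : ι → SimpleGraph V) {f : SimpleGraph V → ℝ}
    (hf : ∀ G, f G ≤ ∑ i ∈ I, if H i ≤ G then 1 else 0) :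
    expect p f ≤ ∑ i ∈ I, (binomialRandom V p).real {G | H i ≤ G} := by
  refine (expect_mono hf).trans_eq ?_
  rw [expect_sum]
  exact Finset.sum_congr rfl fun i _ => (measureReal_eq_expect _).symm

theorem abs_expect_le (f : SimpleGraph V → ℝ) : |expect p f| ≤ expect p fun G => |f G| := by
  refine (Finset.abs_sum_le_sum_abs _ _).trans_eq (Finset.sum_congr rfl fun G _ => ?_)
  rw [abs_mul, abs_of_nonneg measureReal_nonneg]

open Classical in
/-- The approximate Poisson recursion for the number of subgraphs from a family in which unrelated
members have no common edges. -/
theorem abs_copies_recursion_le (I : Finset ι) (H : ι → SimpleGraph V) (r : ι → ι → Prop)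
    (hr : ∀ i ∈ I, r i i) (hdisj : ∀ i ∈ I, ∀ j ∈ I, ¬ r i j → ∀ e ∈ (H i).edgeSet,
      e ∉ (H j).edgeSet) (m : ℕ) :
    |((m : ℝ) + 1) * (binomialRandom V p).real {G | copies I H G = m + 1} -
        (∑ i ∈ I, (binomialRandom V p).real {G | H i ≤ G}) *
          (binomialRandom V p).real {G | copies I H G = m}| ≤
      (∑ i ∈ I, ∑ j ∈ I with r i j ∧ j ≠ i, (binomialRandom V p).real {G | H i ⊔ H j ≤ G}) +
      ∑ i ∈ I, ∑ j ∈ I with r i j, (binomialRandom V p).real {G | H i ≤ G} *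
        (binomialRandom V p).real {G | H j ≤ G} := by
  let N' : ι → SimpleGraph V → ℕ := fun i G => ((I.filter fun j => ¬ r i j).filter
    fun j => H j ≤ G).card
  have hsplit : ∀ i G, copies I H G = ((I.filter fun j => r i j).filter fun j => H j ≤ G).card +
      N' i G := by
    intro i G
    rw [copies, ← Finset.card_filter_add_card_filter_not (s := I.filter fun j => H j ≤ G) (r i),
      Finset.filter_comm, Finset.filter_comm (p := fun j => H j ≤ G)]
  have h1 : ((m : ℝ) + 1) * (binomialRandom V p).real {G | copies I H G = m + 1} =
      ∑ i ∈ I, expect p fun G => if H i ≤ G then (if copies I H G = m + 1 then 1 else 0) else 0 := by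
    rw [measureReal_eq_expect, ← expect_const_mul, ← expect_sum]
    congr 1
    ext G
    by_cases hG : copies I H G = m + 1
    · simp only [Set.mem_ofPred_eq, hG, if_true]
      rw [Finset.sum_boole, mul_one]
      rw [copies] at hG
      rw [hG]
      push_cast
      ring
    · simp [hG]
  -- Members unrelated to `i` share no edge with `H i`, so their count is independent of the
  -- presence of `H i`.
  have h2 : ∀ i ∈ I, (expect p fun G => if H i ≤ G then (if N' i G = m then 1 else 0) else 0) =
      (binomialRandom V p).real {G | H i ≤ G} * expect p fun G => if N' i G = m then 1 else 0 := by
    intro i hi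
    rw [measureReal_subgraph]
    refine expect_subgraph (H i) fun e he G => ?_
    have : N' i (G ⊔ fromEdgeSet {e}) = N' i G := by
      simp only [N']
      congr 1
      refine Finset.filter_congr fun j hj => ?_
      rw [Finset.mem_filter] at hj
      have hej := hdisj i hi j hj.1 hj.2 e he
      rw [← edgeSet_subset_edgeSet, ← edgeSet_subset_edgeSet, edgeSet_sup, edgeSet_fromEdgeSet]
      refine ⟨fun h x hx => (h hx).resolve_right fun h' => hej (h'.1 ▸ hx),
        fun h => h.trans Set.subset_union_left⟩
    rw [this]
  -- Given `H i`, the total count is one more than the unrelated count unless another related member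
  -- is present too.
  have h3 : ∀ i ∈ I, |(expect p fun G => if H i ≤ G then
      (if copies I H G = m + 1 then (1 : ℝ) else 0) else 0) -
      expect p fun G => if H i ≤ G then (if N' i G = m then 1 else 0) else 0| ≤
      ∑ j ∈ I with r i j ∧ j ≠ i, (binomialRandom V p).real {G | H i ⊔ H j ≤ G} := by
    intro i hi
    rw [← expect_sub]
    refine (abs_expect_le _).trans (measureReal_le_expect _ _ fun G => ?_)
    have hnn : (0 : ℝ) ≤ ∑ j ∈ I with r i j ∧ j ≠ i, if H i ⊔ H j ≤ G then (1 : ℝ) else 0 :=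
      Finset.sum_nonneg fun j _ => by split_ifs <;> norm_num
    by_cases hiG : H i ≤ G
    swap
    · simp [hiG]
    simp only [hiG, if_true]
    by_cases hM : ∃ j ∈ I, (r i j ∧ j ≠ i) ∧ H j ≤ G
    · obtain ⟨j, hj, hrj, hjG⟩ := hM
      have h4 : (1 : ℝ) ≤ ∑ j ∈ I with r i j ∧ j ≠ i, if H i ⊔ H j ≤ G then (1 : ℝ) else 0 := by
        have h5 := Finset.single_le_sum (s := I.filter fun j => r i j ∧ j ≠ i)
          (f := fun j => if H i ⊔ H j ≤ G then (1 : ℝ) else 0)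
          (fun j _ => by split_ifs <;> norm_num) (Finset.mem_filter.mpr ⟨hj, hrj⟩)
        simpa [hiG, hjG] using h5
      refine le_trans ?_ h4
      split_ifs <;> norm_num
    · push Not at hM
      have h4 : ((I.filter fun j => r i j).filter fun j => H j ≤ G) = {i} := by
        ext j
        simp only [Finset.mem_filter, Finset.mem_singleton]
        constructor
        · rintro ⟨⟨hj, hrj⟩, hjG⟩
          by_contra hne
          exact hM j hj ⟨hrj, hne⟩ hjG
        · rintro rfl
          exact ⟨⟨hi, hr j hi⟩, hiG⟩
      have h5 := hsplit i G
      rw [h4, Finset.card_singleton] at h5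
      have h6 : copies I H G = m + 1 ↔ N' i G = m := by omega
      simp only [h6, sub_self, abs_zero]
      exact hnn
  have h4 : ∀ i ∈ I, |(expect p fun G => if N' i G = m then (1 : ℝ) else 0) -
      (binomialRandom V p).real {G | copies I H G = m}| ≤
      ∑ j ∈ I with r i j, (binomialRandom V p).real {G | H j ≤ G} := by
    intro i hi
    rw [measureReal_eq_expect, ← expect_sub]
    refine (abs_expect_le _).trans (measureReal_le_expect _ _ fun G => ?_)
    rw [Finset.sum_boole]
    have h5 := hsplit i G
    simp only [Set.mem_ofPred_eq]
    rcases Nat.eq_zero_or_pos ((I.filter fun j => r i j).filter fun j => H j ≤ G).card with h0 | h0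
    · rw [h0, zero_add] at h5
      simp [h0, h5]
    · have h6 : (1 : ℝ) ≤ ((I.filter fun j => r i j).filter fun j => H j ≤ G).card := by
        exact_mod_cast h0
      refine le_trans ?_ h6
      split_ifs <;> norm_num
  rw [h1, Finset.sum_mul, ← Finset.sum_sub_distrib, ← Finset.sum_add_distrib]
  refine (Finset.abs_sum_le_sum_abs _ _).trans (Finset.sum_le_sum fun i hi => ?_)
  have h5 := h3 i hi
  rw [h2 i hi] at h5
  have h6 := mul_le_mul_of_nonneg_left (h4 i hi)
    (measureReal_nonneg (μ := binomialRandom V p) (s := {G | H i ≤ G}))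
  rw [Finset.mul_sum] at h6
  refine (abs_sub_le _ _ _).trans (add_le_add h5 ?_)
  rwa [← mul_sub, abs_mul, abs_of_nonneg measureReal_nonneg]

/-- Markov's inequality for the number of subgraphs from a family. -/
theorem one_sub_le_sum_copies (I : Finset ι) (H : ι → SimpleGraph V) {K : ℕ} (hK : 0 < K) :
    1 - (∑ i ∈ I, (binomialRandom V p).real {G | H i ≤ G}) / K ≤
      ∑ k ∈ Finset.range K, (binomialRandom V p).real {G | copies I H G = k} := by
  classical
  have h1 : (∑ i ∈ I, (binomialRandom V p).real {G | H i ≤ G}) =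
      expect p fun G => (copies I H G : ℝ) := by
    simp_rw [measureReal_eq_expect]
    rw [← expect_sum]
    congr 1
    ext G
    simp [copies]
  simp_rw [h1, measureReal_eq_expect]
  nth_rewrite 1 [← expect_one (V := V) (p := p)]
  rw [← expect_sum, div_eq_inv_mul, ← expect_const_mul,
    ← expect_sub]
  refine expect_mono fun G => ?_
  have hK' : (0 : ℝ) < K := by exact_mod_cast hK
  simp only [Set.mem_ofPred_eq]
  suffices h : 1 - (K : ℝ)⁻¹ * copies I H G ≤
      if copies I H G ∈ Finset.range K then (1 : ℝ) else 0 by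
    refine h.trans_eq ?_
    convert (Finset.sum_ite_eq (Finset.range K) (copies I H G) fun _ => (1 : ℝ)).symm
  split_ifs with h
  · have : (0 : ℝ) ≤ (K : ℝ)⁻¹ * copies I H G := by positivity
    linarith
  · rw [Finset.mem_range, not_lt] at h
    have : (1 : ℝ) ≤ (K : ℝ)⁻¹ * copies I H G := by
      rw [inv_mul_eq_div, one_le_div hK']
      exact_mod_cast h
    linarith

end PoissonRecursion

/-! ### From the recursion to the Poisson limit. -/

section PoissonLimit

/-- A tight family of distributions on `ℕ` satisfying the Poisson recursion asymptotically converges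
to the Poisson distribution. -/
theorem tendsto_poisson_of_recursion {a : ℕ → ℕ → ℝ} {lam δ : ℕ → ℝ} {l : ℝ}
    (ha : ∀ n k, 0 ≤ a n k) (hrec : ∀ n (k : ℕ), |((k : ℝ) + 1) * a n (k + 1) - lam n * a n k| ≤ δ n)
    (hδ : Tendsto δ atTop (𝓝 0)) (hlam : Tendsto lam atTop (𝓝 l))
    (hlow : ∀ n K : ℕ, 0 < K → 1 - lam n / K ≤ ∑ k ∈ Finset.range K, a n k)
    (hup : ∀ n K : ℕ, ∑ k ∈ Finset.range K, a n k ≤ 1) (k : ℕ) :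
    Tendsto (fun n => a n k) atTop (𝓝 (Real.exp (-l) * l ^ k / k.factorial)) := by
  have ha1 : ∀ n k, a n k ≤ 1 := fun n k =>
    (Finset.single_le_sum (fun j _ => ha n j) (Finset.self_mem_range_succ k)).trans (hup n (k + 1))
  -- The recursion ties every `a n k` to `a n 0`, whose own limit is not known yet.
  have hdiff : ∀ k, Tendsto (fun n => a n k - a n 0 * (l ^ k / k.factorial)) atTop (𝓝 0) := by
    intro k
    induction k with
    | zero => simp
    | succ k ih =>
      have h1 : Tendsto (fun n => ((k : ℝ) + 1) * a n (k + 1) - lam n * a n k) atTop (𝓝 0) :=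
        squeeze_zero_norm (fun n => by simpa [Real.norm_eq_abs] using hrec n k) hδ
      have h2 : Tendsto (fun n => (lam n - l) * a n k) atTop (𝓝 0) := by
        have h3 : Tendsto (fun n => lam n - l) atTop (𝓝 0) := by
          simpa using hlam.sub_const l
        refine squeeze_zero_norm (a := fun n => |lam n - l|) (fun n => ?_) (by simpa using h3.abs)
        rw [norm_mul, Real.norm_eq_abs, Real.norm_eq_abs, abs_of_nonneg (ha n k)]
        exact mul_le_of_le_one_right (abs_nonneg _) (ha1 n k)
      have h3 := ((h1.add h2).add (ih.const_mul l)).div_const ((k : ℝ) + 1)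
      simp only [add_zero, mul_zero, zero_div] at h3
      refine h3.congr fun n => ?_
      rw [Nat.factorial_succ, pow_succ]
      have hk : (k : ℝ) + 1 ≠ 0 := by positivity
      have hk' : (k.factorial : ℝ) ≠ 0 := by positivity
      push_cast
      field_simp
      ring
  have hexp : HasSum (fun k : ℕ => l ^ k / k.factorial) (Real.exp l) := by
    rw [Real.exp_eq_exp_ℝ]
    exact NormedSpace.expSeries_div_hasSum_exp l
  -- Tightness fixes the normalisation: for large `K` the first `K` values sum to nearly `1`, and by
  -- `hdiff` this sum is close to `a n 0` times a partial sum of the exponential series.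
  have h0 : Tendsto (fun n => a n 0 * Real.exp l) atTop (𝓝 1) := by
    rw [Metric.tendsto_atTop]
    intro ε hε
    obtain ⟨K, hK0, hK1, hK2⟩ : ∃ K : ℕ, 0 < K ∧ (|l| + 1) / K < ε / 4 ∧
        |∑ k ∈ Finset.range K, l ^ k / k.factorial - Real.exp l| < ε / 4 := by
      have h1 := (tendsto_const_div_atTop_nhds_zero_nat (|l| + 1)).eventually_lt_const
        (by positivity : 0 < ε / 4)
      have h2 := Metric.tendsto_nhds.mp hexp.tendsto_sum_nat (ε / 4) (by positivity)
      obtain ⟨K, hK⟩ := ((eventually_gt_atTop 0).and (h1.and h2)).exists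
      exact ⟨K, hK.1, hK.2.1, by simpa [Real.dist_eq] using hK.2.2⟩
    have h3 : Tendsto (fun n => ∑ k ∈ Finset.range K, (a n k - a n 0 * (l ^ k / k.factorial)))
        atTop (𝓝 0) := by
      simpa using tendsto_finsetSum (Finset.range K) fun k _ => hdiff k
    have h4 := Metric.tendsto_nhds.mp h3 (ε / 4) (by positivity)
    have h5 := Metric.tendsto_nhds.mp hlam 1 one_pos
    obtain ⟨n₀, hn₀⟩ := eventually_atTop.mp (h4.and h5)
    refine ⟨n₀, fun n hn => ?_⟩
    obtain ⟨h6, h7⟩ := hn₀ n hn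
    rw [Finset.sum_sub_distrib, ← Finset.mul_sum, Real.dist_eq, sub_zero] at h6
    rw [Real.dist_eq] at h7 ⊢
    set S := ∑ k ∈ Finset.range K, l ^ k / (k.factorial : ℝ)
    have h8 := hlow n K hK0
    have h9 := hup n K
    have h10 : lam n / K ≤ (|l| + 1) / K := by
      have := abs_lt.mp h7
      have := le_abs_self l
      gcongr
      linarith
    have h11 : |a n 0 * (S - Real.exp l)| < ε / 4 := by
      rw [abs_mul, abs_of_nonneg (ha n 0)]
      exact (mul_le_of_le_one_left (abs_nonneg _) (ha1 n 0)).trans_lt hK2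
    rw [abs_lt] at h6 h11 ⊢
    constructor <;> linarith
  have h1 : Tendsto (fun n => a n 0) atTop (𝓝 (Real.exp (-l))) := by
    have := h0.mul_const (Real.exp (-l))
    rw [one_mul] at this
    refine this.congr fun n => ?_
    rw [mul_assoc, ← Real.exp_add, add_neg_cancel, Real.exp_zero, mul_one]
  have h2 := (hdiff k).add (h1.mul_const (l ^ k / k.factorial))
  rw [zero_add, ← mul_div_assoc] at h2
  exact h2.congr fun n => by ring

end PoissonLimit

end RandomGraph

end

noncomputable section

namespace RandomGraph

open SimpleGraph CliqueHomology

/-! ### Pairs of cross-polytopes and their number. -/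

section Pairs

variable {V : Type*} [LinearOrder V] [Fintype V] {d : ℕ} {σ τ : Equiv.Perm V}

open Classical in
theorem sum_card_nbrs_univ (H : SimpleGraph V) :
    ∑ v, (nbrs H Finset.univ v).card = 2 * H.edgeSet.ncard := by
  rw [Set.ncard_eq_toFinset_card', ← edgeFinset, ← sum_degrees_eq_twice_card_edges]
  refine Finset.sum_congr rfl fun v _ => ?_
  rw [← card_neighborFinset_eq_degree]
  congr 1
  ext u
  simp

theorem nbrs_octGraph_univ (hσ : IsPairing d σ) (v : V) :
    nbrs (octGraph σ) Finset.univ v = nbrs (octGraph σ) σ.support v := by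
  ext u
  rw [mem_nbrs, mem_nbrs, hσ.octGraph_adj]
  simp only [Finset.mem_univ, true_and]
  tauto

open Classical in
theorem ncard_edgeSet_octGraph (hσ : IsPairing d σ) :
    (octGraph σ).edgeSet.ncard = 2 * d * (d + 1) := by
  have h1 := sum_card_nbrs_univ (octGraph σ)
  rw [← Finset.sum_subset (Finset.subset_univ σ.support) fun v _ hv => by
    rw [Finset.card_eq_zero, Finset.eq_empty_iff_forall_notMem]
    intro u hu
    exact hv ((hσ.octGraph_adj.mp (mem_nbrs.mp hu).2).1)] at h1
  rw [Finset.sum_congr rfl fun v hv => by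
    rw [nbrs_octGraph_univ hσ, hσ.card_nbrs hv], Finset.sum_const, hσ.1, smul_eq_mul] at h1
  nlinarith

/-- The only vertex not covered by `x` and its neighbours is the antipode of `x`, and that is joined
to every neighbour `y` of `x`. This spreads agreement at one vertex over the whole support. -/
theorem mem_support_iff_of_nbrs_eq (hσ : IsPairing d σ) {x : V} (hx : x ∈ σ.support) {y : V}
    (hy : y ∈ nbrs (octGraph σ) σ.support x) {v : V} (hv : v ∈ σ.support) :
    v = x ∨ v ∈ nbrs (octGraph σ) σ.support x ∨ v ∈ nbrs (octGraph σ) σ.support y := by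
  rw [mem_nbrs, hσ.octGraph_adj] at hy
  obtain ⟨hyS, -, -, hyx, hyσx⟩ := hy
  by_cases h1 : v = x
  · exact Or.inl h1
  by_cases h2 : v = σ x
  · refine Or.inr (Or.inr (mem_nbrs.mpr ⟨hv, hσ.octGraph_adj.mpr ⟨hyS, hv, ?_, ?_⟩⟩))
    · rw [h2]; exact hyσx.symm
    · rw [h2]; exact fun h => hyx (σ.injective h).symm
  · exact Or.inr (Or.inl (mem_nbrs.mpr ⟨hv, hσ.octGraph_adj.mpr ⟨hx, hv, h1, h2⟩⟩))

open Classical in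
/-- The union of two distinct cross-polytope graphs with a common vertex is dense. -/
theorem lt_ncard_edgeSet_sup (hd : 1 ≤ d) (hσ : IsPairing d σ) (hτ : IsPairing d τ)
    (hne : τ ≠ σ) (hint : ¬ Disjoint σ.support τ.support) :
    d * (σ.support ∪ τ.support).card + 1 ≤ (octGraph σ ⊔ octGraph τ).edgeSet.ncard := by
  -- Every vertex of the union has degree at least `2 d`. With at most `d` edges per vertex all
  -- degrees equal `2 d`, so both cross-polytopes contain the full neighbourhoods of their vertices.
  -- From a common vertex it follows that the supports agree, and then the antipodal maps.
  by_contra! hlt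
  set F := octGraph σ ⊔ octGraph τ with hF
  have hsubσ : ∀ v, nbrs (octGraph σ) σ.support v ⊆ nbrs F Finset.univ v := fun v u hu =>
    mem_nbrs.mpr ⟨Finset.mem_univ _, Or.inl (mem_nbrs.mp hu).2⟩
  have hsubτ : ∀ v, nbrs (octGraph τ) τ.support v ⊆ nbrs F Finset.univ v := fun v u hu =>
    mem_nbrs.mpr ⟨Finset.mem_univ _, Or.inr (mem_nbrs.mp hu).2⟩
  have hle : ∀ v ∈ σ.support ∪ τ.support, 2 * d ≤ (nbrs F Finset.univ v).card := by
    intro v hv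
    rcases Finset.mem_union.mp hv with h | h
    · rw [← hσ.card_nbrs h]; exact Finset.card_le_card (hsubσ v)
    · rw [← hτ.card_nbrs h]; exact Finset.card_le_card (hsubτ v)
  have hsum := sum_card_nbrs_univ F
  have hsum' : ∑ v ∈ σ.support ∪ τ.support, (nbrs F Finset.univ v).card ≤
      ∑ v ∈ σ.support ∪ τ.support, 2 * d := by
    refine (Finset.sum_le_sum_of_subset (Finset.subset_univ _)).trans ?_
    rw [hsum, Finset.sum_const, smul_eq_mul]
    nlinarith
  have hdeg := (Finset.sum_eq_sum_iff_of_le hle).mp (le_antisymm (Finset.sum_le_sum hle) hsum')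
  have heσ : ∀ v ∈ σ.support, nbrs (octGraph σ) σ.support v = nbrs F Finset.univ v := fun v hv =>
    Finset.eq_of_subset_of_card_le (hsubσ v)
      (by rw [hσ.card_nbrs hv, ← hdeg v (Finset.mem_union_left _ hv)])
  have heτ : ∀ v ∈ τ.support, nbrs (octGraph τ) τ.support v = nbrs F Finset.univ v := fun v hv =>
    Finset.eq_of_subset_of_card_le (hsubτ v)
      (by rw [hτ.card_nbrs hv, ← hdeg v (Finset.mem_union_right _ hv)])
  obtain ⟨x, hxσ, hxτ⟩ := Finset.not_disjoint_iff.mp hint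
  obtain ⟨y, hy⟩ : (nbrs (octGraph σ) σ.support x).Nonempty :=
    Finset.card_pos.mp (by rw [hσ.card_nbrs hxσ]; omega)
  have hyσ := nbrs_subset hy
  have hyτ : y ∈ τ.support := by
    rw [heσ x hxσ, ← heτ x hxτ] at hy
    exact nbrs_subset hy
  have hsub : σ.support ⊆ τ.support := by
    intro v hv
    rcases mem_support_iff_of_nbrs_eq hσ hxσ hy hv with rfl | h | h
    · exact hxτ
    · rw [heσ x hxσ, ← heτ x hxτ] at h
      exact nbrs_subset h
    · rw [heσ y hyσ, ← heτ y hyτ] at h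
      exact nbrs_subset h
  have hsupp : σ.support = τ.support :=
    Finset.eq_of_subset_of_card_le hsub (by rw [hσ.1, hτ.1])
  refine hne (Equiv.ext fun v => ?_)
  by_cases hv : v ∈ σ.support
  · by_contra hvne
    have hv' : v ∈ τ.support := hsupp ▸ hv
    have h1 : τ v ∈ nbrs (octGraph σ) σ.support v := by
      have h2 : τ v ∈ σ.support := by rw [hsupp]; exact Equiv.Perm.apply_mem_support.mpr hv'
      exact mem_nbrs.mpr ⟨h2, hσ.octGraph_adj.mpr ⟨hv, h2, IsPairing.apply_ne hv', hvne⟩⟩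
    rw [heσ v hv, ← heτ v hv', mem_nbrs, hτ.octGraph_adj] at h1
    exact h1.2.2.2.2 rfl
  · have hv' : v ∉ τ.support := hsupp ▸ hv
    rw [Equiv.Perm.notMem_support] at hv hv'
    rw [hv, hv']

theorem card_perm_support_subset (W : Finset V) :
    (Finset.univ.filter fun σ : Equiv.Perm V => σ.support ⊆ W).card = W.card.factorial := by
  classical
  have h := Fintype.card_congr (Equiv.Perm.subtypeEquivSubtypePerm (· ∈ W))
  rw [Fintype.card_perm, Fintype.card_coe] at h
  rw [h, Fintype.card_subtype]
  congr 1
  refine Finset.filter_congr fun σ _ => ⟨fun h v hv => ?_, fun h v hv => ?_⟩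
  · exact Equiv.Perm.notMem_support.mp fun h' => hv (h h')
  · by_contra hvW
    exact Equiv.Perm.mem_support.mp hv (h v hvW)

theorem card_pairs_le (v : ℕ) : (Finset.univ.filter fun q : Equiv.Perm V × Equiv.Perm V =>
    (q.1.support ∪ q.2.support).card = v).card ≤ Fintype.card V ^ v * v.factorial ^ 2 := by
  have hsub : (Finset.univ.filter fun q : Equiv.Perm V × Equiv.Perm V =>
      (q.1.support ∪ q.2.support).card = v) ⊆ (Finset.powersetCard v Finset.univ).biUnion
        fun W => (Finset.univ.filter fun σ : Equiv.Perm V => σ.support ⊆ W) ×ˢ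
          (Finset.univ.filter fun σ : Equiv.Perm V => σ.support ⊆ W) := by
    intro q hq
    rw [Finset.mem_filter_univ] at hq
    rw [Finset.mem_biUnion]
    refine ⟨_, Finset.mem_powersetCard.mpr ⟨Finset.subset_univ _, hq⟩, ?_⟩
    rw [Finset.mem_product, Finset.mem_filter_univ, Finset.mem_filter_univ]
    exact ⟨Finset.subset_union_left, Finset.subset_union_right⟩
  refine (Finset.card_le_card hsub).trans (Finset.card_biUnion_le.trans ?_)
  rw [Finset.sum_congr rfl fun W hW => by
    rw [Finset.card_product, card_perm_support_subset, (Finset.mem_powersetCard.mp hW).2],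
    Finset.sum_const, Finset.card_powersetCard, smul_eq_mul, sq]
  exact Nat.mul_le_mul_right _ (Nat.choose_le_pow _ _)

open Classical in
/-- The number of copies of the cross-polytope graph in the complete graph. -/
theorem card_isPairing (d : ℕ) : (Finset.univ.filter fun σ : Equiv.Perm V => IsPairing d σ).card *
    (2 ^ (d + 1) * (d + 1).factorial) = (Fintype.card V).descFactorial (2 * d + 2) := by
  have h1 : (Finset.univ.filter fun σ : Equiv.Perm V => IsPairing d σ) =
      Finset.univ.filter fun σ : Equiv.Perm V =>
        σ.cycleType = Multiset.replicate (d + 1) 2 := by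
    refine Finset.filter_congr fun σ _ => ⟨fun h => ?_, fun h => ⟨?_, ?_⟩⟩
    · have h2 : σ ^ 2 = 1 := by
        ext v
        rw [sq, Equiv.Perm.mul_apply, h.2, Equiv.Perm.one_apply]
      have h3 := Equiv.Perm.cycleType_of_pow_prime_eq_one h2
      have h4 := σ.sum_cycleType
      rw [h3, Multiset.sum_replicate, h.1, smul_eq_mul] at h4
      rw [h3]
      congr 1
      omega
    · rw [← Equiv.Perm.sum_cycleType, h, Multiset.sum_replicate, smul_eq_mul]
      ring
    · have h2 : orderOf σ ∣ 2 := by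
        rw [← Equiv.Perm.lcm_cycleType, h, Multiset.lcm_dvd]
        intro b hb
        rw [Multiset.eq_of_mem_replicate hb]
      have h3 := orderOf_dvd_iff_pow_eq_one.mp h2
      intro v
      rw [← Equiv.Perm.mul_apply, ← sq, h3, Equiv.Perm.one_apply]
  have h2 := Equiv.Perm.card_of_cycleType_mul_eq V (Multiset.replicate (d + 1) 2)
  rw [Multiset.sum_replicate, Multiset.prod_replicate, Multiset.toFinset_replicate,
    if_neg (Nat.succ_ne_zero d), Finset.prod_singleton, Multiset.count_replicate_self, smul_eq_mul,
    (by ring : (d + 1) * 2 = 2 * d + 2)] at h2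
  rw [h1]
  split_ifs at h2 with h
  · refine Nat.eq_of_mul_eq_mul_left (Nat.factorial_pos (Fintype.card V - (2 * d + 2))) ?_
    rw [Nat.factorial_mul_descFactorial h.1, ← h2]
    ring
  · have h3 : ¬ 2 * d + 2 ≤ Fintype.card V := fun h3 => h ⟨h3, fun a ha => by
      rw [Multiset.eq_of_mem_replicate ha]⟩
    rw [Nat.descFactorial_eq_zero_iff_lt.mpr (by omega)]
    have h4 := Nat.factorial_pos (Fintype.card V - (2 * d + 2))
    have h5 := Nat.factorial_pos (d + 1)
    have h6 : (0 : ℕ) < 2 ^ (d + 1) := by positivity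
    simp only [mul_eq_zero] at h2 ⊢
    omega

end Pairs

end RandomGraph

end

noncomputable section

namespace RandomGraph

open SimpleGraph CliqueHomology

/-! ### The number of copies is asymptotically Poisson. -/

section CopyCount

variable {d : ℕ} {c : ℝ≥0}

open Classical in
/-- The antipodal maps of all cross-polytopes on the vertex set `V`. -/
def pairings (V : Type*) [LinearOrder V] [Fintype V] (d : ℕ) : Finset (Equiv.Perm V) :=
  Finset.univ.filter fun σ => IsPairing d σ

theorem mem_pairings {V : Type*} [LinearOrder V] [Fintype V] {σ : Equiv.Perm V} :
    σ ∈ pairings V d ↔ IsPairing d σ := by simp [pairings]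

-- Pairs are grouped by the size `v` of the union of the supports. There are at most `n^v (v!)^2`
-- pairs of weight `p^(dv+1)` each, and `n p^d ≤ 1` leaves `p (v!)^2`. Supports that meet give `v ≤
-- 4 d + 3`.
open Classical in
theorem sum_pairs_le {V : Type*} [LinearOrder V] [Fintype V] {p : ℝ} (hp : 0 ≤ p)
    (hV : Fintype.card V * p ^ d ≤ 1) {f : Equiv.Perm V → Equiv.Perm V → ℝ}
    (hf : ∀ σ ∈ pairings V d, ∀ τ ∈ pairings V d, ¬ Disjoint σ.support τ.support →
      f σ τ ≤ p ^ (d * (σ.support ∪ τ.support).card + 1)) :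
    ∑ σ ∈ pairings V d, ∑ τ ∈ pairings V d with ¬ Disjoint σ.support τ.support, f σ τ ≤
      p * ∑ v ∈ Finset.range (4 * d + 4), (v.factorial : ℝ) ^ 2 := by
  let S := (pairings V d ×ˢ pairings V d).filter fun q => ¬ Disjoint q.1.support q.2.support
  have h1 : ∑ σ ∈ pairings V d, ∑ τ ∈ pairings V d with ¬ Disjoint σ.support τ.support, f σ τ =
      ∑ q ∈ S, f q.1 q.2 := by
    rw [Finset.sum_filter, Finset.sum_product]
    exact Finset.sum_congr rfl fun σ _ => Finset.sum_filter _ _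
  have hS : ∀ q ∈ S, IsPairing d q.1 ∧ IsPairing d q.2 ∧ ¬ Disjoint q.1.support q.2.support := by
    intro q hq
    rw [Finset.mem_filter, Finset.mem_product, mem_pairings, mem_pairings] at hq
    exact ⟨hq.1.1, hq.1.2, hq.2⟩
  have hmaps : ∀ q ∈ S, (q.1.support ∪ q.2.support).card ∈ Finset.range (4 * d + 4) := by
    intro q hq
    obtain ⟨h2, h3, h4⟩ := hS q hq
    have h5 := Finset.card_union_add_card_inter q.1.support q.2.support
    have h6 : 0 < (q.1.support ∩ q.2.support).card :=
      Finset.card_pos.mpr (Finset.not_disjoint_iff_nonempty_inter.mp h4)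
    rw [h2.1, h3.1] at h5
    exact Finset.mem_range.mpr (by omega)
  rw [h1, ← Finset.sum_fiberwise_of_maps_to hmaps, Finset.mul_sum]
  refine Finset.sum_le_sum fun v _ => ?_
  have h2 : ∀ q ∈ S.filter fun q => (q.1.support ∪ q.2.support).card = v,
      f q.1 q.2 ≤ p ^ (d * v + 1) := by
    intro q hq
    obtain ⟨hqS, rfl⟩ := Finset.mem_filter.mp hq
    obtain ⟨h2, h3, h4⟩ := hS q hqS
    exact hf _ (mem_pairings.mpr h2) _ (mem_pairings.mpr h3) h4
  refine (Finset.sum_le_card_nsmul _ _ _ h2).trans ?_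
  have h3 : ((S.filter fun q => (q.1.support ∪ q.2.support).card = v).card : ℝ) ≤
      (Fintype.card V : ℝ) ^ v * (v.factorial : ℝ) ^ 2 := by
    have := (Finset.card_le_card (Finset.filter_subset_filter
      (fun q : Equiv.Perm V × Equiv.Perm V => (q.1.support ∪ q.2.support).card = v)
      (Finset.subset_univ S))).trans (card_pairs_le v)
    exact_mod_cast this
  rw [nsmul_eq_mul]
  calc _ ≤ (Fintype.card V : ℝ) ^ v * (v.factorial : ℝ) ^ 2 * p ^ (d * v + 1) :=
        mul_le_mul_of_nonneg_right h3 (pow_nonneg hp _)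
    _ = p * (v.factorial : ℝ) ^ 2 * (Fintype.card V * p ^ d) ^ v := by
        rw [pow_succ p, pow_mul p, mul_pow]; ring
    _ ≤ p * (v.factorial : ℝ) ^ 2 * 1 :=
        mul_le_mul_of_nonneg_left (pow_le_one₀ (by positivity) hV) (by positivity)
    _ = _ := mul_one _

/-- The number of copies of the cross-polytope graph satisfies the Poisson recursion up to an error
of the order of the edge probability. -/
theorem abs_copies_octGraph_recursion_le {V : Type*} [LinearOrder V] [Fintype V]
    {p : unitInterval} (hd : 1 ≤ d) (hV : Fintype.card V * (p : ℝ) ^ d ≤ 1) (m : ℕ) :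
    |((m : ℝ) + 1) * (binomialRandom V p).real {G | copies (pairings V d) octGraph G = m + 1} -
        (∑ σ ∈ pairings V d, (binomialRandom V p).real {G | octGraph σ ≤ G}) *
          (binomialRandom V p).real {G | copies (pairings V d) octGraph G = m}| ≤
      2 * (p * ∑ v ∈ Finset.range (4 * d + 4), (v.factorial : ℝ) ^ 2) := by
  classical
  have hp : (0 : ℝ) ≤ p := p.2.1
  have hp1 : (p : ℝ) ≤ 1 := p.2.2
  refine (abs_copies_recursion_le (pairings V d) octGraph
    (fun σ τ => ¬ Disjoint σ.support τ.support) ?_ ?_ m).trans ?_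
  · intro σ hσ h
    have h1 := (mem_pairings.mp hσ).1
    rw [disjoint_self.mp h] at h1
    simp at h1
  · intro σ hσ τ hτ h e
    rw [not_not] at h
    induction e with
    | _ u v =>
      intro he he'
      exact Finset.disjoint_left.mp h he.1 he'.1
  rw [two_mul]
  refine add_le_add ?_ ?_
  · refine le_trans (le_of_eq (Finset.sum_congr rfl fun σ _ => ?_)) (sum_pairs_le hp hV
      (f := fun σ τ => if τ ≠ σ then (binomialRandom V p).real {G | octGraph σ ⊔ octGraph τ ≤ G}
        else 0) fun σ hσ τ hτ hint => ?_)
    · rw [← Finset.sum_filter, Finset.filter_filter]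
      exact Finset.sum_congr (Finset.filter_congr_decidable _ _ _) fun _ _ => rfl
    split_ifs with hne
    · rw [measureReal_subgraph]
      exact pow_le_pow_of_le_one hp hp1
        (lt_ncard_edgeSet_sup hd (mem_pairings.mp hσ) (mem_pairings.mp hτ) hne hint)
    · positivity
  · refine le_trans (le_of_eq (Finset.sum_congr rfl fun σ _ => ?_)) (sum_pairs_le hp hV
      (f := fun σ τ => (binomialRandom V p).real {G | octGraph σ ≤ G} *
        (binomialRandom V p).real {G | octGraph τ ≤ G}) fun σ hσ τ hτ hint => ?_)
    · exact Finset.sum_congr (Finset.filter_congr_decidable _ _ _) fun _ _ => rfl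
    rw [mem_pairings] at hσ hτ
    rw [measureReal_subgraph, measureReal_subgraph, ncard_edgeSet_octGraph hσ,
      ncard_edgeSet_octGraph hτ, ← pow_add]
    -- The two copies have `4 d (d + 1)` edges counted separately, and `d (4 d + 3) + 1` suffice
    -- because `d ≥ 1`.
    refine pow_le_pow_of_le_one hp hp1 ?_
    have h5 := Finset.card_union_add_card_inter σ.support τ.support
    have h6 : 0 < (σ.support ∩ τ.support).card :=
      Finset.card_pos.mpr (Finset.not_disjoint_iff_nonempty_inter.mp hint)
    rw [hσ.1, hτ.1] at h5
    have h7 : (σ.support ∪ τ.support).card ≤ 4 * d + 3 := by omega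
    nlinarith

/-- The expected number of copies of the cross-polytope graph converges. -/
theorem tendsto_sum_measureReal_octGraph (hd : 1 ≤ d) (hc : c ≤ 1) :
    Tendsto (fun n : ℕ => ∑ σ ∈ pairings (Fin n) d,
      (binomialRandom (Fin n) (edgeProb c d n)).real {G | octGraph σ ≤ G}) atTop
      (𝓝 ((c : ℝ) ^ (2 * d * (d + 1)) / (2 ^ (d + 1) * (d + 1).factorial))) := by
  have hD : (2 ^ (d + 1) * (d + 1).factorial : ℝ) ≠ 0 := by positivity
  -- A copy has `2 d (d + 1)` edges, so its probability is `(p^d)^(2d+2) = (c^d / n)^(2d+2)`. What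
  -- still depends on `n` is the falling factorial divided by the matching power.
  have h1 : ∀ n : ℕ, ∑ σ ∈ pairings (Fin n) d,
      (binomialRandom (Fin n) (edgeProb c d n)).real {G | octGraph σ ≤ G} =
      (c : ℝ) ^ (2 * d * (d + 1)) / (2 ^ (d + 1) * (d + 1).factorial) *
        ((n.descFactorial (2 * d + 2) : ℝ) / (n : ℝ) ^ (2 * d + 2)) := by
    intro n
    have h2 : ∀ σ ∈ pairings (Fin n) d,
        (binomialRandom (Fin n) (edgeProb c d n)).real {G | octGraph σ ≤ G} =
          ((c : ℝ) ^ d / n) ^ (2 * d + 2) := fun σ hσ => by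
      rw [measureReal_subgraph, ncard_edgeSet_octGraph (mem_pairings.mp hσ),
        ← edgeProb_pow hd hc, ← pow_mul]
      congr 1
      ring
    have h3 : ((pairings (Fin n) d).card : ℝ) * (2 ^ (d + 1) * (d + 1).factorial) =
        n.descFactorial (2 * d + 2) := by
      have := card_isPairing (V := Fin n) d
      rw [Fintype.card_fin] at this
      rw [← this, pairings]
      push_cast
      rfl
    rw [Finset.sum_congr rfl h2, Finset.sum_const, nsmul_eq_mul, ← h3, div_pow, ← pow_mul,
      (by ring : d * (2 * d + 2) = 2 * d * (d + 1))]
    field_simp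
  simp_rw [h1]
  have h2 : Tendsto (fun n : ℕ => (n.descFactorial (2 * d + 2) : ℝ) / (n : ℝ) ^ (2 * d + 2)) atTop
      (𝓝 1) := by
    have h3 := isEquivalent_descFactorial (2 * d + 2)
    refine (Asymptotics.isEquivalent_iff_tendsto_one ?_).mp h3
    filter_upwards [eventually_gt_atTop 0] with n hn
    positivity
  simpa using h2.const_mul ((c : ℝ) ^ (2 * d * (d + 1)) / (2 ^ (d + 1) * (d + 1).factorial))

theorem tendsto_copies (hd : 1 ≤ d) (hc : c ≤ 1) (m : ℕ) :
    Tendsto (fun n : ℕ => (binomialRandom (Fin n) (edgeProb c d n)).real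
        {G | copies (pairings (Fin n) d) octGraph G = m}) atTop
      (𝓝 ((poissonMeasure (c ^ (2 * d * (d + 1)) /
        (2 ^ (d + 1) * (Nat.factorial (d + 1) : ℝ≥0)))).real {m})) := by
  rw [poissonMeasure_real_singleton]
  push_cast
  refine tendsto_poisson_of_recursion
    (a := fun n m => (binomialRandom (Fin n) (edgeProb c d n)).real
      {G | copies (pairings (Fin n) d) octGraph G = m})
    (fun _ _ => measureReal_nonneg)
    (fun n m => abs_copies_octGraph_recursion_le (p := edgeProb c d n) hd ?_ m) ?_
    (tendsto_sum_measureReal_octGraph hd hc)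
    (fun n K hK => one_sub_le_sum_copies _ _ hK) (fun n K => ?_) m
  · rw [Fintype.card_fin]
    exact (edgeProb_pow_mul_le hd hc n).trans (pow_le_one₀ c.2 (by exact_mod_cast hc))
  · simpa using ((tendsto_edgeProb hd hc).mul_const
      (∑ v ∈ Finset.range (4 * d + 4), (v.factorial : ℝ) ^ 2)).const_mul 2
  · rw [← measureReal_biUnion_finset]
    · exact measureReal_le_one
    · intro i _ j _ hij
      refine Set.disjoint_left.mpr fun G hG hG' => hij ?_
      exact hG.symm.trans hG'
    · intro k _
      exact MeasurableSet.of_discrete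

end CopyCount

/-! ### Convergence in distribution on the natural numbers. -/

section WeakConvergence

/-- Probability measures on `ℕ` converge weakly if they converge at every point. -/
theorem tendsto_probabilityMeasure_nat {ν : ℕ → ProbabilityMeasure ℕ} {ν₀ : ProbabilityMeasure ℕ}
    (h : ∀ k, Tendsto (fun n => (ν n : Measure ℕ).real {k}) atTop
      (𝓝 ((ν₀ : Measure ℕ).real {k}))) : Tendsto ν atTop (𝓝 ν₀) := by
  classical
  have h' : ∀ k, Tendsto (fun n => (ν n : Measure ℕ) {k}) atTop (𝓝 ((ν₀ : Measure ℕ) {k})) :=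
    fun k => (ENNReal.tendsto_toReal_iff (fun _ => measure_ne_top _ _) (measure_ne_top _ _)).mp (h k)
  -- Portmanteau: the mass of an open set is the supremum over its finite subsets, on which
  -- convergence is termwise.
  refine tendsto_of_forall_isOpen_le_liminf' fun A _ => ?_
  rw [← Measure.tsum_indicator_apply_singleton _ _ MeasurableSet.of_discrete,
    ENNReal.tsum_eq_iSup_sum]
  refine iSup_le fun s => ?_
  have h1 : ∀ μ : Measure ℕ, ∑ x ∈ s, A.indicator (fun x => μ {x}) x =
      μ ↑(s.filter (· ∈ A)) := by
    intro μ
    rw [← sum_measure_singleton, Finset.sum_filter]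
    exact Finset.sum_congr rfl fun x _ => by rw [Set.indicator_apply]
  have h2 : Tendsto (fun n => (ν n : Measure ℕ) ↑(s.filter (· ∈ A))) atTop
      (𝓝 ((ν₀ : Measure ℕ) ↑(s.filter (· ∈ A)))) := by
    simp_rw [← sum_measure_singleton]
    exact tendsto_finsetSum _ fun k _ => h' k
  rw [h1, ← h2.liminf_eq]
  refine liminf_le_liminf (Eventually.of_forall fun n => measure_mono fun x hx => ?_)
  exact (Finset.mem_filter.mp hx).2

theorem abs_measureReal_sub_le {Ω : Type*} [MeasurableSpace Ω] (μ : Measure Ω) [IsFiniteMeasure μ]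
    {A B C : Set Ω} (hAB : A ⊆ B ∪ C) (hBA : B ⊆ A ∪ C) : |μ.real A - μ.real B| ≤ μ.real C := by
  have h1 := (measureReal_mono (μ := μ) hAB).trans (measureReal_union_le B C)
  have h2 := (measureReal_mono (μ := μ) hBA).trans (measureReal_union_le A C)
  exact abs_le.mpr ⟨by linarith, by linarith⟩

end WeakConvergence

/-! ### Transfer to the Betti number. -/

section Betti

open PreAbstractSimplicialComplex

variable {d : ℕ} {c : ℝ≥0} (k : Type*) [Field k]

theorem betti_eq_copies (hd : 2 ≤ d) {V : Type*} [LinearOrder V] [Fintype V] {G : SimpleGraph V}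
    (hG : Sparse G d) : betti k d G.cliqueComplex = copies (pairings V d) octGraph G := by
  classical
  rw [hG.betti_eq k hd, hG.card_isOct, copies, pairings, Finset.filter_filter]

/-- The Betti number and the number of copies agree on sparse graphs, so their point probabilities
differ by at most the probability of failing sparsity, which tends to zero. -/
theorem tendsto_betti (hd : 2 ≤ d) (hc : c < 1 / (2 ^ (2 * d + 1) * (d : ℝ≥0))) (m : ℕ) :
    Tendsto (fun n : ℕ => (binomialRandom (Fin n) (edgeProb c d n)).real
        {G | betti k d G.cliqueComplex = m}) atTop
      (𝓝 ((poissonMeasure (c ^ (2 * d * (d + 1)) /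
        (2 ^ (d + 1) * (Nat.factorial (d + 1) : ℝ≥0)))).real {m})) := by
  have h1 := tendsto_copies (d := d) (by omega) (le_one_of_lt hd hc) m
  have h2 : Tendsto (fun n : ℕ => (binomialRandom (Fin n) (edgeProb c d n)).real
      {G | betti k d G.cliqueComplex = m} - (binomialRandom (Fin n) (edgeProb c d n)).real
        {G | copies (pairings (Fin n) d) octGraph G = m}) atTop (𝓝 0) := by
    refine squeeze_zero_norm (fun n => abs_measureReal_sub_le _ ?_ ?_) (tendsto_not_sparse hd hc)
    all_goals
      intro G hG
      by_cases hS : Sparse G d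
      · have := betti_eq_copies k hd hS
        simp only [Set.mem_ofPred_eq] at hG
        refine Or.inl ?_
        simp only [Set.mem_ofPred_eq]
        omega
      · exact Or.inr hS
  simpa using h2.add h1

theorem tendsto_sparse (hd : 2 ≤ d) (hc : c < 1 / (2 ^ (2 * d + 1) * (d : ℝ≥0))) :
    Tendsto (fun n : ℕ => binomialRandom (Fin n) (edgeProb c d n) {G | Sparse G d}) atTop
      (𝓝 1) := by
  have h1 := (tendsto_not_sparse hd hc).const_sub 1
  rw [sub_zero] at h1
  rw [← ENNReal.tendsto_toReal_iff (fun _ => measure_ne_top _ _) ENNReal.one_ne_top,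
    ENNReal.toReal_one]
  refine h1.congr fun n => ?_
  rw [← probReal_compl_eq_one_sub MeasurableSet.of_discrete]
  congr 1
  ext G
  simp

end Betti

end RandomGraph

end

theorem theorem1p2 (d : ℕ) (hd : 2 ≤ d) (k : Type*) [Field k] (c : ℝ≥0)
    (hc : c < 1 / (2 ^ (2 * d + 1) * (d : ℝ≥0))) :
    TendstoInDistribution
        (fun (n : ℕ) (G : SimpleGraph (Fin n)) =>
          PreAbstractSimplicialComplex.betti k d G.cliqueComplex)
        atTop (id : ℕ → ℕ)
        (fun n : ℕ => SimpleGraph.binomialRandom (Fin n) (edgeProb c d n))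
        (poissonMeasure (c ^ (2 * d * (d + 1)) / (2 ^ (d + 1) * (Nat.factorial (d + 1) : ℝ≥0)))) ∧
      Tendsto
        (fun n : ℕ => SimpleGraph.binomialRandom (Fin n) (edgeProb c d n)
          {G | PreAbstractSimplicialComplex.HomologyGeneratedByCrossPolytopes k d
            G.cliqueComplex})
        atTop (𝓝 1) := by
  refine ⟨⟨fun n => (Measurable.of_discrete).aemeasurable, aemeasurable_id, ?_⟩, ?_⟩
  · refine RandomGraph.tendsto_probabilityMeasure_nat fun m => ?_
    simp only [ProbabilityMeasure.coe_mk, Measure.map_id]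
    refine (RandomGraph.tendsto_betti k hd hc m).congr fun n => ?_
    rw [map_measureReal_apply Measurable.of_discrete MeasurableSet.of_discrete]
    rfl
  · refine tendsto_of_tendsto_of_tendsto_of_le_of_le (RandomGraph.tendsto_sparse hd hc)
      tendsto_const_nhds (fun n => measure_mono fun G hG => ?_) (fun n => prob_le_one)
    exact hG.homologyGeneratedByCrossPolytopes hd
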